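/- **Setting.** A *$C^*$-precategory* $\mathcal T$ with objects $\mathbb N=\{0,1,2,\dots\}$ consists of complex Banach spaces $\mathcal T(m,n)$ of morphisms from $m$ to $n$, an associative bilinear composition $\mathcal T(m,n)\times\mathcal T(l,m)\to\mathcal T(l,n)$ with $\|ab\|\le\|a\|\|b\|$ (identities are not required), and an antilinear involution $^*:\mathcal T(m,n)\to\mathcal T(n,m)$ with $(ab)^*=b^*a^*$, such that $\|a^*a\|=\|a\|^2$ and $a^*a$ is a positive element of the $C^*$-algebra $\mathcal T(m,m)$ for every $a\in\mathcal T(m,n)$. It is a *right tensor $C^*$-precategory* if it is equipped with linear maps $\otimes1:\mathcal T(m,n)\to\mathcal T(m+1,n+1)$ that preserve composition and $^*$; their iterates are denoted $\otimes 1^k$. An *ideal* $\mathcal K$ in $\mathcal T$ is a family of closed subspaces $\mathcal K(m,n)\subset\mathcal T(m,n)$ that is stable under composition on either side with arbitrary morphisms of $\mathcal T$. Put $J(\mathcal K)(m,n)=\{a\in\mathcal K(m,n):a\otimes1\in\mathcal K(m+1,n+1)\}$. A *right tensor representation* of $\mathcal K$ in a $C^*$-algebra $B$ is a family $\pi=\{\pi_{nm}\}_{n,m\in\mathbb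 N}$ of linear maps $\pi_{nm}:\mathcal K(m,n)\to B$ with $\pi_{nm}(a)^*=\pi_{mn}(a^*)$ and $\pi_{nm}(a)\pi_{m+k,l}(b)=\pi_{n+k,l}((a\otimes1^k)b)$ for all $a\in\mathcal K(m,n)$, $b\in\mathcal K(l,m+k)$, $k,l,m,n\in\mathbb N$. For an ideal $\mathcal J\subset J(\mathcal K)$ in $\mathcal T$, $\pi$ is *coisometric on $\mathcal J$* if $\pi_{nm}(a)=\pi_{n+1,m+1}(a\otimes1)$ for all $a\in\mathcal J(m,n)$. Let $C^*(\pi)$ be the $C^*$-subalgebra of $B$ generated by all the spaces $\pi_{nm}(\mathcal K(m,n))$; $\pi$ *admits a gauge action* if for every $z\in S^1$ there is a $*$-homomorphism $\beta_z:C^*(\pi)\to C^*(\pi)$ with $\beta_z(\pi_{nm}(a))=z^{n-m}\pi_{nm}(a)$ for all $a\in\mathcal K(m,n)$, $n,m\in\mathbb N$. Let $\mathcal O_{\mathcal T}(\mathcal K,\mathcal J)$, with $i=\{i_{(n,m)}\}$, be the universal $C^*$-algebra for right tensor representations of $\mathcal K$ coisometric on $\mathcal J$: it is generated by the image of $i$,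 and every such $\pi$ integrates to a $*$-homomorphism $\Psi_\pi$ on $\mathcal O_{\mathcal T}(\mathcal K,\mathcal J)$ with $\Psi_\pi\circ i_{(n,m)}=\pi_{nm}$. It carries the circle action $\gamma_z(i_{(n,m)}(a))=z^{m-n}i_{(n,m)}(a)$, and for $k\in\mathbb Z$ its $k$-th *spectral subspace* is $\{b:\gamma_z(b)=z^kb\text{ for all }z\in S^1\}$. The *reduction ideal* is $\mathcal R_{\mathcal J}(m,n)=\overline{\operatorname{span}}\bigcup_{k\ge0}\mathcal S_k(m,n)$, where $\mathcal S_0=\{0\}$ and $\mathcal S_{k}(m,n)=\{a\in\mathcal J(m,n):a\otimes1\in\mathcal S_{k-1}(m+1,n+1)\}$ for $k\ge1$. For $m,n\in\mathbb N$ let $\mathcal M(m,n)$ be the space of families $a=(a_{n-i,m-i})_{0\le i\le\min(m,n)}$ with $a_{n-i,m-i}\in\mathcal K(m-i,n-i)$, and for $0\le j\le \min(m,n)$ put $s_j(a)=\sum_{i=j}^{\min(m,n)}a_{n-i,m-i}\otimes1^{i-j}\in\mathcal T(m-j,n-j)$. Let $\mathcal K_{\mathcal J}(m,n)$ be the quotient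 of $\mathcal M(m,n)$ by the null space of the seminorm $$\|a\|^{\mathcal J}_{m,n}=\max\Big\{\|s_0(a)\|,\ \max_{1\le j\le\min(m,n)}\|s_j(a)+\mathcal J(m-j,n-j)\|_{\mathcal T(m-j,n-j)/\mathcal J(m-j,n-j)}\Big\}.$$ Sending $a\in\mathcal K(m,n)$ to the class of the family whose only possibly non-zero entry is $a_{nm}=a$ identifies $\mathcal K(m,n)$ with a subspace of $\mathcal K_{\mathcal J}(m,n)$. If $\pi$ is coisometric on $\mathcal J$, then $\widetilde\pi_{nm}([a])=\sum_{i=0}^{\min(m,n)}\pi_{n-i,m-i}(a_{n-i,m-i})$ defines linear maps $\widetilde\pi_{nm}:\mathcal K_{\mathcal J}(m,n)\to B$. **Theorem** (Gauge-invariant uniqueness for $\mathcal O_{\mathcal T}(\mathcal K,\mathcal J)$). Let $\mathcal K$ and $\mathcal J\subset J(\mathcal K)$ be ideals in a right tensor $C^*$-precategory $\mathcal T$, and let $\pi$ be a right tensor representation of $\mathcal K$ in a $C^*$-algebra $B$, coisometric on $\mathcal J$. The following conditions are equivalent: 1. $\Psi_\pi$ is faithful on the $0$-th spectral subspace of $\mathcal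 O_{\mathcal T}(\mathcal K,\mathcal J)$; 2. $\Psi_\pi$ is faithful on every spectral subspace of $\mathcal O_{\mathcal T}(\mathcal K,\mathcal J)$; 3. $\ker\widetilde\pi=\mathcal R_{\mathcal J}$, that is, $\ker\widetilde\pi_{nm}=\mathcal R_{\mathcal J}(m,n)\subset\mathcal K(m,n)\subset\mathcal K_{\mathcal J}(m,n)$ for all $m,n\in\mathbb N$; 4. $\ker\pi=\mathcal R_{\mathcal J}$, that is, $\ker\pi_{nm}=\mathcal R_{\mathcal J}(m,n)$ for all $m,n\in\mathbb N$, and $$\mathcal J(n,n)=\pi_{nn}^{-1}\Big(\sum_{j=1}^{k}\pi_{n+j,n+j}\big(\mathcal K(n+j,n+j)\big)\Big)\qquad\text{for all } n\in\mathbb N \text{ and all } k\ge1 .$$ Moreover, $\Psi_\pi$ is faithful on $\mathcal O_{\mathcal T}(\mathcal K,\mathcal J)$ if and only if $\pi$ admits a gauge action and one of the equivalent conditions 1–4 holds. -/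

import Mathlib

open scoped ENNReal

universe u v w

/-! ### `C*`-precategories, ideals, right tensorings -/

/-- A `C*`-precategory with objects `Ob`: complex Banach spaces `Hom σ ρ` of morphisms from `σ` to
`ρ`, an associative bilinear contractive composition (no identities are required), and an
antilinear involution `adj` satisfying the `C*`-equality and such that `a* a` is a positive element
of the `C*`-algebra `Hom σ σ` (that is, it is of the form `c* c` with `c` in `Hom σ σ`). -/
structure CStarPrecategory (Ob : Type v) where
  Hom : Ob → Ob → Type u
  [normedHom : ∀ σ ρ, NormedAddCommGroup (Hom σ ρ)]
  [spaceHom : ∀ σ ρ, NormedSpace ℂ (Hom σ ρ)]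
  [completeHom : ∀ σ ρ, CompleteSpace (Hom σ ρ)]
  comp : ∀ {τ σ ρ : Ob}, Hom σ ρ → Hom τ σ → Hom τ ρ
  add_comp : ∀ {τ σ ρ : Ob} (a a' : Hom σ ρ) (b : Hom τ σ),
    comp (a + a') b = comp a b + comp a' b
  comp_add : ∀ {τ σ ρ : Ob} (a : Hom σ ρ) (b b' : Hom τ σ),
    comp a (b + b') = comp a b + comp a b'
  smul_comp : ∀ {τ σ ρ : Ob} (z : ℂ) (a : Hom σ ρ) (b : Hom τ σ),
    comp (z • a) b = z • comp a b
  comp_smul : ∀ {τ σ ρ : Ob} (z : ℂ) (a : Hom σ ρ) (b : Hom τ σ),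
    comp a (z • b) = z • comp a b
  comp_assoc : ∀ {τ σ ρ κ : Ob} (a : Hom ρ κ) (b : Hom σ ρ) (c : Hom τ σ),
    comp (comp a b) c = comp a (comp b c)
  norm_comp_le : ∀ {τ σ ρ : Ob} (a : Hom σ ρ) (b : Hom τ σ), ‖comp a b‖ ≤ ‖a‖ * ‖b‖
  adj : ∀ {σ ρ : Ob}, Hom σ ρ → Hom ρ σ
  adj_adj : ∀ {σ ρ : Ob} (a : Hom σ ρ), adj (adj a) = a
  adj_add : ∀ {σ ρ : Ob} (a b : Hom σ ρ), adj (a + b) = adj a + adj b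
  adj_smul : ∀ {σ ρ : Ob} (z : ℂ) (a : Hom σ ρ), adj (z • a) = (starRingEnd ℂ z) • adj a
  adj_comp : ∀ {τ σ ρ : Ob} (a : Hom σ ρ) (b : Hom τ σ),
    adj (comp a b) = comp (adj b) (adj a)
  norm_adj_comp_self : ∀ {σ ρ : Ob} (a : Hom σ ρ), ‖comp (adj a) a‖ = ‖a‖ ^ 2
  adj_comp_self_pos : ∀ {σ ρ : Ob} (a : Hom σ ρ), ∃ c : Hom σ σ, comp (adj a) a = comp (adj c) c

attribute [instance] CStarPrecategory.normedHom CStarPrecategory.spaceHom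
  CStarPrecategory.completeHom

namespace CStarPrecategory

variable {Ob : Type v} (C : CStarPrecategory.{u, v} Ob)

/-- The endomorphisms of an object, as a (not necessarily unital) `C*`-algebra. -/
def EndAlg (σ : Ob) : Type u := C.Hom σ σ

noncomputable instance (σ : Ob) : NormedAddCommGroup (C.EndAlg σ) :=
  inferInstanceAs (NormedAddCommGroup (C.Hom σ σ))

noncomputable instance (σ : Ob) : NormedSpace ℂ (C.EndAlg σ) :=
  inferInstanceAs (NormedSpace ℂ (C.Hom σ σ))

instance (σ : Ob) : CompleteSpace (C.EndAlg σ) :=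
  inferInstanceAs (CompleteSpace (C.Hom σ σ))

theorem zero_comp {τ σ ρ : Ob} (b : C.Hom τ σ) : C.comp (0 : C.Hom σ ρ) b = 0 := by
  have h := C.smul_comp (0 : ℂ) (0 : C.Hom σ ρ) b
  simpa using h

theorem comp_zero {τ σ ρ : Ob} (a : C.Hom σ ρ) : C.comp a (0 : C.Hom τ σ) = 0 := by
  have h := C.comp_smul (0 : ℂ) a (0 : C.Hom τ σ)
  simpa using h

theorem adj_sub {σ ρ : Ob} (a b : C.Hom σ ρ) : C.adj (a - b) = C.adj a - C.adj b := by
  have h := C.adj_add (a - b) b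
  rw [sub_add_cancel] at h
  rw [h, add_sub_cancel_right]

theorem comp_sub {τ σ ρ : Ob} (a : C.Hom σ ρ) (b c : C.Hom τ σ) :
    C.comp a (b - c) = C.comp a b - C.comp a c := by
  have h := C.comp_add a (b - c) c
  rw [sub_add_cancel] at h
  rw [h, add_sub_cancel_right]

theorem sub_comp {τ σ ρ : Ob} (a b : C.Hom σ ρ) (c : C.Hom τ σ) :
    C.comp (a - b) c = C.comp a c - C.comp b c := by
  have h := C.add_comp (a - b) b c
  rw [sub_add_cancel] at h
  rw [h, add_sub_cancel_right]

noncomputable instance (σ : Ob) : NonUnitalCStarAlgebra (C.EndAlg σ) where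
  __ := (inferInstance : NormedAddCommGroup (C.EndAlg σ))
  __ := (inferInstance : NormedSpace ℂ (C.EndAlg σ))
  __ := (inferInstance : CompleteSpace (C.EndAlg σ))
  mul a b := C.comp (τ := σ) (σ := σ) (ρ := σ) a b
  left_distrib a b c := C.comp_add (τ := σ) (σ := σ) (ρ := σ) a b c
  right_distrib a b c := C.add_comp (τ := σ) (σ := σ) (ρ := σ) a b c
  zero_mul b := C.zero_comp (τ := σ) (σ := σ) (ρ := σ) b
  mul_zero a := C.comp_zero (τ := σ) (σ := σ) (ρ := σ) a
  mul_assoc a b c := C.comp_assoc (τ := σ) (σ := σ) (ρ := σ) (κ := σ) a b c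
  norm_mul_le a b := C.norm_comp_le (τ := σ) (σ := σ) (ρ := σ) a b
  star a := C.adj (σ := σ) (ρ := σ) a
  star_involutive a := C.adj_adj (σ := σ) (ρ := σ) a
  star_mul a b := C.adj_comp (τ := σ) (σ := σ) (ρ := σ) a b
  star_add a b := C.adj_add (σ := σ) (ρ := σ) a b
  norm_mul_self_le a := by
    have h := C.norm_adj_comp_self (σ := σ) (ρ := σ) a
    rw [sq] at h
    exact h.ge
  smul_assoc z a b := C.smul_comp (τ := σ) (σ := σ) (ρ := σ) z a b
  smul_comm z a b := (C.comp_smul (τ := σ) (σ := σ) (ρ := σ) z a b).symm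
  star_smul z a := C.adj_smul (σ := σ) (ρ := σ) z a

/-- A (closed two-sided) ideal in a `C*`-precategory. -/
structure Ideal where
  space : ∀ σ ρ : Ob, Submodule ℂ (C.Hom σ ρ)
  isClosed_space : ∀ σ ρ : Ob, IsClosed (space σ ρ : Set (C.Hom σ ρ))
  comp_mem : ∀ {τ σ ρ : Ob} (a : C.Hom σ ρ) {b : C.Hom τ σ}, b ∈ space τ σ →
    C.comp a b ∈ space τ ρ
  mem_comp : ∀ {τ σ ρ : Ob} {a : C.Hom σ ρ} (b : C.Hom τ σ), a ∈ space σ ρ →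
    C.comp a b ∈ space τ ρ

set_option linter.unusedSimpArgs false in
/-- For selfadjoint `h` and `δ > 0` there is `f` such that `e = h f` is selfadjoint and
`(1 - e) h (1 - e)` has norm at most `δ`. -/
theorem approx_aux {A : Type u} [NonUnitalCStarAlgebra A] (h : A) (hh : IsSelfAdjoint h) (δ : ℝ)
    (hδ : 0 < δ) : ∃ f : A, IsSelfAdjoint (h * f) ∧
      ‖h - h * (h * f) - (h * f) * h + (h * f) * h * (h * f)‖ ≤ δ := by
  set φ : ℝ → ℝ := fun t => t / (t ^ 2 + δ ^ 2)
  have hpos : ∀ t : ℝ, 0 < t ^ 2 + δ ^ 2 := fun t => by positivity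
  have hc : Continuous φ := by
    apply Continuous.div <;> first | fun_prop | exact fun t => (hpos t).ne'
  have h0 : φ 0 = 0 := by simp [φ]
  set g : ℝ → ℝ := fun t => t * φ t
  have hgc : Continuous g := by fun_prop
  have hg0 : g 0 = 0 := by simp [g]
  have e1 : h * cfcₙ φ h = cfcₙ g h := by
    nth_rw 1 [← cfcₙ_id ℝ h]
    rw [← cfcₙ_mul id φ h]
    rfl
  have e2 : h - h * cfcₙ g h - cfcₙ g h * h + cfcₙ g h * h * cfcₙ g h
      = cfcₙ (fun t => t - t * g t - g t * t + g t * t * g t) h := by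
    rw [cfcₙ_add (f := fun t => t - t * g t - g t * t) (g := fun t => g t * t * g t) h
        (by fun_prop) (by simp [hg0]) (by fun_prop) (by simp [hg0]),
      cfcₙ_sub (f := fun t => t - t * g t) (g := fun t => g t * t) h
        (by fun_prop) (by simp [hg0]) (by fun_prop) (by simp [hg0]),
      cfcₙ_sub (f := fun t => t) (g := fun t => t * g t) h
        (by fun_prop) (by simp [hg0]) (by fun_prop) (by simp [hg0]),
      cfcₙ_mul (f := fun t => g t * t) (g := g) h (by fun_prop) (by simp [hg0]) (by fun_prop) (by simp [hg0]),
      cfcₙ_mul (f := fun t => t) (g := g) h (by fun_prop) (by simp [hg0]) (by fun_prop) (by simp [hg0]),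
      cfcₙ_mul (f := g) (g := fun t => t) h (by fun_prop) (by simp [hg0]) (by fun_prop) (by simp [hg0]),
      cfcₙ_id' ℝ h]
  refine ⟨cfcₙ φ h, ?_, ?_⟩
  · rw [e1]; exact cfcₙ_predicate g h
  · rw [e1, e2]
    apply norm_cfcₙ_le
    intro t _
    have e3 : t - t * g t - g t * t + g t * t * g t = t * (δ ^ 2) ^ 2 / (t ^ 2 + δ ^ 2) ^ 2 := by
      have := (hpos t).ne'
      simp only [g, φ]
      field_simp
      ring
    rw [e3, Real.norm_eq_abs, abs_div, abs_of_pos (pow_pos (hpos t) 2),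
      div_le_iff₀ (pow_pos (hpos t) 2), abs_mul, abs_of_pos (by positivity : 0 < (δ ^ 2) ^ 2)]
    have h1 : |t| * δ ≤ t ^ 2 + δ ^ 2 := by
      nlinarith [sq_nonneg (|t| - δ), sq_abs t, sq_nonneg t, sq_nonneg δ]
    have h2 : δ ^ 2 ≤ t ^ 2 + δ ^ 2 := by nlinarith [sq_nonneg t]
    have h3 := mul_le_mul h1 h2 (by positivity) (hpos t).le
    nlinarith [mul_le_mul_of_nonneg_left h3 hδ.le]

variable {C}

/-- Ideals in `C*`-precategories are automatically selfadjoint. -/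
theorem Ideal.adj_mem (K : C.Ideal) {σ ρ : Ob} {a : C.Hom σ ρ} (ha : a ∈ K.space σ ρ) :
    C.adj a ∈ K.space ρ σ := by
  set h : C.EndAlg ρ := C.comp a (C.adj a) with hh
  have hK : C.comp a (C.adj a) ∈ K.space ρ ρ := K.mem_comp _ ha
  have hsa : IsSelfAdjoint h := by
    change C.adj (C.comp a (C.adj a)) = C.comp a (C.adj a)
    rw [C.adj_comp, C.adj_adj]
  have hcl := K.isClosed_space ρ σ
  rw [← SetLike.mem_coe, ← hcl.closure_eq, Metric.mem_closure_iff]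
  intro ε hε
  obtain ⟨f, hf1, hf2⟩ := approx_aux h hsa ((ε / 2) ^ 2) (by positivity)
  set e : C.Hom ρ ρ := C.comp h f with he
  have heK : e ∈ K.space ρ ρ := K.mem_comp _ hK
  have hes : C.adj e = e := hf1
  refine ⟨C.comp (C.adj a) e, K.comp_mem _ heK, ?_⟩
  rw [dist_eq_norm]
  have key : C.comp (C.adj (C.adj a - C.comp (C.adj a) e)) (C.adj a - C.comp (C.adj a) e)
      = (h - h * (h * f) - (h * f) * h + (h * f) * h * (h * f) : C.EndAlg ρ) := by
    change _ = C.comp a (C.adj a) - C.comp (C.comp a (C.adj a)) e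
      - C.comp e (C.comp a (C.adj a)) + C.comp (C.comp e (C.comp a (C.adj a))) e
    rw [C.adj_sub, C.adj_comp, C.adj_adj, hes, C.comp_sub, C.sub_comp, C.sub_comp]
    simp only [C.comp_assoc]
    abel
  have h2 := C.norm_adj_comp_self (C.adj a - C.comp (C.adj a) e)
  rw [key] at h2
  have h3 : ‖C.adj a - C.comp (C.adj a) e‖ ^ 2 ≤ (ε / 2) ^ 2 := h2 ▸ hf2
  have h4 := abs_le_of_sq_le_sq h3 (by positivity)
  rw [abs_of_nonneg (norm_nonneg _)] at h4
  linarith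

end CStarPrecategory

/-- A right tensor `C*`-precategory: a `C*`-precategory with objects `0, 1, 2, …` and an
endomorphism `a ↦ a ⊗ 1` sending the object `n` to `n + 1`. -/
structure RightTensorPrecategory extends CStarPrecategory.{u, 0} ℕ where
  tensor : ∀ {m n : ℕ}, Hom m n →ₗ[ℂ] Hom (m + 1) (n + 1)
  tensor_comp : ∀ {l m n : ℕ} (a : Hom m n) (b : Hom l m),
    tensor (comp a b) = comp (tensor a) (tensor b)
  tensor_adj : ∀ {m n : ℕ} (a : Hom m n), tensor (adj a) = adj (tensor a)

namespace RightTensorPrecategory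

variable (T : RightTensorPrecategory.{u})

/-- Ideals of a right tensor `C*`-precategory (no compatibility with the right tensoring). -/
abbrev Ideal := T.toCStarPrecategory.Ideal

variable {T}

/-- The iterated right tensoring `a ↦ a ⊗ 1^k`. -/
def tensorPow {m n : ℕ} (a : T.Hom m n) : ∀ k : ℕ, T.Hom (m + k) (n + k)
  | 0 => a
  | k + 1 => T.tensor (tensorPow a k)

/-- `J(K)(m,n) = {a ∈ K(m,n) : a ⊗ 1 ∈ K(m+1,n+1)}`. -/
def idealJ (K : T.Ideal) (m n : ℕ) : Submodule ℂ (T.Hom m n) :=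
  K.space m n ⊓ (K.space (m + 1) (n + 1)).comap T.tensor

/-- The spaces `S_k` in the saturation of `N`: `S_0 = N`, `S_{k+1} = J ∩ (⊗1)⁻¹(S_k)`. -/
def saturationStep (J : T.Ideal) (N : ∀ m n : ℕ, Submodule ℂ (T.Hom m n)) :
    ℕ → ∀ m n : ℕ, Submodule ℂ (T.Hom m n)
  | 0, m, n => N m n
  | k + 1, m, n => J.space m n ⊓ (saturationStep J N k (m + 1) (n + 1)).comap T.tensor

/-- The `J`-saturation of `N`: the closed linear span of the `S_k`. -/
def saturation (J : T.Ideal) (N : ∀ m n : ℕ, Submodule ℂ (T.Hom m n)) (m n : ℕ) :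
    Submodule ℂ (T.Hom m n) :=
  (⨆ k : ℕ, saturationStep J N k m n).topologicalClosure

/-- The reduction ideal `R_J`: the `J`-saturation of the zero ideal. -/
def reductionIdeal (J : T.Ideal) (m n : ℕ) : Submodule ℂ (T.Hom m n) :=
  saturation J (fun _ _ => ⊥) m n

/-! ### Right tensor representations -/

/-- A right tensor representation `π = {π_{nm}}` of the ideal `K` in a `C*`-algebra `B`, where
`π_{nm}` is defined on `K(m,n)`. The case `k = 0` of `map_tensor` is multiplicativity. -/
structure Representation (K : T.Ideal) (B : Type w) [NonUnitalCStarAlgebra B] where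
  map : ∀ n m : ℕ, K.space m n →ₗ[ℂ] B
  map_adj : ∀ (n m : ℕ) (a : K.space m n),
    star (map n m a) = map m n ⟨T.adj a.1, K.adj_mem a.2⟩
  map_tensor : ∀ (k l m n : ℕ) (a : K.space m n) (b : K.space l (m + k)),
    map n m a * map (m + k) l b = map (n + k) l ⟨T.comp (tensorPow a.1 k) b.1, K.comp_mem _ b.2⟩

namespace Representation

variable {K : T.Ideal} {B : Type w} [NonUnitalCStarAlgebra B]

/-- `π` is coisometric on `J`: `π_{nm}(a) = π_{n+1,m+1}(a ⊗ 1)` for `a ∈ J(m,n)`. (The two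
membership proofs are automatic when `J ⊆ J(K)`.) -/
def IsCoisometricOn (π : Representation K B) (J : T.Ideal) : Prop :=
  ∀ (n m : ℕ) (a : T.Hom m n) (h : a ∈ K.space m n)
    (h' : T.tensor a ∈ K.space (m + 1) (n + 1)), a ∈ J.space m n →
    π.map n m ⟨a, h⟩ = π.map (n + 1) (m + 1) ⟨T.tensor a, h'⟩

theorem map_mul (π : Representation K B) {l m n : ℕ} (a : K.space m n) (b : K.space l m) :
    π.map n m a * π.map m l b = π.map n l ⟨T.comp a.1 b.1, K.comp_mem _ b.2⟩ :=
  π.map_tensor 0 l m n a b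

end Representation

/-- The diagonal space `K(m,m)` as a closed `*`-subalgebra of the `C*`-algebra `T(m,m)`. -/
def diagSubalgebra (K : T.Ideal) (m : ℕ) : NonUnitalStarSubalgebra ℂ (T.EndAlg m) where
  carrier := {a | (show T.Hom m m from a) ∈ K.space m m}
  add_mem' ha hb := (K.space m m).add_mem ha hb
  zero_mem' := (K.space m m).zero_mem
  mul_mem' {a b} _ hb := K.comp_mem (show T.Hom m m from a) (b := (show T.Hom m m from b)) hb
  smul_mem' c _ ha := (K.space m m).smul_mem c ha
  star_mem' {a} ha := K.adj_mem (a := (show T.Hom m m from a)) ha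

instance (K : T.Ideal) (m : ℕ) : IsClosed (diagSubalgebra K m : Set (T.EndAlg m)) :=
  K.isClosed_space m m

namespace Representation

variable {K : T.Ideal} {B : Type w} [NonUnitalCStarAlgebra B]

/-- `π_{mm}` as a `*`-homomorphism. -/
def diagHom (π : Representation K B) (m : ℕ) : diagSubalgebra K m →⋆ₙₐ[ℂ] B where
  toFun a := π.map m m ⟨a.1, a.2⟩
  map_smul' c a := (π.map m m).map_smul c ⟨a.1, a.2⟩
  map_zero' := (π.map m m).map_zero
  map_add' a b := (π.map m m).map_add ⟨a.1, a.2⟩ ⟨b.1, b.2⟩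
  map_mul' a b := (π.map_mul (l := m) (m := m) (n := m) ⟨a.1, a.2⟩ ⟨b.1, b.2⟩).symm
  map_star' a := (π.map_adj m m ⟨a.1, a.2⟩).symm

/-- Representations are contractive. -/
theorem norm_map_le (π : Representation K B) {n m : ℕ} (a : K.space m n) :
    ‖π.map n m a‖ ≤ ‖a‖ := by
  have h1 : ‖π.map n m a‖ * ‖π.map n m a‖ ≤ ‖a‖ ^ 2 := by
    rw [← CStarRing.norm_star_mul_self, π.map_adj, π.map_mul]
    have h := NonUnitalStarAlgHom.norm_apply_le (π.diagHom m)
      ⟨T.comp (T.adj a.1) a.1, K.comp_mem _ a.2⟩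
    refine h.trans (le_of_eq ?_)
    exact T.norm_adj_comp_self a.1
  rw [← sq] at h1
  exact (abs_le_of_sq_le_sq' h1 (norm_nonneg _)).2

/-- The representation `z^{m-n} π_{nm}`, for `z` on the unit circle. -/
noncomputable def twist (π : Representation K B) (z : Circle) : Representation K B where
  map n m := ((z ^ ((m : ℤ) - n) : Circle) : ℂ) • π.map n m
  map_adj n m a := by
    rw [LinearMap.smul_apply, LinearMap.smul_apply, star_smul, π.map_adj]
    congr 1
    rw [← starRingEnd_apply, ← Circle.coe_inv_eq_conj, ← zpow_neg, neg_sub]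
  map_tensor k l m n a b := by
    rw [LinearMap.smul_apply, LinearMap.smul_apply, LinearMap.smul_apply, smul_mul_smul_comm,
      π.map_tensor]
    congr 1
    rw [← Circle.coe_mul, ← zpow_add]
    congr 2
    push_cast
    ring

theorem IsCoisometricOn.twist {π : Representation K B} {J : T.Ideal} (h : π.IsCoisometricOn J)
    (z : Circle) : (π.twist z).IsCoisometricOn J := by
  intro n m a h1 h2 ha
  simp only [Representation.twist, LinearMap.smul_apply]
  rw [h n m a h1 h2 ha]
  congr 3
  push_cast
  ring

/-- `C*(π)`: the `C*`-subalgebra of `B` generated by the spaces `π_{nm}(K(m,n))`. -/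
def generatedAlgebra (π : Representation K B) : NonUnitalStarSubalgebra ℂ B :=
  (NonUnitalStarAlgebra.adjoin ℂ
    {b : B | ∃ (n m : ℕ) (a : K.space m n), π.map n m a = b}).topologicalClosure

instance (π : Representation K B) : IsClosed (π.generatedAlgebra : Set B) :=
  NonUnitalStarSubalgebra.isClosed_topologicalClosure _

theorem map_mem_generatedAlgebra (π : Representation K B) {n m : ℕ} (a : K.space m n) :
    π.map n m a ∈ π.generatedAlgebra :=
  NonUnitalStarSubalgebra.le_topologicalClosure _
    (NonUnitalStarAlgebra.subset_adjoin ℂ _ ⟨n, m, a, rfl⟩)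

/-- `π` admits a gauge action: for every `z` in the circle there is a `*`-homomorphism `β_z` of
`C*(π)` with `β_z(π_{nm}(a)) = z^{n-m} π_{nm}(a)`. -/
def AdmitsGaugeAction (π : Representation K B) : Prop :=
  ∀ z : Circle, ∃ β : π.generatedAlgebra →⋆ₙₐ[ℂ] π.generatedAlgebra,
    ∀ (n m : ℕ) (a : K.space m n),
      β ⟨π.map n m a, π.map_mem_generatedAlgebra a⟩ =
        ((z ^ ((n : ℤ) - m) : Circle) : ℂ) • ⟨π.map n m a, π.map_mem_generatedAlgebra a⟩

end Representation

/-! ### The universal algebra `O_T(K,J)` -/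

/-- All right tensor representations of `K` that are coisometric on `J`. -/
structure CoisometricRep (K J : T.Ideal) where
  alg : Type u
  [inst : NonUnitalCStarAlgebra alg]
  rep : Representation K alg
  coisometric : rep.IsCoisometricOn J

attribute [instance] CoisometricRep.inst

/-- The `C*`-algebra of bounded families indexed by all representations of `K` coisometric on
`J`. -/
abbrev AmbientAlg (K J : T.Ideal) : Type (u + 1) :=
  lp (fun ω : CoisometricRep K J => ω.alg) ∞

/-- The direct sum of all right tensor representations of `K` that are coisometric on `J`. -/
noncomputable def ambientRep (K J : T.Ideal) : Representation K (AmbientAlg K J) where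
  map n m :=
    { toFun a := ⟨fun ω => ω.rep.map n m a, memℓp_infty
        ⟨‖a‖, by rintro _ ⟨ω, rfl⟩; exact ω.rep.norm_map_le a⟩⟩
      map_add' a b := by ext ω; exact (ω.rep.map n m).map_add a b
      map_smul' c a := by ext ω; exact (ω.rep.map n m).map_smul c a }
  map_adj n m a := by ext ω; exact ω.rep.map_adj n m a
  map_tensor k l m n a b := by ext ω; exact ω.rep.map_tensor k l m n a b

/-- The `C*`-algebra `O_T(K,J)`: the `C*`-algebra generated by the direct sum of all right tensor
representations of `K` that are coisometric on `J`. -/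
def UnivAlg (K J : T.Ideal) : Type (u + 1) := (ambientRep K J).generatedAlgebra

noncomputable instance (K J : T.Ideal) : NonUnitalCStarAlgebra (UnivAlg K J) :=
  inferInstanceAs (NonUnitalCStarAlgebra (ambientRep K J).generatedAlgebra)

/-- The universal representation `i = {i_{(n,m)}}` of `K` in `O_T(K,J)`. -/
noncomputable def univRep (K J : T.Ideal) : Representation K (UnivAlg K J) where
  map n m := ((ambientRep K J).map n m).codRestrict
    (ambientRep K J).generatedAlgebra.toSubmodule
    (fun a => (ambientRep K J).map_mem_generatedAlgebra a)
  map_adj n m a := Subtype.ext ((ambientRep K J).map_adj n m a)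
  map_tensor k l m n a b := Subtype.ext ((ambientRep K J).map_tensor k l m n a b)

theorem univRep_isCoisometricOn (K J : T.Ideal) : (univRep K J).IsCoisometricOn J := by
  intro n m a h h' ha
  apply Subtype.ext
  ext ω
  exact ω.coisometric n m a h h' ha

/-- The representation `Ψ_π` of `O_T(K,J)` to which `π` integrates. -/
noncomputable def integrated {K J : T.Ideal} {B : Type u} [NonUnitalCStarAlgebra B]
    (π : Representation K B) (hπ : π.IsCoisometricOn J) : UnivAlg K J →⋆ₙₐ[ℂ] B where
  toFun x := (x.1 : ∀ ω : CoisometricRep K J, ω.alg) ⟨B, π, hπ⟩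
  map_smul' _ _ := rfl
  map_zero' := rfl
  map_add' _ _ := rfl
  map_mul' _ _ := rfl
  map_star' _ := rfl

theorem integrated_univRep {K J : T.Ideal} {B : Type u} [NonUnitalCStarAlgebra B]
    (π : Representation K B) (hπ : π.IsCoisometricOn J) (n m : ℕ) (a : K.space m n) :
    integrated π hπ ((univRep K J).map n m a) = π.map n m a := rfl

/-- The twist by `z` of an index of the family of all representations. -/
noncomputable def CoisometricRep.twist {K J : T.Ideal} (z : Circle) (ω : CoisometricRep K J) :
    CoisometricRep K J :=
  ⟨ω.alg, ω.rep.twist z, ω.coisometric.twist z⟩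

/-- The endomorphism of the ambient algebra that induces the gauge action. -/
noncomputable def ambientGauge (K J : T.Ideal) (z : Circle) :
    AmbientAlg K J →⋆ₙₐ[ℂ] AmbientAlg K J where
  toFun x := ⟨fun ω => (x : ∀ ω : CoisometricRep K J, ω.alg) (ω.twist z), memℓp_infty
    ⟨‖x‖, by rintro _ ⟨ω, rfl⟩; exact lp.norm_apply_le_norm ENNReal.top_ne_zero x (ω.twist z)⟩⟩
  map_smul' _ _ := rfl
  map_zero' := rfl
  map_add' _ _ := rfl
  map_mul' _ _ := rfl
  map_star' _ := rfl

theorem ambientGauge_map (K J : T.Ideal) (z : Circle) (n m : ℕ) (a : K.space m n) :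
    ambientGauge K J z ((ambientRep K J).map n m a) =
      ((z ^ ((m : ℤ) - n) : Circle) : ℂ) • (ambientRep K J).map n m a := by
  ext ω
  rfl

theorem ambientGauge_mem (K J : T.Ideal) (z : Circle) {x : AmbientAlg K J}
    (hx : x ∈ (ambientRep K J).generatedAlgebra) :
    ambientGauge K J z x ∈ (ambientRep K J).generatedAlgebra := by
  have hcont : Continuous (ambientGauge K J z) := by
    have := NonUnitalStarAlgHom.norm_apply_le (ambientGauge K J z)
    exact AddMonoidHomClass.continuous_of_bound (ambientGauge K J z) 1
      (fun x => by simpa using this x)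
  have hle : (ambientRep K J).generatedAlgebra ≤
      (ambientRep K J).generatedAlgebra.comap (ambientGauge K J z) := by
    refine NonUnitalStarSubalgebra.topologicalClosure_minimal _
      (NonUnitalStarAlgebra.adjoin_le ?_) ?_
    · rintro _ ⟨n, m, a, rfl⟩
      change ambientGauge K J z _ ∈ (ambientRep K J).generatedAlgebra
      rw [ambientGauge_map]
      exact SMulMemClass.smul_mem _ ((ambientRep K J).map_mem_generatedAlgebra a)
    · exact (NonUnitalStarSubalgebra.isClosed_topologicalClosure _).preimage hcont
  exact hle hx

/-- The gauge action `γ` on `O_T(K,J)`; it is determined by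
`γ_z(i_{(n,m)}(a)) = z^{m-n} i_{(n,m)}(a)`. -/
noncomputable def gauge (K J : T.Ideal) (z : Circle) : UnivAlg K J →⋆ₙₐ[ℂ] UnivAlg K J where
  toFun x := ⟨ambientGauge K J z x.1, ambientGauge_mem K J z x.2⟩
  map_smul' _ _ := rfl
  map_zero' := rfl
  map_add' _ _ := rfl
  map_mul' _ _ := rfl
  map_star' _ := rfl

theorem gauge_univRep (K J : T.Ideal) (z : Circle) (n m : ℕ) (a : K.space m n) :
    gauge K J z ((univRep K J).map n m a) =
      ((z ^ ((m : ℤ) - n) : Circle) : ℂ) • (univRep K J).map n m a :=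
  Subtype.ext (ambientGauge_map K J z n m a)

/-- The `k`-th spectral subspace `{b : γ_z(b) = z^k b for all z}` of `O_T(K,J)`. -/
def spectralSubspace (K J : T.Ideal) (k : ℤ) : Set (UnivAlg K J) :=
  {b | ∀ z : Circle, gauge K J z b = ((z ^ k : Circle) : ℂ) • b}

/-! ### The spaces `K_J(m,n)` and the extension `π̃` -/

/-- The space `M_T(K)` of infinite matrices `{a_{nm}}` with finitely many non-zero entries
`a_{nm} ∈ K(m,n)`. -/
def Matrices (K : T.Ideal) : Type u := DirectSum (ℕ × ℕ) fun x => K.space x.2 x.1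

noncomputable instance (K : T.Ideal) : AddCommGroup (Matrices K) :=
  inferInstanceAs (AddCommGroup (DirectSum (ℕ × ℕ) fun x => K.space x.2 x.1))

noncomputable instance (K : T.Ideal) : Module ℂ (Matrices K) :=
  inferInstanceAs (Module ℂ (DirectSum (ℕ × ℕ) fun x => K.space x.2 x.1))

/-- The matrix whose only non-zero entry is `a`, at the place `(n,m)`. -/
noncomputable def single (K : T.Ideal) (n m : ℕ) : K.space m n →ₗ[ℂ] Matrices K :=
  DirectSum.lof ℂ (ℕ × ℕ) (fun x => K.space x.2 x.1) (n, m)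

/-- The entry `a_{nm}`. -/
noncomputable def entry (K : T.Ideal) (n m : ℕ) : Matrices K →ₗ[ℂ] K.space m n :=
  DirectSum.component ℂ (ℕ × ℕ) (fun x => K.space x.2 x.1) (n, m)

/-- The space `M(m,n)` of matrices supported on the diagonal through `(n,m)`, up to that place. -/
def diagMatrices (K : T.Ideal) (m n : ℕ) : Submodule ℂ (Matrices K) where
  carrier := {a | ∀ p q : ℕ, entry K p q a ≠ 0 → q + n = p + m ∧ p ≤ n}
  add_mem' {a b} ha hb p q h := by
    by_cases h1 : entry K p q a = 0
    · refine hb p q fun h2 => h ?_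
      rw [map_add, h1, h2, add_zero]
    · exact ha p q h1
  zero_mem' p q h := (h (map_zero _)).elim
  smul_mem' c a ha p q h := by
    refine ha p q fun h1 => h ?_
    rw [map_smul, h1, smul_zero]

/-- The element `∑_{0 ≤ i ≤ min(n,m)} a_{n-i,m-i} ⊗ 1^i` of `T(m,n)`. -/
noncomputable def diagSum (K : T.Ideal) : ∀ n m : ℕ, Matrices K →ₗ[ℂ] T.Hom m n
  | 0, m => (K.space m 0).subtype ∘ₗ entry K 0 m
  | n + 1, 0 => (K.space 0 (n + 1)).subtype ∘ₗ entry K (n + 1) 0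
  | n + 1, m + 1 => T.tensor ∘ₗ diagSum K n m +
      (K.space (m + 1) (n + 1)).subtype ∘ₗ entry K (n + 1) (m + 1)

/-- The seminorm `‖·‖^J_{m,n}` on `M(m,n)`: the maximum of the norm of `diagSum` at the place
`(n,m)` and of the quotient norms modulo `J` of `diagSum` at the earlier places of the diagonal. -/
noncomputable def seminormJ (K J : T.Ideal) (m n : ℕ) : Seminorm ℂ (diagMatrices K m n) :=
  ((Finset.Icc 1 (min m n)).sup fun i =>
    (normSeminorm ℂ (T.Hom (m - i) (n - i) ⧸ J.space (m - i) (n - i))).comp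
      ((J.space (m - i) (n - i)).mkQ ∘ₗ diagSum K (n - i) (m - i) ∘ₗ
        (diagMatrices K m n).subtype)) ⊔
  (normSeminorm ℂ (T.Hom m n)).comp (diagSum K n m ∘ₗ (diagMatrices K m n).subtype)

/-- The null space of `‖·‖^J_{m,n}`. -/
noncomputable def nullSpace (K J : T.Ideal) (m n : ℕ) : Submodule ℂ (diagMatrices K m n) where
  carrier := {a | seminormJ K J m n a = 0}
  add_mem' {a b} ha hb := le_antisymm
    ((map_add_le_add (seminormJ K J m n) a b).trans_eq (by
      rw [Set.mem_ofPred_eq] at ha hb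
      rw [ha, hb, add_zero])) (apply_nonneg _ _)
  zero_mem' := map_zero (seminormJ K J m n)
  smul_mem' c a ha := by
    rw [Set.mem_ofPred_eq] at ha ⊢
    rw [map_smul_eq_mul, ha, mul_zero]

/-- The space `K_J(m,n) = M(m,n) / ‖·‖^J_{m,n}`. -/
abbrev quotientSpace (K J : T.Ideal) (m n : ℕ) : Type u :=
  diagMatrices K m n ⧸ nullSpace K J m n

theorem single_mem (K : T.Ideal) (m n : ℕ) (a : K.space m n) :
    single K n m a ∈ diagMatrices K m n := by
  intro p q h
  by_cases hpq : (n, m) = (p, q)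
  · obtain ⟨rfl, rfl⟩ := Prod.mk.inj hpq
    exact ⟨by omega, le_rfl⟩
  · refine (h ?_).elim
    exact DirectSum.of_eq_of_ne _ _ _ (Ne.symm hpq)

/-- The embedding `K(m,n) ⊆ K_J(m,n)`, sending `a` to the class of the matrix whose only non-zero
entry is `a`. -/
noncomputable def inclusion (K J : T.Ideal) (m n : ℕ) : K.space m n →ₗ[ℂ] quotientSpace K J m n :=
  (nullSpace K J m n).mkQ ∘ₗ (single K n m).codRestrict (diagMatrices K m n) (single_mem K m n)

namespace Representation

variable {K : T.Ideal} {B : Type w} [NonUnitalCStarAlgebra B]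

/-- The map `{a_{nm}} ↦ ∑_{n,m} π_{nm}(a_{nm})` on `M_T(K)`. -/
noncomputable def matrixMap (π : Representation K B) : Matrices K →ₗ[ℂ] B :=
  DirectSum.toModule ℂ (ℕ × ℕ) B fun x => π.map x.1 x.2

theorem matrixMap_single (π : Representation K B) (n m : ℕ) (a : K.space m n) :
    π.matrixMap (single K n m a) = π.map n m a :=
  DirectSum.toModule_lof (ι := ℕ × ℕ) (M := fun x => K.space x.2 x.1) ℂ (n, m) a

theorem entry_single_self (n m p q : ℕ) (hn : n = p) (hm : m = q) (a : Matrices K) :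
    entry K p q (single K n m (entry K n m a)) = entry K p q a := by
  subst hn hm
  exact DirectSum.of_eq_same _ _

theorem entry_single_ne (n m p q : ℕ) (h : n ≠ p) (a : K.space m n) :
    entry K p q (single K n m a) = 0 :=
  DirectSum.of_eq_of_ne _ _ _ fun h' => h (Prod.mk.inj h').1.symm

theorem eq_sum_single {m n : ℕ} {a : Matrices K} (ha : a ∈ diagMatrices K m n) :
    a = ∑ i ∈ Finset.range (min n m + 1), single K (n - i) (m - i) (entry K (n - i) (m - i) a) := by
  refine DFinsupp.ext fun x => ?_
  obtain ⟨p, q⟩ := x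
  change entry K p q a = entry K p q _
  rw [map_sum]
  by_cases h : q + n = p + m ∧ p ≤ n
  · rw [Finset.sum_eq_single (n - p)]
    · rw [entry_single_self] <;> omega
    · intro i hi hne
      rw [Finset.mem_range] at hi
      exact entry_single_ne _ _ _ _ (by omega) _
    · intro hi
      rw [Finset.mem_range] at hi
      omega
  · have h0 : entry K p q a = 0 := by
      by_contra h1
      exact h (ha p q h1)
    rw [h0, Finset.sum_eq_zero]
    intro i hi
    rw [Finset.mem_range] at hi
    by_cases hp : n - i = p
    · by_cases hq : m - i = q
      · omega
      · exact DirectSum.of_eq_of_ne _ _ _ fun h' => hq (Prod.mk.inj h').2.symm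
    · exact entry_single_ne _ _ _ _ hp _

theorem matrixMap_eq (π : Representation K B) {m n : ℕ} {a : Matrices K}
    (ha : a ∈ diagMatrices K m n) :
    π.matrixMap a =
      ∑ i ∈ Finset.range (min n m + 1), π.map (n - i) (m - i) (entry K (n - i) (m - i) a) := by
  conv_lhs => rw [eq_sum_single ha]
  rw [map_sum]
  exact Finset.sum_congr rfl fun i _ => π.matrixMap_single _ _ _

theorem sum_eq_map_diagSum (π : Representation K B) {J : T.Ideal}
    (hJ : ∀ m n, J.space m n ≤ idealJ K m n) (hπ : π.IsCoisometricOn J) (a : Matrices K) :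
    ∀ n m : ℕ, (∀ i ∈ Finset.Icc 1 (min m n), diagSum K (n - i) (m - i) a ∈ J.space (m - i) (n - i)) →
      ∃ h : diagSum K n m a ∈ K.space m n,
        ∑ i ∈ Finset.range (min n m + 1), π.map (n - i) (m - i) (entry K (n - i) (m - i) a) =
          π.map n m ⟨diagSum K n m a, h⟩
  | 0, m, _ => ⟨(entry K 0 m a).2, by simp [diagSum]⟩
  | n + 1, 0, _ => ⟨(entry K (n + 1) 0 a).2, by simp [diagSum]⟩
  | n + 1, m + 1, H => by
    have hlow : diagSum K n m a ∈ J.space m n := H 1 (by simp)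
    obtain ⟨h, hs⟩ := sum_eq_map_diagSum π hJ hπ a n m fun i hi => by
      have := H (i + 1) (by simp only [Finset.mem_Icc] at hi ⊢; omega)
      rw [Nat.add_sub_add_right, Nat.add_sub_add_right] at this
      exact this
    have hten : T.tensor (diagSum K n m a) ∈ K.space (m + 1) (n + 1) := (hJ m n hlow).2
    refine ⟨(K.space (m + 1) (n + 1)).add_mem hten (entry K (n + 1) (m + 1) a).2, ?_⟩
    have hmin : min (n + 1) (m + 1) = min n m + 1 := by omega
    let F : ℕ → ℕ → B := fun p q => π.map p q (entry K p q a)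
    have hF : ∀ i, F (n + 1 - (i + 1)) (m + 1 - (i + 1)) = F (n - i) (m - i) := fun i => by
      rw [Nat.add_sub_add_right, Nat.add_sub_add_right]
    rw [hmin, Finset.sum_range_succ', Finset.sum_congr rfl fun i _ => hF i]
    refine (congrArg (· + F (n + 1) (m + 1)) (hs.trans (hπ n m _ h hten hlow))).trans ?_
    exact ((π.map (n + 1) (m + 1)).map_add _ _).symm

theorem nullSpace_le (π : Representation K B) {J : T.Ideal}
    (hJ : ∀ m n, J.space m n ≤ idealJ K m n) (hπ : π.IsCoisometricOn J) (m n : ℕ) :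
    nullSpace K J m n ≤ LinearMap.ker (π.matrixMap ∘ₗ (diagMatrices K m n).subtype) := by
  intro a ha
  have ha' : seminormJ K J m n a = 0 := ha
  have h1 : ∀ i ∈ Finset.Icc 1 (min m n),
      diagSum K (n - i) (m - i) a.1 ∈ J.space (m - i) (n - i) := by
    intro i hi
    have hle : ‖(J.space (m - i) (n - i)).mkQ (diagSum K (n - i) (m - i) a.1)‖ ≤ 0 := by
      rw [← ha']
      refine le_trans ?_ (le_sup_left (α := Seminorm ℂ (diagMatrices K m n)) a)
      exact Seminorm.le_finset_sup_apply (p := fun i =>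
        (normSeminorm ℂ (T.Hom (m - i) (n - i) ⧸ J.space (m - i) (n - i))).comp
        ((J.space (m - i) (n - i)).mkQ ∘ₗ diagSum K (n - i) (m - i) ∘ₗ
        (diagMatrices K m n).subtype)) hi
    have h0 : ‖((diagSum K (n - i) (m - i) a.1 : T.Hom (m - i) (n - i)) :
        T.Hom (m - i) (n - i) ⧸ (J.space (m - i) (n - i)).toAddSubgroup)‖ = 0 :=
      le_antisymm hle (norm_nonneg _)
    have hc := (QuotientAddGroup.norm_mk_eq_zero_iff_mem_closure
      (S := (J.space (m - i) (n - i)).toAddSubgroup)).1 h0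
    exact (J.isClosed_space (m - i) (n - i)).closure_subset hc
  have h2 : diagSum K n m a.1 = 0 := by
    have hle : ‖diagSum K n m a.1‖ ≤ 0 := by
      rw [← ha']
      exact (le_sup_right (α := Seminorm ℂ (diagMatrices K m n)) :
        (normSeminorm ℂ (T.Hom m n)).comp (diagSum K n m ∘ₗ (diagMatrices K m n).subtype) ≤ _) a
    exact norm_le_zero_iff.1 hle
  obtain ⟨h, hs⟩ := sum_eq_map_diagSum π hJ hπ a.1 n m h1
  rw [LinearMap.mem_ker]
  change π.matrixMap a.1 = 0
  rw [π.matrixMap_eq a.2, hs]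
  have h3 : (⟨diagSum K n m a.1, h⟩ : K.space m n) = 0 := Subtype.ext h2
  rw [h3, map_zero]

/-- The extension `π̃` of `π` to `K_J`: on `K_J(m,n)` it sends the class of a matrix `{a_{pq}}` in
`M(m,n)` to `∑ π_{pq}(a_{pq})`. -/
noncomputable def extension (π : Representation K B) {J : T.Ideal}
    (hJ : ∀ m n, J.space m n ≤ idealJ K m n) (hπ : π.IsCoisometricOn J) (n m : ℕ) :
    quotientSpace K J m n →ₗ[ℂ] B :=
  (nullSpace K J m n).liftQ (π.matrixMap ∘ₗ (diagMatrices K m n).subtype)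
    (π.nullSpace_le hJ hπ m n)

/-- `Ψ_π` is faithful on the `k`-th spectral subspace of `O_T(K,J)`. -/
def FaithfulOnSpectral {B : Type u} [NonUnitalCStarAlgebra B] (π : Representation K B)
    {J : T.Ideal} (hπ : π.IsCoisometricOn J) (k : ℤ) : Prop :=
  Set.InjOn (integrated π hπ) (spectralSubspace K J k)

/-- `ker π̃ = R_J`, where `R_J(m,n) ⊆ K(m,n)` is regarded as a subspace of `K_J(m,n)`. -/
def KerExtensionEq (π : Representation K B) {J : T.Ideal}
    (hJ : ∀ m n, J.space m n ≤ idealJ K m n) (hπ : π.IsCoisometricOn J) : Prop :=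
  ∀ n m : ℕ, LinearMap.ker (π.extension hJ hπ n m) =
    ((reductionIdeal J m n).comap (K.space m n).subtype).map (inclusion K J m n)

/-- `ker π = R_J`. -/
def KerEq (π : Representation K B) (J : T.Ideal) : Prop :=
  ∀ n m : ℕ, LinearMap.ker (π.map n m) = (reductionIdeal J m n).comap (K.space m n).subtype

/-- `J(n,n) = π_{nn}⁻¹(∑_{j=1}^k π_{n+j,n+j}(K(n+j,n+j)))` for all `n` and all `k ≥ 1`. -/
def DiagonalCondition (π : Representation K B) (J : T.Ideal) : Prop :=
  ∀ n k : ℕ, 1 ≤ k → (J.space n n).comap (K.space n n).subtype =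
    (⨆ j ∈ Finset.Icc 1 k, LinearMap.range (π.map (n + j) (n + j))).comap (π.map n n)

end Representation

end RightTensorPrecategory

/-! Conditions 1 and 2 agree by the `C*`-identity: if `b` has degree `k`, then `b* b` has degree
`0`.

Conditions 3 and 4 describe the same linear relations. Suppose the images of the entries along a
diagonal add up to zero. Starting from the end of the diagonal with the smallest indices, coisometry
collects the entries into one partial sum. The image of this partial sum is minus the sum of the
images of the entries further along, so the diagonal condition puts the partial sum into `J`, and it
can be pushed one place further. At the last place a single element of the kernel of `π` remains
(`kerExtensionEq_iff`).

For 4 ⇒ 1, averaging over the circle shows that the degree zero part is the closure of the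
increasing union of the spaces `segment 0 d`, the sums of the images of `K(j,j)` for `j ≤ d`. Each
of them is a `C*`-algebra. On it `Ψ_π` is injective by the same pushing argument
(`eq_zero_of_mem_segment`), hence isometric, and an isometric estimate survives the passage to the
closure.

For 1 ⇒ 4, a coisometric representation is needed that kills no more than `R_J` and satisfies no
more diagonal relations than those forced by `J`. It is built from the Toeplitz operators `∑_k a ⊗
1^k` on columns. Those of `a` and of `a ⊗ 1` differ by the matrix unit of `a`, so dividing by the
closed span of the matrix units with entries in `J` imposes coisometry on `J`. If the class of the
operator of `a` vanishes, then all `a ⊗ 1^k` lie in `J` and have norms tending to `0`; functional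
calculus then approximates `a` by elements of the spaces `S_k` (`mem_reductionIdeal`). The first
diagonal entry detects `J`. Every relation in `O_T(K,J)` also holds in this model, and faithfulness
lifts relations between the `π_{nm}(a)` to `O_T(K,J)`. The columns become Hilbert spaces by a GNS
construction, where the positivity axiom of a `C*`-precategory enters.

Finally, a gauge action on `C*(π)` makes the kernel of `Ψ_π` invariant, so the kernel contains the
Fourier coefficients of its elements. These vanish by condition 2, and an element with zero Fourier
coefficients is zero. Conversely, an injective `Ψ_π` is an isomorphism onto `C*(π)` and transports
the circle action. -/

/-! ### Quotients of `C*`-algebras -/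

/-- A closed selfadjoint two-sided ideal of a `C*`-algebra. -/
structure ClosedStarIdeal (A : Type u) [NonUnitalCStarAlgebra A] where
  carrier : Submodule ℂ A
  isClosed_carrier : IsClosed (carrier : Set A)
  mul_mem_left : ∀ (a : A) {x : A}, x ∈ carrier → a * x ∈ carrier
  mul_mem_right : ∀ (a : A) {x : A}, x ∈ carrier → x * a ∈ carrier
  star_mem : ∀ {x : A}, x ∈ carrier → star x ∈ carrier

namespace ClosedStarIdeal

variable {A : Type u} [NonUnitalCStarAlgebra A] (I : ClosedStarIdeal A)

/-- For every `x` in the ideal there is a contraction `e ≥ 0` in the ideal with `x e` close to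
`x`. -/
theorem exists_approx {x : A} (hx : x ∈ I.carrier) {ε : ℝ} (hε : 0 < ε) :
    ∃ e ∈ I.carrier, IsSelfAdjoint e ∧ ‖x - x * e‖ ≤ ε ∧ ∀ y : A, ‖y - y * e‖ ≤ ‖y‖ := by
  set h : A := star x * x with hdef
  have hh : IsSelfAdjoint h := IsSelfAdjoint.star_mul_self x
  -- By the `C*`-identity `‖x - x e‖² = ‖(1 - e) x* x (1 - e)‖`, so a bound `ε²` is needed on the
  -- right. It is attained for `e = g(x* x)` with `g(t) = t² / (t² + δ²)`, because `|t| δ⁴ / (t² +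
  -- δ²)² ≤ δ`.
  set δ : ℝ := ε ^ 2
  have hδ : 0 < δ := by positivity
  have hpos : ∀ t : ℝ, 0 < t ^ 2 + δ ^ 2 := fun t => by positivity
  set φ : ℝ → ℝ := fun t => t / (t ^ 2 + δ ^ 2) with hφ
  have hc : Continuous φ := by
    apply Continuous.div <;> first | fun_prop | exact fun t => (hpos t).ne'
  have h0 : φ 0 = 0 := by simp [φ]
  set g : ℝ → ℝ := fun t => t * φ t with hg
  have hgc : Continuous g := by fun_prop
  have hg0 : g 0 = 0 := by simp [g]
  have e1 : h * cfcₙ φ h = cfcₙ g h := by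
    nth_rw 1 [← cfcₙ_id ℝ h]
    rw [← cfcₙ_mul id φ h]
    rfl
  have hone : ∀ t, 1 - g t = δ ^ 2 / (t ^ 2 + δ ^ 2) := fun t => by
    have := (hpos t).ne'
    simp only [g, φ]
    field_simp
    ring
  clear_value g
  have hgc' : Continuous fun t => 1 - g t := by fun_prop
  have hH : IsSelfAdjoint (h : Unitization ℂ A) := hh.inr ℂ
  -- The element `1 - e` exists only in the unitization, where it is a contraction because `0 < 1 -
  -- g ≤ 1`.
  set d : Unitization ℂ A := 1 - ((cfcₙ g h : A) : Unitization ℂ A) with hd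
  have hdc : d = cfc (fun t => 1 - g t) (h : Unitization ℂ A) := by
    rw [hd, Unitization.real_cfcₙ_eq_cfc_inr h g hg0, cfc_sub (fun _ => (1 : ℝ)) g _
      continuousOn_const hgc.continuousOn, cfc_const_one ℝ _]
  have hdn : ‖d‖ ≤ 1 := by
    rw [hdc]
    refine norm_cfc_le zero_le_one fun t _ => ?_
    rw [hone, Real.norm_eq_abs, abs_of_nonneg (by positivity), div_le_one (hpos t)]
    nlinarith [sq_nonneg t]
  have hmul : ∀ y : A, ((y - y * cfcₙ g h : A) : Unitization ℂ A) = y * d := fun y => by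
    rw [hd, mul_sub, mul_one, ← Unitization.inr_mul, ← Unitization.inr_sub]
  have hsa : IsSelfAdjoint (cfcₙ g h) := cfcₙ_predicate g h
  have hds : star d = d := by
    rw [hd, star_sub, star_one, ← Unitization.inr_star, hsa.star_eq]
  refine ⟨cfcₙ g h, e1 ▸ I.mul_mem_right _ (I.mul_mem_left _ hx), hsa, ?_, fun y => ?_⟩
  · refine abs_le_of_sq_le_sq' ?_ hε.le |>.2
    rw [← Unitization.norm_inr (𝕜 := ℂ), hmul, sq, ← CStarRing.norm_star_mul_self, star_mul, hds,
      show d * star (x : Unitization ℂ A) * (x * d) = d * h * d by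
        rw [hdef, Unitization.inr_mul, Unitization.inr_star]; simp only [mul_assoc]]
    have : d * h * d = cfc (fun t => (1 - g t) * t * (1 - g t)) (h : Unitization ℂ A) := by
      rw [cfc_mul (fun t => (1 - g t) * t) (fun t => 1 - g t) _
        (hgc'.mul continuous_id').continuousOn hgc'.continuousOn,
        cfc_mul (fun t => (1 - g t)) (fun t => t) _ hgc'.continuousOn continuous_id'.continuousOn, cfc_id' ℝ _, ← hdc]
    rw [this]
    refine norm_cfc_le hδ.le fun t _ => ?_
    have e3 : (1 - g t) * t * (1 - g t) = t * (δ ^ 2) ^ 2 / (t ^ 2 + δ ^ 2) ^ 2 := by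
      rw [hone]
      field_simp
    rw [e3, Real.norm_eq_abs, abs_div, abs_of_pos (pow_pos (hpos t) 2),
      div_le_iff₀ (pow_pos (hpos t) 2), abs_mul, abs_of_pos (by positivity : 0 < (δ ^ 2) ^ 2)]
    have h1 : |t| * δ ≤ t ^ 2 + δ ^ 2 := by
      nlinarith [sq_nonneg (|t| - δ), sq_abs t, sq_nonneg t, sq_nonneg δ]
    have h2 : δ ^ 2 ≤ t ^ 2 + δ ^ 2 := by nlinarith [sq_nonneg t]
    have h3 := mul_le_mul h1 h2 (by positivity) (hpos t).le
    nlinarith [mul_le_mul_of_nonneg_left h3 hδ.le]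
  · rw [← Unitization.norm_inr (𝕜 := ℂ), hmul]
    refine (norm_mul_le _ _).trans ?_
    rw [Unitization.norm_inr]
    exact mul_le_of_le_one_right (norm_nonneg _) hdn

/-- The inequality behind the `C*`-identity of the quotient norm. -/
theorem exists_norm_sq_le (a : A) {i : A} (hi : i ∈ I.carrier) {ε : ℝ} (hε : 0 < ε) :
    ∃ j ∈ I.carrier, ‖a - j‖ ^ 2 ≤ ‖star a * a + i‖ + ε := by
  obtain ⟨e, he, hsa, h1, h2⟩ := I.exists_approx hi hε
  have h3 : ∀ y : A, ‖y - e * y‖ ≤ ‖y‖ := fun y => by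
    have := h2 (star y)
    rwa [← norm_star, star_sub, star_mul, star_star, hsa.star_eq, norm_star] at this
  -- With `e` acting almost as a unit on `i`, `‖a (1 - e)‖²` is the norm of `(1 - e)(a* a + i)(1 -
  -- e) - (1 - e) i (1 - e)`. The first term has norm at most `‖a* a + i‖`, the second at most `ε`.
  refine ⟨a * e, I.mul_mem_left _ he, ?_⟩
  set y := star a * a
  have key : star (a - a * e) * (a - a * e) =
      ((y + i) - (y + i) * e - e * ((y + i) - (y + i) * e)) -
        ((i - i * e) - e * (i - i * e)) := by
    simp only [star_sub, star_mul, hsa.star_eq, y]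
    noncomm_ring
  rw [sq, ← CStarRing.norm_star_mul_self, key]
  exact (norm_sub_le _ _).trans (add_le_add ((h3 _).trans (h2 _)) ((h3 _).trans h1))

/-- The quotient of a `C*`-algebra by a closed ideal. -/
def Quot : Type u := A ⧸ I.carrier

instance : IsClosed (I.carrier : Set A) := I.isClosed_carrier

noncomputable instance : NormedAddCommGroup I.Quot :=
  inferInstanceAs (NormedAddCommGroup (A ⧸ I.carrier))

noncomputable instance : NormedSpace ℂ I.Quot :=
  inferInstanceAs (NormedSpace ℂ (A ⧸ I.carrier))

instance : CompleteSpace I.Quot :=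
  inferInstanceAs (CompleteSpace (A ⧸ I.carrier))

/-- The quotient map as a linear map. -/
noncomputable def mkₗ : A →ₗ[ℂ] I.Quot := I.carrier.mkQ

theorem mkₗ_surjective : Function.Surjective I.mkₗ := Submodule.mkQ_surjective _

theorem mkₗ_eq_zero {a : A} : I.mkₗ a = 0 ↔ a ∈ I.carrier := Submodule.Quotient.mk_eq_zero _

theorem norm_mkₗ_le (a : A) : ‖I.mkₗ a‖ ≤ ‖a‖ := Submodule.Quotient.norm_mk_le I.carrier a

theorem exists_norm_lt (x : I.Quot) {ε : ℝ} (hε : 0 < ε) :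
    ∃ a, I.mkₗ a = x ∧ ‖a‖ < ‖x‖ + ε := Submodule.Quotient.norm_mk_lt (S := I.carrier) x hε

noncomputable instance : Mul I.Quot where
  mul := Quotient.map₂ (· * ·) (by
    intro a a' h b b' h'
    have h1 := (Submodule.quotientRel_def _).1 h
    have h2 := (Submodule.quotientRel_def _).1 h'
    refine (Submodule.quotientRel_def _).2 ?_
    have : a * b - a' * b' = (a - a') * b + a' * (b - b') := by noncomm_ring
    rw [this]
    exact add_mem (I.mul_mem_right _ h1) (I.mul_mem_left _ h2))

noncomputable instance : Star I.Quot where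
  star := Quotient.map star (by
    intro a a' h
    have h1 := (Submodule.quotientRel_def _).1 h
    refine (Submodule.quotientRel_def _).2 ?_
    rw [← star_sub]
    exact I.star_mem h1)

theorem mkₗ_mul (a b : A) : I.mkₗ (a * b) = I.mkₗ a * I.mkₗ b := rfl

theorem mkₗ_star (a : A) : I.mkₗ (star a) = star (I.mkₗ a) := rfl

theorem forall_quot {p : I.Quot → Prop} : (∀ x, p x) ↔ ∀ a, p (I.mkₗ a) :=
  I.mkₗ_surjective.forall

noncomputable instance : NonUnitalCStarAlgebra I.Quot where
  __ := (inferInstance : NormedAddCommGroup I.Quot)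
  __ := (inferInstance : NormedSpace ℂ I.Quot)
  __ := (inferInstance : CompleteSpace I.Quot)
  left_distrib := by
    simp only [forall_quot, ← map_add, ← mkₗ_mul, mul_add, implies_true]
  right_distrib := by
    simp only [forall_quot, ← map_add, ← mkₗ_mul, add_mul, implies_true]
  zero_mul := by
    simp only [forall_quot, ← map_zero I.mkₗ, ← mkₗ_mul, zero_mul, implies_true]
  mul_zero := by
    simp only [forall_quot, ← map_zero I.mkₗ, ← mkₗ_mul, mul_zero, implies_true]
  mul_assoc := by
    simp only [forall_quot, ← mkₗ_mul, mul_assoc, implies_true]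
  norm_mul_le x y := by
    refine le_of_forall_pos_le_add fun ε hε => ?_
    -- The quotient norm is an infimum that need not be attained, so representatives exceed it by
    -- some `η`.
    obtain ⟨η, hη, hη'⟩ : ∃ η > 0, (‖x‖ + η) * (‖y‖ + η) ≤ ‖x‖ * ‖y‖ + ε := by
      have hcont : ContinuousAt (fun η : ℝ => (‖x‖ + η) * (‖y‖ + η)) 0 := by fun_prop
      have := hcont.eventually_lt (g := fun _ => ‖x‖ * ‖y‖ + ε) continuousAt_const (by simpa)
      obtain ⟨r, hr, hr'⟩ := Metric.eventually_nhds_iff.1 this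
      refine ⟨r / 2, by positivity, (hr' ?_).le⟩
      rw [Real.dist_eq, sub_zero, abs_of_pos (by positivity)]
      linarith
    obtain ⟨a, rfl, ha⟩ := I.exists_norm_lt x hη
    obtain ⟨b, rfl, hb⟩ := I.exists_norm_lt y hη
    refine le_trans ?_ hη'
    refine (I.norm_mkₗ_le (a * b)).trans ((norm_mul_le _ _).trans ?_)
    gcongr
  star_involutive := by
    simp only [Function.Involutive, forall_quot, ← mkₗ_star, star_star, implies_true]
  star_mul := by
    simp only [forall_quot, ← mkₗ_star, ← mkₗ_mul, star_mul, implies_true]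
  star_add := by
    simp only [forall_quot, ← mkₗ_star, ← map_add, star_add, implies_true]
  norm_mul_self_le := by
    rw [forall_quot]
    intro a
    refine le_of_forall_pos_le_add fun ε hε => ?_
    rw [← mkₗ_star, ← mkₗ_mul]
    obtain ⟨b, hb, hb'⟩ := I.exists_norm_lt (I.mkₗ (star a * a)) (half_pos hε)
    -- A nearly minimal representative of the class of `a* a` has the form `a* a + i` with `i` in
    -- the ideal; subtracting a suitable `j` from `a` then gives the `C*`-inequality.
    have hi : b - star a * a ∈ I.carrier := by rw [← mkₗ_eq_zero, map_sub, hb, sub_self]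
    obtain ⟨j, hj, hj'⟩ := I.exists_norm_sq_le a hi (half_pos hε)
    have h1 : ‖I.mkₗ a‖ ≤ ‖a - j‖ := by
      have := I.norm_mkₗ_le (a - j)
      rwa [map_sub, I.mkₗ_eq_zero.2 hj, sub_zero] at this
    rw [add_sub_cancel] at hj'
    nlinarith [norm_nonneg (I.mkₗ a)]
  smul_assoc z := by
    simp only [forall_quot, smul_eq_mul, ← mkₗ_mul, ← map_smul, smul_mul_assoc, implies_true]
  smul_comm z := by
    simp only [forall_quot, smul_eq_mul, ← mkₗ_mul, ← map_smul, mul_smul_comm, implies_true]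
  star_smul z := by
    simp only [forall_quot, ← mkₗ_star, ← map_smul, star_smul, implies_true]

/-- The quotient map as a `*`-homomorphism. -/
noncomputable def proj : A →⋆ₙₐ[ℂ] I.Quot where
  toFun := I.mkₗ
  map_smul' := map_smul I.mkₗ
  map_zero' := map_zero I.mkₗ
  map_add' := map_add I.mkₗ
  map_mul' := I.mkₗ_mul
  map_star' := I.mkₗ_star

theorem proj_surjective : Function.Surjective I.proj := I.mkₗ_surjective

theorem proj_eq_zero {a : A} : I.proj a = 0 ↔ a ∈ I.carrier := I.mkₗ_eq_zero

theorem proj_eq_proj {a b : A} : I.proj a = I.proj b ↔ a - b ∈ I.carrier := by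
  rw [← proj_eq_zero, map_sub, sub_eq_zero]

end ClosedStarIdeal

/-! ### Closed ranges of `*`-homomorphisms and closed sums of subalgebras. -/

namespace NonUnitalStarAlgHom

theorem continuous_of_cstar {A : Type u} {B : Type v} [NonUnitalCStarAlgebra A]
    [NonUnitalCStarAlgebra B] (f : A →⋆ₙₐ[ℂ] B) : Continuous f :=
  AddMonoidHomClass.continuous_of_bound f 1 fun x => by
    simpa using NonUnitalStarAlgHom.norm_apply_le f x

/-- The kernel of a `*`-homomorphism between `C*`-algebras. -/
def kerIdeal {A : Type u} {B : Type v} [NonUnitalCStarAlgebra A]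
    [NonUnitalCStarAlgebra B] (f : A →⋆ₙₐ[ℂ] B) : ClosedStarIdeal A where
  carrier := LinearMap.ker (f : A →ₗ[ℂ] B)
  isClosed_carrier := isClosed_singleton.preimage f.continuous_of_cstar
  mul_mem_left a x hx := by
    have : f x = 0 := hx
    change f (a * x) = 0
    rw [map_mul, this, mul_zero]
  mul_mem_right a x hx := by
    have : f x = 0 := hx
    change f (x * a) = 0
    rw [map_mul, this, zero_mul]
  star_mem {x} hx := by
    have : f x = 0 := hx
    change f (star x) = 0
    rw [map_star, this, star_zero]

/-- The range of a `*`-homomorphism between `C*`-algebras is closed. -/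
theorem isClosed_range_of_cstar {A : Type u} {B : Type v} [NonUnitalCStarAlgebra A]
    [NonUnitalCStarAlgebra B] (f : A →⋆ₙₐ[ℂ] B) : IsClosed (Set.range f) := by
  set I := f.kerIdeal
  have hf : ∀ a b, I.proj a = I.proj b → f a = f b := fun a b h => by
    have h1 : f (a - b) = 0 := I.proj_eq_proj.1 h
    rwa [map_sub, sub_eq_zero] at h1
  set s := Function.surjInv I.proj_surjective
  have hs : ∀ x, I.proj (s x) = x := Function.surjInv_eq I.proj_surjective
  -- The map induced on the quotient by the kernel is injective, hence isometric, and an isometry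
  -- from a complete space has closed range.
  let g : I.Quot →⋆ₙₐ[ℂ] B :=
    { toFun x := f (s x)
      map_smul' c x := by
        rw [MonoidHom.id_apply, ← map_smul]; exact hf _ _ (by rw [map_smul, hs, hs])
      map_zero' := by rw [← map_zero f]; exact hf _ _ (by rw [map_zero, hs])
      map_add' x y := by rw [← map_add]; exact hf _ _ (by rw [map_add, hs, hs, hs])
      map_mul' x y := by rw [← map_mul]; exact hf _ _ (by rw [map_mul, hs, hs, hs])
      map_star' x := by rw [← map_star]; exact hf _ _ (by rw [map_star, hs, hs]) }
  have hg : Function.Injective g := by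
    intro x y h
    have h1 : f (s x) = f (s y) := h
    rw [← hs x, ← hs y, I.proj_eq_proj]
    change f (s x - s y) = 0
    rw [map_sub, h1, sub_self]
  have hr : Set.range f = Set.range g := by
    ext b
    constructor
    · rintro ⟨a, rfl⟩
      exact ⟨I.proj a, hf _ _ (hs _)⟩
    · rintro ⟨x, rfl⟩
      exact ⟨s x, rfl⟩
  rw [hr]
  exact (NonUnitalStarAlgHom.isometry g hg).isClosedEmbedding.isClosed_range

end NonUnitalStarAlgHom

/-- The idealizer of a closed selfadjoint subspace of a `C*`-algebra. -/
def idealizer {A : Type u} [NonUnitalCStarAlgebra A] (I : Submodule ℂ A)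
    (hs : ∀ x ∈ I, star x ∈ I) : NonUnitalStarSubalgebra ℂ A where
  carrier := {a | ∀ x ∈ I, a * x ∈ I ∧ x * a ∈ I}
  add_mem' {a b} ha hb x hx := by
    rw [add_mul, mul_add]
    exact ⟨add_mem (ha x hx).1 (hb x hx).1, add_mem (ha x hx).2 (hb x hx).2⟩
  zero_mem' x _ := by simp
  mul_mem' {a b} ha hb x hx := by
    rw [mul_assoc, ← mul_assoc x]
    exact ⟨(ha _ (hb x hx).1).1, (hb _ (ha x hx).2).2⟩
  smul_mem' c a ha x hx := by
    rw [smul_mul_assoc, mul_smul_comm]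
    exact ⟨I.smul_mem c (ha x hx).1, I.smul_mem c (ha x hx).2⟩
  star_mem' {a} ha x hx := by
    have h := ha _ (hs x hx)
    have h1 := hs _ h.1
    have h2 := hs _ h.2
    rw [star_mul, star_star] at h1 h2
    exact ⟨h2, h1⟩

theorem isClosed_idealizer {A : Type u} [NonUnitalCStarAlgebra A] {I : Submodule ℂ A}
    (hs : ∀ x ∈ I, star x ∈ I) (hI : IsClosed (I : Set A)) :
    IsClosed (idealizer I hs : Set A) := by
  have : (idealizer I hs : Set A) =
      ⋂ x ∈ I, {a : A | a * x ∈ (I : Set A)} ∩ {a : A | x * a ∈ (I : Set A)} := by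
    ext a
    simp only [Set.mem_iInter, Set.mem_inter_iff]
    rfl
  rw [this]
  refine isClosed_biInter fun x _ => ?_
  exact (hI.preimage (continuous_mul_const x)).inter (hI.preimage (continuous_const_mul x))

/-- A closed selfadjoint subalgebra, as an ideal of its idealizer. -/
noncomputable def idealOfIdealizer {A : Type u} [NonUnitalCStarAlgebra A] (I : Submodule ℂ A)
    (hs : ∀ x ∈ I, star x ∈ I) (hI : IsClosed (I : Set A))
    [IsClosed (idealizer I hs : Set A)] : ClosedStarIdeal (idealizer I hs) where
  carrier := I.comap (idealizer I hs).toSubmodule.subtype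
  isClosed_carrier := hI.preimage continuous_subtype_val
  mul_mem_left a _ hx := (a.2 _ hx).1
  mul_mem_right a _ hx := (a.2 _ hx).2
  star_mem hx := hs _ hx

/-- The sum of a closed `*`-subalgebra `C` and a closed selfadjoint subalgebra `I` with
`C I ⊆ I` and `I C ⊆ I` is closed. -/
theorem isClosed_sup_of_le_idealizer {A : Type u} [NonUnitalCStarAlgebra A] (I : Submodule ℂ A)
    (hs : ∀ x ∈ I, star x ∈ I) (hI : IsClosed (I : Set A)) (hm : ∀ x ∈ I, ∀ y ∈ I, x * y ∈ I)
    (C : NonUnitalStarSubalgebra ℂ A) (hC : IsClosed (C : Set A)) (hCI : C ≤ idealizer I hs) :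
    IsClosed ((C.toSubmodule ⊔ I : Submodule ℂ A) : Set A) := by
  have hcl := isClosed_idealizer hs hI
  set J := idealOfIdealizer I hs hI
  have hII : ∀ x ∈ I, x ∈ idealizer I hs := fun x hx y hy => ⟨hm x hx y hy, hm y hy x hx⟩
  -- Modulo `I` the sum becomes the image of `C`, which is closed; `C + I` is the preimage of that
  -- image in the idealizer.
  let f : C →⋆ₙₐ[ℂ] J.Quot := J.proj.comp (NonUnitalStarSubalgebra.inclusion hCI)
  have hr : IsClosed (Subtype.val '' (J.proj ⁻¹' (Set.range f)) : Set A) :=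
    hcl.isClosedEmbedding_subtypeVal.isClosedMap _
      (f.isClosed_range_of_cstar.preimage J.proj.continuous_of_cstar)
  convert hr using 1
  ext a
  rw [SetLike.mem_coe, Submodule.mem_sup]
  constructor
  · rintro ⟨c, hc, x, hx, rfl⟩
    refine ⟨⟨c + x, add_mem (hCI hc) (hII x hx)⟩, ⟨⟨c, hc⟩, ?_⟩, rfl⟩
    refine J.proj_eq_proj.2 ?_
    change c - (c + x) ∈ I
    rw [sub_add_cancel_left]
    exact neg_mem hx
  · rintro ⟨b, ⟨c, hc⟩, rfl⟩
    refine ⟨c, c.2, b - c, ?_, add_sub_cancel _ _⟩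
    exact J.proj_eq_proj.1 hc.symm

/-! ### Positive functionals -/

/-- Positive functionals separate the points of a `C*`-algebra. -/
theorem exists_positive_functional {A : Type u} [NonUnitalCStarAlgebra A] {c : A} (hc : c ≠ 0) :
    ∃ φ : A →ₗ[ℂ] ℂ, (∀ a, φ (star a) = starRingEnd ℂ (φ a)) ∧
      (∀ a, 0 ≤ (φ (star a * a)).re) ∧ (φ (star c * c)).re ≠ 0 := by
  let _ := CStarAlgebra.spectralOrder A
  have _ := CStarAlgebra.spectralOrderedRing A
  -- Hahn–Banach: a real functional that is nonnegative on the positive cone and negative at `-c*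
  -- c`.
  have hnot : -(star c * c) ∉ ProperCone.positive ℝ A := by
    rw [ProperCone.mem_positive]
    intro h
    have h1 : star c * c = 0 := le_antisymm (neg_nonneg.1 h) (star_mul_self_nonneg c)
    exact hc ((CStarRing.star_mul_self_eq_zero_iff c).1 h1)
  obtain ⟨f, hf, hf'⟩ := ProperCone.hyperplane_separation_point _ hnot
  -- Averaging with the involution makes the complexification of the functional hermitian and does
  -- not change its values on `a* a`.
  set g : A →ₗ[ℝ] ℝ := (1 / 2 : ℝ) • (f.toLinearMap + f.toLinearMap ∘ₗ
    (starLinearEquiv (A := A) ℝ).toLinearMap)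
  have hg : ∀ a, g a = (1 / 2) * (f a + f (star a)) := fun a => rfl
  have hgs : ∀ a, g (star a) = g a := fun a => by rw [hg, hg, star_star, add_comm]
  have hgp : ∀ a, g (star a * a) = f (star a * a) := fun a => by
    rw [hg, star_mul, star_star]; ring
  refine ⟨Module.Dual.extendRCLike (𝕜 := ℂ) g, fun a => ?_, fun a => ?_, ?_⟩
  · have h1 : Complex.I • star a = star (-(Complex.I • a)) := by
      rw [star_neg, star_smul]; simp
    simp only [Module.Dual.extendRCLike_apply]
    rw [hgs, RCLike.I_to_complex, h1, hgs, map_neg]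
    simp
  · have := Module.Dual.re_extendRCLike_apply (𝕜 := ℂ) g (star a * a)
    rw [RCLike.re_to_complex] at this
    rw [this, hgp]
    exact hf _ (star_mul_self_nonneg a)
  · have := Module.Dual.re_extendRCLike_apply (𝕜 := ℂ) g (star c * c)
    rw [RCLike.re_to_complex] at this
    rw [this, hgp]
    rw [map_neg] at hf'
    exact (neg_lt_zero.1 hf').ne'

namespace CStarPrecategory

variable {Ob : Type v} (C : CStarPrecategory.{u, v} Ob)

theorem adj_zero (σ ρ : Ob) : C.adj (0 : C.Hom σ ρ) = 0 := by
  simpa using C.adj_smul (0 : ℂ) (0 : C.Hom σ ρ)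

/-- The composition as a linear map in the second variable. -/
def compLeft {σ ρ : Ob} (a : C.Hom σ ρ) (τ : Ob) : C.Hom τ σ →ₗ[ℂ] C.Hom τ ρ where
  toFun := C.comp a
  map_add' := C.comp_add a
  map_smul' z := C.comp_smul z a

/-- Positive functionals on the endomorphism algebra of an object. -/
structure PositiveFunctional (l : Ob) where
  toFun : C.Hom l l →ₗ[ℂ] ℂ
  map_adj : ∀ a, toFun (C.adj a) = starRingEnd ℂ (toFun a)
  re_nonneg : ∀ a : C.Hom l l, 0 ≤ (toFun (C.comp (C.adj a) a)).re

variable {C}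

theorem exists_positiveFunctional {l : Ob} {c : C.Hom l l} (hc : c ≠ 0) :
    ∃ φ : C.PositiveFunctional l, (φ.toFun (C.comp (C.adj c) c)).re ≠ 0 := by
  obtain ⟨φ, h1, h2, h3⟩ := exists_positive_functional (A := C.EndAlg l) (c := c) hc
  exact ⟨⟨φ, h1, h2⟩, h3⟩

namespace PositiveFunctional

variable {l : Ob} (φ : C.PositiveFunctional l)

/-- The positivity axiom enters here: `c* c` equals `d* d` for an endomorphism `d` of `l`, so a
functional on `T(l,l)` gives a semi-inner product on every `T(l,p)`. -/
theorem re_adj_comp_self_nonneg {p : Ob} (c : C.Hom l p) :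
    0 ≤ (φ.toFun (C.comp (C.adj c) c)).re := by
  obtain ⟨d, hd⟩ := C.adj_comp_self_pos c
  rw [hd]
  exact φ.re_nonneg d

theorem conj_apply {p : Ob} (c d : C.Hom l p) :
    starRingEnd ℂ (φ.toFun (C.comp (C.adj d) c)) = φ.toFun (C.comp (C.adj c) d) := by
  rw [← φ.map_adj, C.adj_comp, C.adj_adj]

/-- The equation says `r² - a = (r - e)²`, so `e = r - √(r² - a)`. This function vanishes at `0`,
and the expanded form avoids a unit. -/
theorem exists_two_smul_sub_mul_self {A : Type u} [NonUnitalCStarAlgebra A] (a : A)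
    (ha : IsSelfAdjoint a) {r : ℝ} (hr : 0 ≤ r) (har : ‖a‖ ≤ r ^ 2) :
    ∃ e : A, IsSelfAdjoint e ∧ a = (2 * r) • e - e * e := by
  set f : ℝ → ℝ := fun t => r - √(r ^ 2 - t) with hf
  have hfc : Continuous f := by fun_prop
  have hf0 : f 0 = 0 := by simp [f, Real.sqrt_sq hr]
  refine ⟨cfcₙ f a, cfcₙ_predicate f a, ?_⟩
  have h1 : (2 * r) • cfcₙ f a - cfcₙ f a * cfcₙ f a
      = cfcₙ (fun t => (2 * r) * f t - f t * f t) a := by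
    rw [cfcₙ_sub (fun t => (2 * r) * f t) (fun t => f t * f t) a
        (hfc.const_mul _).continuousOn (by simp [hf0]) (hfc.mul hfc).continuousOn (by simp [hf0]),
      cfcₙ_mul f f a hfc.continuousOn hf0 hfc.continuousOn hf0,
      cfcₙ_const_mul (2 * r) f a hfc.continuousOn hf0]
  rw [h1]
  conv_lhs => rw [← cfcₙ_id' ℝ a]
  refine cfcₙ_congr fun t ht => ?_
  -- The bound on the quasispectrum keeps the radicand nonnegative; the real square root is `0` on
  -- negative numbers.
  have ht' : t ≤ r ^ 2 := by
    rw [Unitization.quasispectrum_eq_spectrum_inr' ℝ ℂ] at ht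
    have := spectrum.norm_le_norm_of_mem ht
    rw [Unitization.norm_inr] at this
    exact (le_abs_self t).trans (this.trans har)
  have hs := Real.sq_sqrt (sub_nonneg.2 ht')
  simp only [f]
  nlinarith

/-- Left multiplication by `a` is bounded by `‖a‖` in the seminorm given by a positive
functional. -/
theorem re_comp_le {q p : Ob} (a : C.Hom q p) (c : C.Hom l q) :
    (φ.toFun (C.comp (C.adj (C.comp a c)) (C.comp a c))).re ≤
      ‖a‖ ^ 2 * (φ.toFun (C.comp (C.adj c) c)).re := by
  obtain ⟨e, he, hea⟩ := exists_two_smul_sub_mul_self (A := C.EndAlg q) (C.comp (C.adj a) a)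
    (by
      change C.adj (C.comp (C.adj a) a) = C.comp (C.adj a) a
      rw [C.adj_comp, C.adj_adj])
    (norm_nonneg a) (C.norm_adj_comp_self a).le
  set e' : C.Hom q q := e
  have he' : C.adj e' = e' := he
  have hea' : C.comp (C.adj a) a = ((2 * ‖a‖ : ℝ) : ℂ) • e' - C.comp e' e' := hea
  -- With `r = ‖a‖` and `e` the root just found, `‖a‖² c* c - (a c)* (a c)` is the square `((r - e)
  -- c)* ((r - e) c)`.
  have h := φ.re_adj_comp_self_nonneg (((‖a‖ : ℝ) : ℂ) • c - C.comp e' c)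
  have key : C.comp (C.adj (((‖a‖ : ℝ) : ℂ) • c - C.comp e' c)) (((‖a‖ : ℝ) : ℂ) • c - C.comp e' c)
      = ((‖a‖ ^ 2 : ℝ) : ℂ) • C.comp (C.adj c) c -
        C.comp (C.adj (C.comp a c)) (C.comp a c) := by
    have h1 : C.comp (C.adj (C.comp a c)) (C.comp a c)
        = C.comp (C.adj c) (C.comp (C.comp (C.adj a) a) c) := by
      rw [C.adj_comp]; simp only [C.comp_assoc]
    rw [h1, hea', C.adj_sub, C.adj_comp, he', C.adj_smul]
    simp only [C.comp_sub, C.sub_comp, C.smul_comp, C.comp_smul, C.comp_assoc,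
      Complex.conj_ofReal]
    push_cast
    module
  rw [key, map_sub, map_smul, Complex.sub_re, smul_eq_mul, Complex.re_ofReal_mul] at h
  linarith

end PositiveFunctional

end CStarPrecategory

namespace RightTensorPrecategory

variable {T : RightTensorPrecategory.{u}}

/-! ### Spaces of finitely supported columns -/

/-- The finitely supported columns `(ξ_p)`, `ξ_p ∈ T(l,p)`. -/
def Column (T : RightTensorPrecategory.{u}) (l : ℕ) : Submodule ℂ (∀ p, T.Hom l p) where
  carrier := {ξ | ∃ N, ∀ p, N ≤ p → ξ p = 0}
  add_mem' := by
    rintro ξ η ⟨N, hN⟩ ⟨M, hM⟩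
    refine ⟨max N M, fun p hp => ?_⟩
    rw [Pi.add_apply, hN p (le_of_max_le_left hp), hM p (le_of_max_le_right hp), add_zero]
  zero_mem' := ⟨0, fun _ _ => rfl⟩
  smul_mem' c ξ := by
    rintro ⟨N, hN⟩
    exact ⟨N, fun p hp => by rw [Pi.smul_apply, hN p hp, smul_zero]⟩

/-- The column whose entries from the `n`-th on are given by `f`, and which vanishes before. -/
def shiftBy {l : ℕ} (n : ℕ) (f : ∀ k, T.Hom l (n + k)) (p : ℕ) : T.Hom l p :=
  if h : n ≤ p then (Nat.add_sub_of_le h) ▸ f (p - n) else 0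

theorem shiftBy_add {l : ℕ} (n : ℕ) (f : ∀ k, T.Hom l (n + k)) (k : ℕ) :
    shiftBy n f (n + k) = f k := by
  have h : ∀ j (hj : n + j = n + k), hj ▸ f j = f k := by
    intro j hj
    obtain rfl : j = k := by omega
    rfl
  rw [shiftBy, dif_pos (Nat.le_add_right n k)]
  exact h _ _

theorem shiftBy_of_lt {l n p : ℕ} (f : ∀ k, T.Hom l (n + k)) (h : p < n) :
    shiftBy n f p = 0 := dif_neg (by omega)

/-- Entries at `n + k` carry the types on which the operators below are defined, so comparing
columns in this way requires no transport along equalities of indices. -/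
theorem eq_of_shift {l n : ℕ} {ξ η : ∀ p, T.Hom l p} (h1 : ∀ p < n, ξ p = η p)
    (h2 : ∀ k, ξ (n + k) = η (n + k)) (p : ℕ) : ξ p = η p := by
  rcases lt_or_ge p n with h | h
  · exact h1 p h
  · obtain ⟨k, rfl⟩ := Nat.exists_eq_add_of_le h
    exact h2 k

/-- The operator on columns which maps the entry at `m + k` to the entry at `n + k` through
`s k`. -/
def columnOp (m n : ℕ) {l : ℕ} (s : ∀ k, T.Hom l (m + k) →ₗ[ℂ] T.Hom l (n + k)) :
    Column T l →ₗ[ℂ] Column T l where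
  toFun ξ := ⟨shiftBy n fun k => s k (ξ.1 (m + k)), by
    obtain ⟨N, hN⟩ := ξ.2
    refine ⟨n + N, fun p hp => ?_⟩
    obtain ⟨k, rfl⟩ := Nat.exists_eq_add_of_le ((Nat.le_add_right n N).trans hp)
    rw [shiftBy_add, hN (m + k) (by omega), map_zero]⟩
  map_add' ξ η := Subtype.ext <| funext <| eq_of_shift (n := n)
    (fun p hp => by simp [shiftBy_of_lt _ hp]) (fun k => by simp [shiftBy_add])
  map_smul' c ξ := Subtype.ext <| funext <| eq_of_shift (n := n)
    (fun p hp => by simp [shiftBy_of_lt _ hp]) (fun k => by simp [shiftBy_add])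

theorem columnOp_add (m n : ℕ) {l : ℕ} (s : ∀ k, T.Hom l (m + k) →ₗ[ℂ] T.Hom l (n + k))
    (ξ : Column T l) (k : ℕ) : (columnOp m n s ξ).1 (n + k) = s k (ξ.1 (m + k)) :=
  shiftBy_add n (fun k => s k (ξ.1 (m + k))) k

theorem columnOp_of_lt {m n l p : ℕ} (s : ∀ k, T.Hom l (m + k) →ₗ[ℂ] T.Hom l (n + k))
    (ξ : Column T l) (h : p < n) : (columnOp m n s ξ).1 p = 0 :=
  shiftBy_of_lt (fun k => s k (ξ.1 (m + k))) h

/-- The space of columns with the semi-inner product given by a positive functional. -/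
@[nolint unusedArguments]
def PreHilbert {l : ℕ} (_φ : T.PositiveFunctional l) : Type u := Column T l

variable {l : ℕ} (φ : T.PositiveFunctional l)

instance : AddCommGroup (PreHilbert φ) := inferInstanceAs (AddCommGroup (Column T l))
instance : Module ℂ (PreHilbert φ) := inferInstanceAs (Module ℂ (Column T l))

/-- The entries of a column. -/
def PreHilbert.entry {φ : T.PositiveFunctional l} (ξ : PreHilbert φ) (p : ℕ) : T.Hom l p :=
  (show Column T l from ξ).1 p

theorem PreHilbert.entry_finite {φ : T.PositiveFunctional l} (ξ : PreHilbert φ) :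
    ∃ N, ∀ p, N ≤ p → ξ.entry p = 0 := (show Column T l from ξ).2

/-- The inner product of two columns at one entry. -/
def innerAt (ξ η : PreHilbert φ) (p : ℕ) : ℂ := φ.toFun (T.comp (T.adj (ξ.entry p)) (η.entry p))

theorem summable_innerAt (ξ η : PreHilbert φ) : Summable (innerAt φ ξ η) := by
  obtain ⟨N, hN⟩ := η.entry_finite
  refine summable_of_ne_finset_zero (s := Finset.range N) fun p hp => ?_
  rw [Finset.mem_range, not_lt] at hp
  rw [innerAt, hN p hp, T.comp_zero, map_zero]

theorem innerAt_self_re_nonneg (ξ : PreHilbert φ) (p : ℕ) : 0 ≤ (innerAt φ ξ ξ p).re :=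
  φ.re_adj_comp_self_nonneg _

/-- This is the GNS form summed over the entries; the sums are finite because columns are finitely
supported. The form may be degenerate; the null vectors disappear in the completion. -/
noncomputable abbrev preHilbertCore : PreInnerProductSpace.Core ℂ (PreHilbert φ) where
  inner ξ η := ∑' p, innerAt φ ξ η p
  conj_inner_symm ξ η := by
    rw [Complex.conj_tsum]
    exact tsum_congr fun p => φ.conj_apply _ _
  re_inner_nonneg ξ := by
    rw [RCLike.re_to_complex, Complex.re_tsum (summable_innerAt φ ξ ξ)]
    exact tsum_nonneg (innerAt_self_re_nonneg φ ξ)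
  add_left ξ η ζ := by
    rw [← (summable_innerAt φ ξ ζ).tsum_add (summable_innerAt φ η ζ)]
    refine tsum_congr fun p => ?_
    change φ.toFun (T.comp (T.adj (ξ.entry p + η.entry p)) (ζ.entry p)) = _
    rw [T.adj_add, T.add_comp, map_add]
    rfl
  smul_left ξ η c := by
    rw [← tsum_mul_left]
    refine tsum_congr fun p => ?_
    change φ.toFun (T.comp (T.adj (c • ξ.entry p)) (η.entry p)) = _
    rw [T.adj_smul, T.smul_comp, map_smul]
    rfl

noncomputable instance : SeminormedAddCommGroup (PreHilbert φ) :=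
  InnerProductSpace.Core.toSeminormedAddCommGroup (c := preHilbertCore φ)

noncomputable instance : InnerProductSpace ℂ (PreHilbert φ) :=
  InnerProductSpace.ofCore (preHilbertCore φ)

theorem preHilbert_inner (ξ η : PreHilbert φ) : inner ℂ ξ η = ∑' p, innerAt φ ξ η p := rfl

theorem preHilbert_norm_sq (ξ : PreHilbert φ) : ‖ξ‖ ^ 2 = ∑' p, (innerAt φ ξ ξ p).re := by
  rw [← Complex.re_tsum (summable_innerAt φ ξ ξ), ← preHilbert_inner,
    norm_sq_eq_re_inner (𝕜 := ℂ) ξ, RCLike.re_to_complex]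

/-- `columnOp` on the space with semi-inner product. -/
def preHilbertOp (m n : ℕ) (s : ∀ k, T.Hom l (m + k) →ₗ[ℂ] T.Hom l (n + k)) :
    PreHilbert φ →ₗ[ℂ] PreHilbert φ := columnOp m n s

theorem tsum_eq_tsum_shift {M : Type*} [AddCommMonoid M] [TopologicalSpace M] {f : ℕ → M} {n : ℕ}
    (hf : ∀ p < n, f p = 0) : ∑' p, f p = ∑' k, f (n + k) := by
  refine ((add_right_injective n).tsum_eq fun p hp => ?_).symm
  by_contra h
  refine hp (hf p ?_)
  by_contra h1
  exact h ⟨p - n, by simp only; omega⟩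

/-- The operator acts along a single diagonal: distinct entries of the image come from distinct
entries of the column, and different entries are orthogonal. Hence a uniform entrywise bound bounds
the operator. -/
theorem preHilbertOp_norm_le {m n : ℕ} {s : ∀ k, T.Hom l (m + k) →ₗ[ℂ] T.Hom l (n + k)} {r : ℝ}
    (hr : 0 ≤ r)
    (hs : ∀ k c, (φ.toFun (T.comp (T.adj (s k c)) (s k c))).re ≤
      r ^ 2 * (φ.toFun (T.comp (T.adj c) c)).re) (ξ : PreHilbert φ) :
    ‖preHilbertOp φ m n s ξ‖ ≤ r * ‖ξ‖ := by
  refine abs_le_of_sq_le_sq' ?_ (by positivity) |>.2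
  have hsum : Summable fun p => (innerAt φ ξ ξ p).re :=
    (Complex.hasSum_re (summable_innerAt φ ξ ξ).hasSum).summable
  have hsum' : Summable fun p => (innerAt φ (preHilbertOp φ m n s ξ) (preHilbertOp φ m n s ξ) p).re :=
    (Complex.hasSum_re (summable_innerAt φ _ _).hasSum).summable
  rw [mul_pow, preHilbert_norm_sq, preHilbert_norm_sq, tsum_eq_tsum_shift (n := n)]
  · have h1 := tsum_comp_le_tsum_of_inj hsum (innerAt_self_re_nonneg φ ξ) (add_right_injective m)
    refine le_trans ?_ (mul_le_mul_of_nonneg_left h1 (sq_nonneg r))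
    rw [← tsum_mul_left]
    refine Summable.tsum_le_tsum (fun k => ?_) (hsum'.comp_injective (add_right_injective n))
      ((hsum.comp_injective (add_right_injective m)).mul_left _)
    have h2 : (preHilbertOp φ m n s ξ).entry (n + k) = s k (ξ.entry (m + k)) := columnOp_add _ _ _ _ _
    simp only [innerAt, h2]
    exact hs k _
  · intro p hp
    have h2 : (preHilbertOp φ m n s ξ).entry p = 0 := columnOp_of_lt _ _ hp
    rw [innerAt, h2, T.comp_zero, map_zero, Complex.zero_re]

theorem preHilbertOp_inner {m n : ℕ} {s : ∀ k, T.Hom l (m + k) →ₗ[ℂ] T.Hom l (n + k)}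
    {s' : ∀ k, T.Hom l (n + k) →ₗ[ℂ] T.Hom l (m + k)}
    (h : ∀ k c d, φ.toFun (T.comp (T.adj (s k c)) d) = φ.toFun (T.comp (T.adj c) (s' k d)))
    (ξ η : PreHilbert φ) :
    inner ℂ (preHilbertOp φ m n s ξ) η = inner ℂ ξ (preHilbertOp φ n m s' η) := by
  rw [preHilbert_inner, preHilbert_inner,
    tsum_eq_tsum_shift (f := innerAt φ (preHilbertOp φ m n s ξ) η) (n := n),
    tsum_eq_tsum_shift (f := innerAt φ ξ (preHilbertOp φ n m s' η)) (n := m)]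
  · refine tsum_congr fun k => ?_
    have h1 : (preHilbertOp φ m n s ξ).entry (n + k) = s k (ξ.entry (m + k)) := columnOp_add _ _ _ _ _
    have h2 : (preHilbertOp φ n m s' η).entry (m + k) = s' k (η.entry (n + k)) :=
      columnOp_add _ _ _ _ _
    rw [innerAt, innerAt, h1, h2, h]
  · intro p hp
    have h2 : (preHilbertOp φ n m s' η).entry p = 0 := columnOp_of_lt _ _ hp
    rw [innerAt, h2, T.comp_zero, map_zero]
  · intro p hp
    have h2 : (preHilbertOp φ m n s ξ).entry p = 0 := columnOp_of_lt _ _ hp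
    rw [innerAt, h2, T.adj_zero, T.zero_comp, map_zero]

/-! ### The `C*`-algebra acting on all column spaces -/

/-- The Hilbert space completion of the space of columns. -/
abbrev Hilbert {l : ℕ} (φ : T.PositiveFunctional l) : Type u :=
  UniformSpace.Completion (PreHilbert φ)

/-- The `C*`-algebra of bounded families of operators on the Hilbert spaces of columns. -/
def ColumnAlg (T : RightTensorPrecategory.{u}) : Type u :=
  lp (fun ω : Σ l, T.PositiveFunctional l => Hilbert ω.2 →L[ℂ] Hilbert ω.2) ∞

noncomputable instance : NonUnitalCStarAlgebra (ColumnAlg T) :=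
  inferInstanceAs (NonUnitalCStarAlgebra
    (lp (fun ω : Σ l, T.PositiveFunctional l => Hilbert ω.2 →L[ℂ] Hilbert ω.2) ∞))

/-- A uniformly bounded family of operators on the spaces of columns. -/
structure ColumnFamily (T : RightTensorPrecategory.{u}) where
  toFun : ∀ {l : ℕ} (φ : T.PositiveFunctional l), PreHilbert φ →ₗ[ℂ] PreHilbert φ
  exists_bound : ∃ r : ℝ, 0 ≤ r ∧
    ∀ {l : ℕ} (φ : T.PositiveFunctional l) (ξ : PreHilbert φ), ‖toFun φ ξ‖ ≤ r * ‖ξ‖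

namespace ColumnFamily

/-- The bounded operator on the Hilbert space of columns. -/
noncomputable def operator (S : ColumnFamily T) {l : ℕ} (φ : T.PositiveFunctional l) :
    Hilbert φ →L[ℂ] Hilbert φ :=
  ((S.toFun φ).mkContinuous S.exists_bound.choose
    (S.exists_bound.choose_spec.2 φ)).completion

theorem operator_coe (S : ColumnFamily T) (ξ : PreHilbert φ) :
    S.operator φ (ξ : Hilbert φ) = (S.toFun φ ξ : PreHilbert φ) :=
  ContinuousLinearMap.completion_apply_coe _ _

theorem operator_norm_le (S : ColumnFamily T) {r : ℝ} (hr : 0 ≤ r)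
    (h : ∀ ξ : PreHilbert φ, ‖S.toFun φ ξ‖ ≤ r * ‖ξ‖) : ‖S.operator φ‖ ≤ r := by
  refine ContinuousLinearMap.opNorm_le_bound _ hr fun x => ?_
  induction x using UniformSpace.Completion.induction_on with
  | hp => apply isClosed_le <;> fun_prop
  | ih ξ =>
    rw [operator_coe, UniformSpace.Completion.norm_coe, UniformSpace.Completion.norm_coe]
    exact h ξ

/-- The element of the `C*`-algebra `ColumnAlg T` given by a bounded family of operators. -/
noncomputable def elem (S : ColumnFamily T) : ColumnAlg T :=
  ⟨fun ω => S.operator ω.2, memℓp_infty ⟨S.exists_bound.choose, by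
    rintro _ ⟨ω, rfl⟩
    exact S.operator_norm_le ω.2 S.exists_bound.choose_spec.1
      (S.exists_bound.choose_spec.2 ω.2)⟩⟩

theorem norm_elem_le (S : ColumnFamily T) {r : ℝ} (hr : 0 ≤ r)
    (h : ∀ {l : ℕ} (φ : T.PositiveFunctional l) (ξ : PreHilbert φ), ‖S.toFun φ ξ‖ ≤ r * ‖ξ‖) :
    ‖S.elem‖ ≤ r :=
  lp.norm_le_of_forall_le hr fun ω => S.operator_norm_le ω.2 hr (h ω.2)

theorem elem_eq_zero (S : ColumnFamily T) (h : S.elem = 0) (ξ : PreHilbert φ) :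
    ‖S.toFun φ ξ‖ = 0 := by
  have h1 : S.operator φ = 0 := congrArg (fun x : ColumnAlg T => x.1 ⟨l, φ⟩) h
  rw [← UniformSpace.Completion.norm_coe, ← operator_coe, h1]
  simp

/-- Identities between bounded operators need checking only on the dense image of the columns; the
same reduction gives sums, multiples and adjoints. -/
theorem elem_mul {S S' S'' : ColumnFamily T}
    (h : ∀ {l : ℕ} (φ : T.PositiveFunctional l) (ξ : PreHilbert φ),
      S.toFun φ (S'.toFun φ ξ) = S''.toFun φ ξ) : S.elem * S'.elem = S''.elem := by
  refine Subtype.ext (funext fun ω => ?_)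
  change S.operator ω.2 * S'.operator ω.2 = S''.operator ω.2
  ext x
  induction x using UniformSpace.Completion.induction_on with
  | hp => apply isClosed_eq <;> fun_prop
  | ih ξ => rw [mul_apply_eq_comp, operator_coe, operator_coe, operator_coe, h]

theorem elem_add {S S' S'' : ColumnFamily T}
    (h : ∀ {l : ℕ} (φ : T.PositiveFunctional l) (ξ : PreHilbert φ),
      S''.toFun φ ξ = S.toFun φ ξ + S'.toFun φ ξ) : S''.elem = S.elem + S'.elem := by
  refine Subtype.ext (funext fun ω => ?_)
  change S''.operator ω.2 = S.operator ω.2 + S'.operator ω.2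
  ext x
  induction x using UniformSpace.Completion.induction_on with
  | hp => apply isClosed_eq <;> fun_prop
  | ih ξ =>
    rw [add_apply, operator_coe, operator_coe, operator_coe, h,
      UniformSpace.Completion.coe_add]

theorem elem_smul {S S' : ColumnFamily T} {c : ℂ}
    (h : ∀ {l : ℕ} (φ : T.PositiveFunctional l) (ξ : PreHilbert φ),
      S'.toFun φ ξ = c • S.toFun φ ξ) : S'.elem = c • S.elem := by
  refine Subtype.ext (funext fun ω => ?_)
  change S'.operator ω.2 = c • S.operator ω.2
  ext x
  induction x using UniformSpace.Completion.induction_on with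
  | hp => exact isClosed_eq (S'.operator ω.2).continuous (c • S.operator ω.2).continuous
  | ih ξ =>
    change S'.operator ω.2 ξ = c • (S.operator ω.2 ξ)
    rw [operator_coe, operator_coe, h,
      UniformSpace.Completion.coe_smul]

theorem elem_star {S S' : ColumnFamily T}
    (h : ∀ {l : ℕ} (φ : T.PositiveFunctional l) (ξ η : PreHilbert φ),
      inner ℂ (S'.toFun φ ξ) η = inner ℂ ξ (S.toFun φ η)) : star S.elem = S'.elem := by
  refine Subtype.ext (funext fun ω => ?_)
  change ContinuousLinearMap.adjoint (S.operator ω.2) = S'.operator ω.2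
  symm
  refine (ContinuousLinearMap.eq_adjoint_iff _ _).2 fun x y => ?_
  induction x, y using UniformSpace.Completion.induction_on₂ with
  | hp => apply isClosed_eq <;> fun_prop
  | ih ξ η => rw [operator_coe, operator_coe, UniformSpace.Completion.inner_coe,
      UniformSpace.Completion.inner_coe, h]

end ColumnFamily

end RightTensorPrecategory

namespace RightTensorPrecategory

variable {T : RightTensorPrecategory.{u}}

/-! ### Iterated right tensoring -/

/-- Contractivity is automatic: on `T(m,m)` the right tensoring is a `*`-homomorphism of
`C*`-algebras, and the general case follows from `‖a‖² = ‖a* a‖`. -/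
theorem norm_tensor_le {m n : ℕ} (a : T.Hom m n) : ‖T.tensor a‖ ≤ ‖a‖ := by
  let f : T.EndAlg m →⋆ₙₐ[ℂ] T.EndAlg (m + 1) :=
    { toFun := fun x => T.tensor (m := m) (n := m) x
      map_smul' := fun c x => (T.tensor (m := m) (n := m)).map_smul c x
      map_zero' := (T.tensor (m := m) (n := m)).map_zero
      map_add' := fun x y => (T.tensor (m := m) (n := m)).map_add x y
      map_mul' := fun x y => T.tensor_comp (l := m) (m := m) (n := m) x y
      map_star' := fun x => T.tensor_adj (m := m) (n := m) x }
  refine abs_le_of_sq_le_sq' ?_ (norm_nonneg _) |>.2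
  rw [← T.norm_adj_comp_self, ← T.norm_adj_comp_self, ← T.tensor_adj, ← T.tensor_comp]
  exact NonUnitalStarAlgHom.norm_apply_le f (show T.EndAlg m from T.comp (T.adj a) a)

theorem norm_tensorPow_le {m n : ℕ} (a : T.Hom m n) : ∀ k, ‖tensorPow a k‖ ≤ ‖a‖
  | 0 => le_rfl
  | k + 1 => (norm_tensor_le _).trans (norm_tensorPow_le a k)

theorem tensorPow_add {m n : ℕ} (a b : T.Hom m n) :
    ∀ k, tensorPow (a + b) k = tensorPow a k + tensorPow b k
  | 0 => rfl
  | k + 1 => by rw [tensorPow, tensorPow_add a b k, map_add]; rfl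

theorem tensorPow_smul {m n : ℕ} (c : ℂ) (a : T.Hom m n) :
    ∀ k, tensorPow (c • a) k = c • tensorPow a k
  | 0 => rfl
  | k + 1 => by rw [tensorPow, tensorPow_smul c a k, map_smul]; rfl

theorem tensorPow_adj {m n : ℕ} (a : T.Hom m n) :
    ∀ k, tensorPow (T.adj a) k = T.adj (tensorPow a k)
  | 0 => rfl
  | k + 1 => by rw [tensorPow, tensorPow_adj a k, T.tensor_adj]; rfl

theorem tensorPow_comp {l m n : ℕ} (a : T.Hom m n) (b : T.Hom l m) :
    ∀ k, tensorPow (T.comp a b) k = T.comp (tensorPow a k) (tensorPow b k)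
  | 0 => rfl
  | k + 1 => by rw [tensorPow, tensorPow_comp a b k, T.tensor_comp]; rfl

theorem tensor_heq {m n m' n' : ℕ} (hm : m = m') (hn : n = n') {a : T.Hom m n} {a' : T.Hom m' n'}
    (h : HEq a a') : HEq (T.tensor a) (T.tensor a') := by
  subst hm hn
  rw [eq_of_heq h]

/-- The objects `m + k + j` and `m + (k + j)` are not definitionally equal for a variable `j`, which
forces heterogeneous equality. -/
theorem tensorPow_tensorPow_heq {m n : ℕ} (a : T.Hom m n) (k : ℕ) :
    ∀ j, HEq (tensorPow (tensorPow a k) j) (tensorPow a (k + j))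
  | 0 => HEq.rfl
  | j + 1 => tensor_heq (Nat.add_assoc m k j) (Nat.add_assoc n k j)
      (tensorPow_tensorPow_heq a k j)

/-! ### Band operators -/

theorem PreHilbert.ext {l : ℕ} {φ : T.PositiveFunctional l} {ξ η : PreHilbert φ}
    (h : ∀ p, ξ.entry p = η.entry p) : ξ = η :=
  Subtype.ext (funext h)

/-- The family of operators given by a matrix with entries `x k` at the places `(n+k, m+k)`. -/
def bandFamily {m n : ℕ} (x : ∀ k, T.Hom (m + k) (n + k)) (h : ∃ r, ∀ k, ‖x k‖ ≤ r) :
    ColumnFamily T where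
  toFun {l} φ := preHilbertOp φ m n fun k => T.compLeft (x k) l
  exists_bound := by
    obtain ⟨r, hr⟩ := h
    have hr0 : 0 ≤ r := (norm_nonneg _).trans (hr 0)
    refine ⟨r, hr0, fun φ ξ => preHilbertOp_norm_le φ hr0 (fun k c => ?_) ξ⟩
    refine (φ.re_comp_le (x k) c).trans ?_
    exact mul_le_mul_of_nonneg_right (by gcongr; exact hr k) (φ.re_adj_comp_self_nonneg c)

section band

variable {m n : ℕ} {x : ∀ k, T.Hom (m + k) (n + k)} {h : ∃ r, ∀ k, ‖x k‖ ≤ r} {l : ℕ}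
  {φ : T.PositiveFunctional l} (ξ : PreHilbert φ)

theorem bandFamily_entry_add (k : ℕ) :
    ((bandFamily x h).toFun φ ξ).entry (n + k) = T.comp (x k) (ξ.entry (m + k)) :=
  columnOp_add _ _ _ _ _

theorem bandFamily_entry_of_lt {p : ℕ} (hp : p < n) :
    ((bandFamily x h).toFun φ ξ).entry p = 0 :=
  columnOp_of_lt _ _ hp

theorem bandFamily_inner {x' : ∀ k, T.Hom (n + k) (m + k)} {h' : ∃ r, ∀ k, ‖x' k‖ ≤ r}
    (hx : ∀ k, x' k = T.adj (x k)) (η : PreHilbert φ) :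
    inner ℂ ((bandFamily x h).toFun φ ξ) η = inner ℂ ξ ((bandFamily x' h').toFun φ η) := by
  refine preHilbertOp_inner φ (fun k c d => ?_) ξ η
  change φ.toFun (T.comp (T.adj (T.comp (x k) c)) d) = φ.toFun (T.comp (T.adj c) (T.comp (x' k) d))
  rw [T.adj_comp, hx, T.comp_assoc]

end band

theorem bandFamily_elem_add {m n : ℕ} {x y z : ∀ k, T.Hom (m + k) (n + k)}
    {hx : ∃ r, ∀ k, ‖x k‖ ≤ r} {hy : ∃ r, ∀ k, ‖y k‖ ≤ r} {hz : ∃ r, ∀ k, ‖z k‖ ≤ r}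
    (h : ∀ k, z k = x k + y k) :
    (bandFamily z hz).elem = (bandFamily x hx).elem + (bandFamily y hy).elem := by
  refine ColumnFamily.elem_add fun φ ξ => PreHilbert.ext <| eq_of_shift (n := n) (fun p hp => ?_)
    fun k => ?_
  · change _ = ((bandFamily x hx).toFun φ ξ).entry p + ((bandFamily y hy).toFun φ ξ).entry p
    simp only [bandFamily_entry_of_lt _ hp, add_zero]
  · change _ = ((bandFamily x hx).toFun φ ξ).entry _ + ((bandFamily y hy).toFun φ ξ).entry _
    simp only [bandFamily_entry_add, h, T.add_comp]

theorem bandFamily_elem_smul {m n : ℕ} {x z : ∀ k, T.Hom (m + k) (n + k)} {c : ℂ}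
    {hx : ∃ r, ∀ k, ‖x k‖ ≤ r} {hz : ∃ r, ∀ k, ‖z k‖ ≤ r} (h : ∀ k, z k = c • x k) :
    (bandFamily z hz).elem = c • (bandFamily x hx).elem := by
  refine ColumnFamily.elem_smul fun φ ξ => PreHilbert.ext <| eq_of_shift (n := n) (fun p hp => ?_)
    fun k => ?_
  · change _ = c • ((bandFamily x hx).toFun φ ξ).entry p
    simp only [bandFamily_entry_of_lt _ hp, smul_zero]
  · change _ = c • ((bandFamily x hx).toFun φ ξ).entry _
    simp only [bandFamily_entry_add, h, T.smul_comp]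

/-- The operator `∑_k a ⊗ 1^k`, where `a ⊗ 1^k` is at the place `(n+k, m+k)`. -/
def toeplitzFamily {m n : ℕ} (a : T.Hom m n) : ColumnFamily T :=
  bandFamily (tensorPow a) ⟨‖a‖, norm_tensorPow_le a⟩

/-- The entries of a matrix unit. -/
def unitEntry {m n : ℕ} (a : T.Hom m n) : ∀ k, T.Hom (m + k) (n + k)
  | 0 => a
  | _ + 1 => 0

/-- The operator whose only non-zero entry is `a`, at the place `(n,m)`. -/
def unitFamily {m n : ℕ} (a : T.Hom m n) : ColumnFamily T :=
  bandFamily (unitEntry a) ⟨‖a‖, fun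
    | 0 => le_rfl
    | k + 1 => by rw [unitEntry, norm_zero]; exact norm_nonneg _⟩

/-- The projection onto the `p`-th entry. -/
def projFamily (T : RightTensorPrecategory.{u}) (p : ℕ) : ColumnFamily T where
  toFun {l} φ := preHilbertOp φ p p fun
    | 0 => LinearMap.id
    | _ + 1 => 0
  exists_bound := by
    refine ⟨1, zero_le_one, fun φ ξ => preHilbertOp_norm_le φ zero_le_one (fun k c => ?_) ξ⟩
    rcases k with _ | k
    · rw [one_pow, one_mul]; rfl
    · rw [LinearMap.zero_apply, T.comp_zero, map_zero, one_pow, one_mul]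
      exact φ.re_adj_comp_self_nonneg c

section entries

variable {m n l : ℕ} (a : T.Hom m n) {φ : T.PositiveFunctional l} (ξ : PreHilbert φ)

theorem toeplitz_entry_add (k : ℕ) :
    ((toeplitzFamily a).toFun φ ξ).entry (n + k) = T.comp (tensorPow a k) (ξ.entry (m + k)) :=
  bandFamily_entry_add ξ k

theorem toeplitz_entry_of_lt {p : ℕ} (hp : p < n) :
    ((toeplitzFamily a).toFun φ ξ).entry p = 0 :=
  bandFamily_entry_of_lt ξ hp

theorem toeplitz_entry_add_add (k j : ℕ) :
    ((toeplitzFamily a).toFun φ ξ).entry (n + k + j) =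
      T.comp (tensorPow (tensorPow a k) j) (ξ.entry (m + k + j)) := by
  have key : ∀ p q (_ : p = n + (k + j)) (_ : q = m + (k + j)) (x : T.Hom q p),
      HEq x (tensorPow a (k + j)) →
      ((toeplitzFamily a).toFun φ ξ).entry p = T.comp x (ξ.entry q) := by
    rintro p q rfl rfl x hx
    rw [eq_of_heq hx]
    exact toeplitz_entry_add a ξ (k + j)
  exact key _ _ (Nat.add_assoc n k j) (Nat.add_assoc m k j) _ (tensorPow_tensorPow_heq a k j)

theorem unit_entry_self : ((unitFamily a).toFun φ ξ).entry n = T.comp a (ξ.entry m) :=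
  bandFamily_entry_add ξ 0

theorem unit_entry_of_ne {p : ℕ} (hp : p ≠ n) : ((unitFamily a).toFun φ ξ).entry p = 0 := by
  rcases lt_or_gt_of_ne hp with h | h
  · exact bandFamily_entry_of_lt ξ h
  · obtain ⟨k, rfl⟩ := Nat.exists_eq_add_of_lt h
    exact (bandFamily_entry_add ξ (k + 1)).trans (T.zero_comp _)

theorem unit_zero_entry (p : ℕ) :
    ((unitFamily (0 : T.Hom m n)).toFun φ ξ).entry p = 0 := by
  by_cases hp : p = n
  · subst hp
    rw [unit_entry_self, T.zero_comp]
  · rw [unit_entry_of_ne _ _ hp]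

theorem proj_entry_self (p : ℕ) : ((projFamily T p).toFun φ ξ).entry p = ξ.entry p :=
  columnOp_add p p _ _ 0

theorem proj_entry_of_ne {p q : ℕ} (hq : q ≠ p) : ((projFamily T p).toFun φ ξ).entry q = 0 := by
  rcases lt_or_gt_of_ne hq with h | h
  · exact columnOp_of_lt _ _ h
  · obtain ⟨k, rfl⟩ := Nat.exists_eq_add_of_lt h
    exact columnOp_add p p _ _ (k + 1)

end entries

/-- The operators `∑_k a ⊗ 1^k`. -/
noncomputable def toeplitz (n m : ℕ) : T.Hom m n →ₗ[ℂ] ColumnAlg T where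
  toFun a := (toeplitzFamily a).elem
  map_add' a b := bandFamily_elem_add (tensorPow_add a b)
  map_smul' c a := bandFamily_elem_smul (tensorPow_smul c a)

/-- The matrix units. -/
noncomputable def matrixUnit (n m : ℕ) : T.Hom m n →ₗ[ℂ] ColumnAlg T where
  toFun a := (unitFamily a).elem
  map_add' _ _ := bandFamily_elem_add fun
    | 0 => rfl
    | _ + 1 => (add_zero _).symm
  map_smul' _ _ := bandFamily_elem_smul fun
    | 0 => rfl
    | _ + 1 => (smul_zero _).symm

/-- The projections onto the entries. -/
noncomputable def entryProj (T : RightTensorPrecategory.{u}) (p : ℕ) : ColumnAlg T :=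
  (projFamily T p).elem

theorem star_toeplitz (n m : ℕ) (a : T.Hom m n) :
    star (toeplitz n m a) = toeplitz m n (T.adj a) :=
  ColumnFamily.elem_star fun _ ξ η => bandFamily_inner ξ
    (fun k => by rw [← tensorPow_adj, T.adj_adj]) η

theorem star_matrixUnit (n m : ℕ) (a : T.Hom m n) :
    star (matrixUnit n m a) = matrixUnit m n (T.adj a) :=
  ColumnFamily.elem_star fun _ ξ η => bandFamily_inner ξ
    (fun
      | 0 => (T.adj_adj a).symm
      | _ + 1 => (T.adj_zero _ _).symm) η

/-- On the entry with index `n + k + j` the product acts by `(a ⊗ 1^(k+j)) (b ⊗ 1^j) = ((a ⊗ 1^k) b)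
⊗ 1^j`. The entries before `n + k` vanish because the image of the second factor starts at `m + k`.
This is the defining relation of a right tensor representation. -/
theorem toeplitz_mul (k l m n : ℕ) (a : T.Hom m n) (b : T.Hom l (m + k)) :
    toeplitz n m a * toeplitz (m + k) l b = toeplitz (n + k) l (T.comp (tensorPow a k) b) := by
  refine ColumnFamily.elem_mul fun φ ξ => PreHilbert.ext <| eq_of_shift (n := n + k)
    (fun p hp => ?_) fun j => ?_
  · rw [toeplitz_entry_of_lt _ _ hp]
    rcases lt_or_ge p n with h | h
    · rw [toeplitz_entry_of_lt _ _ h]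
    · obtain ⟨i, rfl⟩ := Nat.exists_eq_add_of_le h
      rw [toeplitz_entry_add, toeplitz_entry_of_lt _ _ (by omega), T.comp_zero]
  · rw [toeplitz_entry_add_add, toeplitz_entry_add, toeplitz_entry_add, tensorPow_comp,
      T.comp_assoc]

theorem toeplitz_mul_matrixUnit (k l m n : ℕ) (a : T.Hom m n) (b : T.Hom l (m + k)) :
    toeplitz n m a * matrixUnit (m + k) l b = matrixUnit (n + k) l (T.comp (tensorPow a k) b) := by
  refine ColumnFamily.elem_mul fun φ ξ => PreHilbert.ext fun p => ?_
  by_cases hp : p = n + k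
  · subst hp
    rw [toeplitz_entry_add, unit_entry_self, unit_entry_self, T.comp_assoc]
  · rw [unit_entry_of_ne _ _ hp]
    rcases lt_or_ge p n with h | h
    · rw [toeplitz_entry_of_lt _ _ h]
    · obtain ⟨i, rfl⟩ := Nat.exists_eq_add_of_le h
      rw [toeplitz_entry_add, unit_entry_of_ne _ _ (by omega), T.comp_zero]

theorem toeplitz_mul_matrixUnit_of_lt {l m n q : ℕ} (a : T.Hom m n) (b : T.Hom l q) (hq : q < m) :
    toeplitz n m a * matrixUnit q l b = 0 := by
  rw [← map_zero (matrixUnit (T := T) n l)]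
  refine ColumnFamily.elem_mul fun φ ξ => PreHilbert.ext <| eq_of_shift (n := n)
    (fun p hp => ?_) fun j => ?_
  · rw [unit_zero_entry, toeplitz_entry_of_lt _ _ hp]
  · rw [toeplitz_entry_add, unit_entry_of_ne _ _ (by omega), T.comp_zero]
    rw [unit_zero_entry]

theorem matrixUnit_mul (l m n : ℕ) (a : T.Hom m n) (b : T.Hom l m) :
    matrixUnit n m a * matrixUnit m l b = matrixUnit n l (T.comp a b) := by
  refine ColumnFamily.elem_mul fun φ ξ => PreHilbert.ext fun p => ?_
  by_cases hp : p = n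
  · subst hp
    rw [unit_entry_self, unit_entry_self, unit_entry_self, T.comp_assoc]
  · rw [unit_entry_of_ne _ _ hp, unit_entry_of_ne _ _ hp]

/-- The failure of coisometry at `a` is exactly one matrix unit, with entry `a`. Dividing out the
matrix units with entries in `J` therefore imposes coisometry on `J`. -/
theorem toeplitz_eq_add (n m : ℕ) (a : T.Hom m n) :
    toeplitz n m a = matrixUnit n m a + toeplitz (n + 1) (m + 1) (T.tensor a) := by
  refine ColumnFamily.elem_add fun φ ξ => PreHilbert.ext <| eq_of_shift (n := n + 1)
    (fun p hp => ?_) fun j => ?_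
  · change _ = ((unitFamily a).toFun φ ξ).entry p + ((toeplitzFamily (T.tensor a)).toFun φ ξ).entry p
    rw [toeplitz_entry_of_lt _ _ hp, add_zero]
    rcases Nat.lt_succ_iff_lt_or_eq.1 hp with h | rfl
    · rw [toeplitz_entry_of_lt _ _ h, unit_entry_of_ne _ _ h.ne]
    · rw [unit_entry_self]
      exact toeplitz_entry_add a ξ 0
  · change _ = ((unitFamily a).toFun φ ξ).entry _ + ((toeplitzFamily (T.tensor a)).toFun φ ξ).entry _
    rw [toeplitz_entry_add_add, toeplitz_entry_add, unit_entry_of_ne _ _ (by omega), zero_add]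
    rfl

theorem norm_entryProj_le (p : ℕ) : ‖entryProj T p‖ ≤ 1 := by
  refine ColumnFamily.norm_elem_le _ zero_le_one fun φ ξ => ?_
  refine preHilbertOp_norm_le φ zero_le_one (fun k c => ?_) ξ
  rcases k with _ | k
  · rw [one_pow, one_mul]; rfl
  · rw [LinearMap.zero_apply, T.comp_zero, map_zero, one_pow, one_mul]
    exact φ.re_adj_comp_self_nonneg c

theorem entryProj_mul_matrixUnit (n m : ℕ) (a : T.Hom m n) :
    entryProj T n * matrixUnit n m a = matrixUnit n m a := by
  refine ColumnFamily.elem_mul fun φ ξ => PreHilbert.ext fun p => ?_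
  by_cases hp : p = n
  · subst hp
    rw [proj_entry_self]
  · rw [proj_entry_of_ne _ hp, unit_entry_of_ne _ _ hp]

theorem matrixUnit_mul_entryProj (n m : ℕ) (a : T.Hom m n) :
    matrixUnit n m a * entryProj T m = matrixUnit n m a := by
  refine ColumnFamily.elem_mul fun φ ξ => PreHilbert.ext fun p => ?_
  by_cases hp : p = n
  · subst hp
    rw [unit_entry_self, proj_entry_self, unit_entry_self]
  · rw [unit_entry_of_ne _ _ hp, unit_entry_of_ne _ _ hp]

theorem entryProj_mul_matrixUnit_of_ne {n m p : ℕ} (a : T.Hom m n) (hp : p ≠ n) :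
    entryProj T p * matrixUnit n m a = 0 := by
  rw [← map_zero (matrixUnit (T := T) n m)]
  refine ColumnFamily.elem_mul fun φ ξ => PreHilbert.ext fun q => ?_
  rw [unit_zero_entry]
  by_cases hq : q = p
  · subst hq
    rw [proj_entry_self, unit_entry_of_ne _ _ hp]
  · rw [proj_entry_of_ne _ hq]

theorem matrixUnit_mul_entryProj_of_ne {n m q : ℕ} (a : T.Hom m n) (hq : q ≠ m) :
    matrixUnit n m a * entryProj T q = 0 := by
  rw [← map_zero (matrixUnit (T := T) n m)]
  refine ColumnFamily.elem_mul fun φ ξ => PreHilbert.ext fun p => ?_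
  by_cases hp : p = n
  · subst hp
    rw [unit_entry_self, unit_entry_self, proj_entry_of_ne _ hq.symm, T.comp_zero, T.zero_comp]
  · rw [unit_entry_of_ne _ _ hp, unit_entry_of_ne _ _ hp]

theorem entryProj_mul_toeplitz_of_lt {n m p : ℕ} (a : T.Hom m n) (hp : p < n) :
    entryProj T p * toeplitz n m a = 0 := by
  rw [← map_zero (matrixUnit (T := T) n m)]
  refine ColumnFamily.elem_mul fun φ ξ => PreHilbert.ext fun q => ?_
  rw [unit_zero_entry]
  by_cases hq : q = p
  · subst hq
    rw [proj_entry_self, toeplitz_entry_of_lt _ _ hp]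
  · rw [proj_entry_of_ne _ hq]

/-- Compression recovers every `a ⊗ 1^k` from the Toeplitz operator of `a`; membership in `J` and
norms are read off in this way. -/
theorem toeplitz_entry (n m k : ℕ) (a : T.Hom m n) :
    entryProj T (n + k) * (toeplitz n m a * entryProj T (m + k)) =
      matrixUnit (n + k) (m + k) (tensorPow a k) := by
  have h : toeplitz n m a * entryProj T (m + k) = matrixUnit (n + k) (m + k) (tensorPow a k) := by
    refine ColumnFamily.elem_mul fun φ ξ => PreHilbert.ext <| eq_of_shift (n := n)
      (fun p hp => ?_) fun j => ?_
    · rw [unit_entry_of_ne _ _ (by omega), toeplitz_entry_of_lt _ _ hp]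
    · rw [toeplitz_entry_add]
      by_cases hj : j = k
      · subst hj
        rw [proj_entry_self, unit_entry_self]
      · rw [proj_entry_of_ne _ (by omega), unit_entry_of_ne _ _ (by omega), T.comp_zero]
  rw [h, entryProj_mul_matrixUnit]

/-- The matrix unit of `a` sends the column with the single entry `a*` to the one with the single
entry `a a*`. Its squared seminorm is the value of `φ` at `(a a*)* (a a*)`, which is nonzero for a
suitable `φ` if `a ≠ 0`. -/
theorem matrixUnit_diag_injective (p : ℕ) :
    Function.Injective (matrixUnit p p : T.Hom p p →ₗ[ℂ] ColumnAlg T) := by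
  rw [← LinearMap.ker_eq_bot, Submodule.eq_bot_iff]
  intro a ha
  by_contra hne
  have hne' : T.comp a (T.adj a) ≠ 0 := by
    intro h
    have h1 := T.norm_adj_comp_self (T.adj a)
    rw [T.adj_adj, h, norm_zero] at h1
    have h2 : T.adj a = 0 := norm_eq_zero.1 (pow_eq_zero_iff two_ne_zero |>.1 h1.symm)
    exact hne (by rw [← T.adj_adj a, h2, T.adj_zero])
  obtain ⟨φ, hφ⟩ := CStarPrecategory.exists_positiveFunctional hne'
  let ξ : PreHilbert φ := (⟨Pi.single p (T.adj a), p + 1, fun q hq =>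
    Pi.single_eq_of_ne (by omega) _⟩ : Column T p)
  have hξ : ξ.entry p = T.adj a := Pi.single_eq_same _ _
  have h := ColumnFamily.elem_eq_zero φ (unitFamily a) ha ξ
  have h1 := preHilbert_norm_sq φ ((unitFamily a).toFun φ ξ)
  rw [h, tsum_eq_single p] at h1
  · rw [innerAt, unit_entry_self, hξ] at h1
    exact hφ (by rw [← h1]; simp)
  · intro q hq
    rw [innerAt, unit_entry_of_ne _ _ hq, T.comp_zero, map_zero, Complex.zero_re]

/-- On the diagonal the matrix units form an injective, hence isometric, `*`-homomorphism; the
`C*`-equality extends this to `T(m,n)`. -/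
theorem norm_matrixUnit (n m : ℕ) (a : T.Hom m n) : ‖matrixUnit n m a‖ = ‖a‖ := by
  let f : T.EndAlg m →⋆ₙₐ[ℂ] ColumnAlg T :=
    { toFun := fun x => matrixUnit (T := T) m m x
      map_smul' := fun c x => (matrixUnit (T := T) m m).map_smul c x
      map_zero' := (matrixUnit (T := T) m m).map_zero
      map_add' := fun x y => (matrixUnit (T := T) m m).map_add x y
      map_mul' := fun x y => (matrixUnit_mul (T := T) m m m x y).symm
      map_star' := fun x => (star_matrixUnit (T := T) m m x).symm }
  have h : ∀ y : T.EndAlg m, ‖f y‖ = ‖y‖ :=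
    NonUnitalStarAlgHom.norm_map f (matrixUnit_diag_injective m)
  have h1 : ‖matrixUnit m m (T.comp (T.adj a) a)‖ = ‖T.comp (T.adj a) a‖ := h (T.comp (T.adj a) a)
  rw [← matrixUnit_mul (T := T) m n m, ← star_matrixUnit, CStarRing.norm_star_mul_self,
    T.norm_adj_comp_self, ← sq] at h1
  exact (sq_eq_sq₀ (norm_nonneg _) (norm_nonneg _)).1 h1

/-- A `C*`-algebra which contains matrix units over `T` and the infinite matrices
`∑_k a ⊗ 1^k`, with the projections onto the entries. -/
structure MatrixModel (T : RightTensorPrecategory.{u}) (A : Type u) [NonUnitalCStarAlgebra A] where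
  toeplitz : ∀ n m : ℕ, T.Hom m n →ₗ[ℂ] A
  matrixUnit : ∀ n m : ℕ, T.Hom m n →ₗ[ℂ] A
  entryProj : ℕ → A
  star_toeplitz : ∀ (n m : ℕ) (a : T.Hom m n),
    star (toeplitz n m a) = toeplitz m n (T.adj a)
  star_matrixUnit : ∀ (n m : ℕ) (a : T.Hom m n),
    star (matrixUnit n m a) = matrixUnit m n (T.adj a)
  toeplitz_mul : ∀ (k l m n : ℕ) (a : T.Hom m n) (b : T.Hom l (m + k)),
    toeplitz n m a * toeplitz (m + k) l b = toeplitz (n + k) l (T.comp (tensorPow a k) b)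
  toeplitz_mul_matrixUnit : ∀ (k l m n : ℕ) (a : T.Hom m n) (b : T.Hom l (m + k)),
    toeplitz n m a * matrixUnit (m + k) l b = matrixUnit (n + k) l (T.comp (tensorPow a k) b)
  toeplitz_mul_matrixUnit_of_lt : ∀ {l m n q : ℕ} (a : T.Hom m n) (b : T.Hom l q), q < m →
    toeplitz n m a * matrixUnit q l b = 0
  toeplitz_eq_add : ∀ (n m : ℕ) (a : T.Hom m n),
    toeplitz n m a = matrixUnit n m a + toeplitz (n + 1) (m + 1) (T.tensor a)
  norm_entryProj_le : ∀ p, ‖entryProj p‖ ≤ 1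
  entryProj_mul_matrixUnit : ∀ (n m : ℕ) (a : T.Hom m n),
    entryProj n * matrixUnit n m a = matrixUnit n m a
  matrixUnit_mul_entryProj : ∀ (n m : ℕ) (a : T.Hom m n),
    matrixUnit n m a * entryProj m = matrixUnit n m a
  entryProj_mul_matrixUnit_of_ne : ∀ {n m p : ℕ} (a : T.Hom m n), p ≠ n →
    entryProj p * matrixUnit n m a = 0
  matrixUnit_mul_entryProj_of_ne : ∀ {n m q : ℕ} (a : T.Hom m n), q ≠ m →
    matrixUnit n m a * entryProj q = 0
  entryProj_mul_toeplitz_of_lt : ∀ {n m p : ℕ} (a : T.Hom m n), p < n →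
    entryProj p * toeplitz n m a = 0
  toeplitz_entry : ∀ (n m k : ℕ) (a : T.Hom m n),
    entryProj (n + k) * (toeplitz n m a * entryProj (m + k)) =
      matrixUnit (n + k) (m + k) (tensorPow a k)
  norm_matrixUnit : ∀ (n m : ℕ) (a : T.Hom m n), ‖matrixUnit n m a‖ = ‖a‖

/-- The model on the spaces of columns. -/
noncomputable def columnModel (T : RightTensorPrecategory.{u}) : MatrixModel T (ColumnAlg T) where
  toeplitz := toeplitz
  matrixUnit := matrixUnit
  entryProj := entryProj T
  star_toeplitz := star_toeplitz
  star_matrixUnit := star_matrixUnit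
  toeplitz_mul := toeplitz_mul
  toeplitz_mul_matrixUnit := toeplitz_mul_matrixUnit
  toeplitz_mul_matrixUnit_of_lt := toeplitz_mul_matrixUnit_of_lt
  toeplitz_eq_add := toeplitz_eq_add
  norm_entryProj_le := norm_entryProj_le
  entryProj_mul_matrixUnit := entryProj_mul_matrixUnit
  matrixUnit_mul_entryProj := matrixUnit_mul_entryProj
  entryProj_mul_matrixUnit_of_ne := entryProj_mul_matrixUnit_of_ne
  matrixUnit_mul_entryProj_of_ne := matrixUnit_mul_entryProj_of_ne
  entryProj_mul_toeplitz_of_lt := entryProj_mul_toeplitz_of_lt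
  toeplitz_entry := toeplitz_entry
  norm_matrixUnit := norm_matrixUnit

end RightTensorPrecategory

namespace RightTensorPrecategory

variable {T : RightTensorPrecategory.{u}}

/-! ### The reduction ideal -/

theorem mem_space_of_heq (J : T.Ideal) {m n m' n' : ℕ} (hm : m = m') (hn : n = n')
    {a : T.Hom m n} {a' : T.Hom m' n'} (h : HEq a a') (ha : a ∈ J.space m n) :
    a' ∈ J.space m' n' := by
  subst hm hn
  rwa [← eq_of_heq h]

theorem eq_zero_of_heq {m n m' n' : ℕ} (hm : m = m') (hn : n = n')
    {a : T.Hom m n} {a' : T.Hom m' n'} (h : HEq a a') (ha : a = 0) : a' = 0 := by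
  subst hm hn
  rwa [← eq_of_heq h]

theorem mem_saturationStep (J : T.Ideal) : ∀ (k : ℕ) {m n : ℕ} (b : T.Hom m n),
    (∀ j, tensorPow b j ∈ J.space (m + j) (n + j)) → tensorPow b k = 0 →
      b ∈ saturationStep J (fun _ _ => ⊥) k m n
  | 0, _, _, _, _, hb => hb
  | k + 1, m, n, b, hJ, hb => by
    refine ⟨hJ 0, mem_saturationStep J k (T.tensor b) (fun j => ?_) ?_⟩
    · exact mem_space_of_heq J (Nat.add_assoc m 1 j).symm (Nat.add_assoc n 1 j).symm
        (tensorPow_tensorPow_heq b 1 j).symm (hJ (1 + j))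
    · have h : ∀ i, i = k + 1 → tensorPow b i = 0 := by
        rintro _ rfl
        exact hb
      exact eq_zero_of_heq (Nat.add_assoc m 1 k).symm (Nat.add_assoc n 1 k).symm
        (tensorPow_tensorPow_heq b 1 k).symm (h (1 + k) (Nat.add_comm 1 k))

/-- The iterated right tensoring on the endomorphisms of an object, as a `*`-homomorphism. -/
def tensorPowHom (T : RightTensorPrecategory.{u}) (m k : ℕ) :
    T.EndAlg m →⋆ₙₐ[ℂ] T.EndAlg (m + k) where
  toFun x := tensorPow (m := m) (n := m) x k
  map_smul' c x := tensorPow_smul (m := m) (n := m) c x k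
  map_zero' := by
    have h := tensorPow_smul (T := T) (m := m) (n := m) 0 0 k
    rw [zero_smul, zero_smul] at h
    exact h
  map_add' x y := tensorPow_add (m := m) (n := m) x y k
  map_mul' x y := tensorPow_comp (m := m) (n := m) (l := m) x y k
  map_star' x := tensorPow_adj (m := m) (n := m) x k

/-- For selfadjoint `h` there is `e` which is killed by every `*`-homomorphism mapping `h` to an
element of norm at most `δ`, and such that `(1 - e) h (1 - e)` has norm at most `2 δ`. -/
theorem exists_cutoff {A : Type u} [NonUnitalCStarAlgebra A] (h : A) (hh : IsSelfAdjoint h)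
    {δ : ℝ} (hδ : 0 < δ) : ∃ e : A, IsSelfAdjoint e ∧
      ‖h - h * e - e * h + e * h * e‖ ≤ 2 * δ ∧
      ∀ {B : Type u} [NonUnitalCStarAlgebra B] (f : A →⋆ₙₐ[ℂ] B), ‖f h‖ ≤ δ → f e = 0 := by
  obtain ⟨g, hgc, hg0, hg1⟩ : ∃ g : ℝ → ℝ, Continuous g ∧ (∀ t, |t| ≤ δ → g t = 0) ∧
      ∀ t, |t * (1 - g t) ^ 2| ≤ 2 * δ := by
    -- This `g` vanishes on `[-δ, δ]` and equals `1` outside `[-2δ, 2δ]`. So `t (1 - g)²` is at most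
    -- `2δ` in modulus, and `g (f h) = 0` once the spectrum of `f h` lies in `[-δ, δ]`.
    refine ⟨fun t => min 1 (max 0 ((|t| - δ) / δ)), by fun_prop, fun t ht => ?_, fun t => ?_⟩
    · have : (|t| - δ) / δ ≤ 0 := div_nonpos_of_nonpos_of_nonneg (by linarith) hδ.le
      simp only [max_eq_left this]
      exact min_eq_right zero_le_one
    · rw [abs_mul, abs_of_nonneg (sq_nonneg (_ : ℝ))]
      beta_reduce
      rcases le_total (2 * δ) |t| with ht | ht
      · have : 1 ≤ (|t| - δ) / δ := by rw [le_div_iff₀ hδ]; linarith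
        rw [min_eq_left (this.trans (le_max_right _ _))]
        simp only [sub_self, ne_eq, OfNat.ofNat_ne_zero, not_false_eq_true, zero_pow, mul_zero]
        positivity
      · have h0 : 0 ≤ min 1 (max 0 ((|t| - δ) / δ)) := le_min zero_le_one (le_max_left _ _)
        have h1 : min 1 (max 0 ((|t| - δ) / δ)) ≤ 1 := min_le_left _ _
        have h2 : (1 - min 1 (max 0 ((|t| - δ) / δ))) ^ 2 ≤ 1 := by nlinarith
        nlinarith [abs_nonneg t]
  have hg00 : g 0 = 0 := hg0 0 (by simpa using hδ.le)
  refine ⟨cfcₙ g h, cfcₙ_predicate g h, ?_, fun f hf => ?_⟩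
  · have c1 : Continuous fun t => t * g t := by fun_prop
    have c2 : Continuous fun t => g t * t := by fun_prop
    have c3 : Continuous fun t => g t * t * g t := by fun_prop
    have e2 : h - h * cfcₙ g h - cfcₙ g h * h + cfcₙ g h * h * cfcₙ g h
        = cfcₙ (fun t => t - t * g t - g t * t + g t * t * g t) h := by
      rw [cfcₙ_add (f := fun t => t - t * g t - g t * t) (g := fun t => g t * t * g t) h
          ((continuous_id'.sub c1).sub c2).continuousOn (by simp) c3.continuousOn (by simp),
        cfcₙ_sub (f := fun t => t - t * g t) (g := fun t => g t * t) h
          (continuous_id'.sub c1).continuousOn (by simp) c2.continuousOn (by simp),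
        cfcₙ_sub (f := fun t => t) (g := fun t => t * g t) h
          continuous_id'.continuousOn (by simp) c1.continuousOn (by simp),
        cfcₙ_mul (f := fun t => g t * t) (g := g) h c2.continuousOn (by simp)
          hgc.continuousOn hg00,
        cfcₙ_mul (f := fun t => t) (g := g) h continuous_id'.continuousOn (by simp)
          hgc.continuousOn hg00,
        cfcₙ_mul (f := g) (g := fun t => t) h hgc.continuousOn hg00
          continuous_id'.continuousOn (by simp),
        cfcₙ_id' ℝ h]
    rw [e2]
    refine norm_cfcₙ_le fun t _ => ?_
    have : t - t * g t - g t * t + g t * t * g t = t * (1 - g t) ^ 2 := by ring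
    rw [this]
    exact hg1 t
  · have hfh : IsSelfAdjoint (f h) := hh.map f
    rw [NonUnitalStarAlgHomClass.map_cfcₙ f g h hgc.continuousOn hg00 f.continuous_of_cstar hh hfh,
      ← cfcₙ_zero ℝ (f h)]
    refine cfcₙ_congr fun t ht => hg0 t ?_
    rw [Unitization.quasispectrum_eq_spectrum_inr' ℝ ℂ] at ht
    have := spectrum.norm_le_norm_of_mem ht
    rw [Unitization.norm_inr] at this
    exact this.trans hf

/-- If `a ⊗ 1^k` is small, a cutoff `e` of `a* a` is killed by `⊗ 1^k` while `a e` is still close to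
`a`. All `(a e) ⊗ 1^j` lie in `J`, so `a e` lies in `S_k`. -/
theorem mem_reductionIdeal (J : T.Ideal) {m n : ℕ} {a : T.Hom m n}
    (hJ : ∀ k, tensorPow a k ∈ J.space (m + k) (n + k))
    (hlim : ∀ ε > 0, ∃ k, ‖tensorPow a k‖ ≤ ε) : a ∈ reductionIdeal J m n := by
  refine Metric.mem_closure_iff.2 fun ε hε => ?_
  obtain ⟨k, hk⟩ := hlim (ε / 2) (by positivity)
  -- The threshold `(ε/2)²` bounds `‖(a* a) ⊗ 1^k‖`, and it gives `‖a - a e‖² ≤ 2 (ε/2)² < ε²`.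
  obtain ⟨e, he, he1, he2⟩ := exists_cutoff (A := T.EndAlg m) (T.comp (T.adj a) a)
    (by
      change T.adj (T.comp (T.adj a) a) = T.comp (T.adj a) a
      rw [T.adj_comp, T.adj_adj])
    (show 0 < (ε / 2) ^ 2 by positivity)
  set e' : T.Hom m m := e
  have hes : T.adj e' = e' := he
  have hzero : tensorPow e' k = 0 := by
    refine he2 (tensorPowHom T m k) ?_
    change ‖tensorPow (T.comp (T.adj a) a) k‖ ≤ _
    rw [tensorPow_comp, tensorPow_adj, T.norm_adj_comp_self]
    gcongr
  refine ⟨T.comp a e', ?_, ?_⟩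
  · refine Submodule.mem_iSup_of_mem k (mem_saturationStep J k _ (fun j => ?_) ?_)
    · rw [tensorPow_comp]
      exact J.mem_comp _ (hJ j)
    · rw [tensorPow_comp, hzero, T.comp_zero]
  · have key : T.comp (T.adj (a - T.comp a e')) (a - T.comp a e') =
        T.comp (T.adj a) a - T.comp (T.comp (T.adj a) a) e' - T.comp e' (T.comp (T.adj a) a)
          + T.comp (T.comp e' (T.comp (T.adj a) a)) e' := by
      rw [T.adj_sub, T.adj_comp, hes, T.comp_sub, T.sub_comp, T.sub_comp]
      simp only [T.comp_assoc]
      abel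
    have h2 := T.norm_adj_comp_self (a - T.comp a e')
    rw [key] at h2
    have h3 : ‖a - T.comp a e'‖ ^ 2 ≤ 2 * (ε / 2) ^ 2 := h2 ▸ he1
    rw [dist_eq_norm]
    refine lt_of_pow_lt_pow_left₀ 2 hε.le (h3.trans_lt ?_)
    nlinarith

/-! ### A representation with kernel the reduction ideal -/

/-- The compression `x ↦ p x q`. -/
noncomputable def compress {A : Type u} [NonUnitalCStarAlgebra A] (p q : A) : A →ₗ[ℂ] A :=
  LinearMap.mulLeft ℂ p ∘ₗ LinearMap.mulRight ℂ q

theorem compress_apply {A : Type u} [NonUnitalCStarAlgebra A] (p q x : A) :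
    compress p q x = p * (x * q) := rfl

theorem norm_compress_le {A : Type u} [NonUnitalCStarAlgebra A] {p q : A} (hp : ‖p‖ ≤ 1)
    (hq : ‖q‖ ≤ 1) (x : A) : ‖compress p q x‖ ≤ ‖x‖ := by
  rw [compress_apply]
  exact (norm_mul_le _ _).trans ((mul_le_of_le_one_left (norm_nonneg _) hp).trans
    ((norm_mul_le _ _).trans (mul_le_of_le_one_right (norm_nonneg _) hq)))

theorem continuous_compress {A : Type u} [NonUnitalCStarAlgebra A] (p q : A) :
    Continuous (compress p q) :=
  (continuous_const_mul p).comp (continuous_mul_const q)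

theorem mul_mem_closure_span {A : Type u} [NonUnitalCStarAlgebra A] {S : Set A} {t x : A}
    (h : ∀ s ∈ S, t * s ∈ (Submodule.span ℂ S).topologicalClosure)
    (hx : x ∈ (Submodule.span ℂ S).topologicalClosure) :
    t * x ∈ (Submodule.span ℂ S).topologicalClosure := by
  have hle : (Submodule.span ℂ S).topologicalClosure ≤
      (Submodule.span ℂ S).topologicalClosure.comap (LinearMap.mulLeft ℂ t) :=
    Submodule.topologicalClosure_minimal _ (Submodule.span_le.2 h)
      ((Submodule.isClosed_topologicalClosure _).preimage (continuous_const_mul t))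
  exact hle hx

namespace MatrixModel

variable {A : Type u} [NonUnitalCStarAlgebra A] (M : MatrixModel T A) (J : T.Ideal)

/-- The closed span of the matrix units with entries in `J`. -/
noncomputable def unitSpan : Submodule ℂ (A) :=
  (Submodule.span ℂ {x | ∃ (n m : ℕ) (a : T.Hom m n), a ∈ J.space m n ∧
    x = M.matrixUnit n m a}).topologicalClosure

theorem isClosed_unitSpan : IsClosed (M.unitSpan J : Set (A)) :=
  Submodule.isClosed_topologicalClosure _

variable {M J}

theorem matrixUnit_mem_unitSpan {n m : ℕ} {a : T.Hom m n} (ha : a ∈ J.space m n) :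
    M.matrixUnit n m a ∈ M.unitSpan J :=
  Submodule.le_topologicalClosure _ (Submodule.subset_span ⟨n, m, a, ha, rfl⟩)

theorem unitSpan_le {N : Submodule ℂ (A)} (hN : IsClosed (N : Set (A)))
    (h : ∀ (n m : ℕ) (a : T.Hom m n), a ∈ J.space m n → M.matrixUnit n m a ∈ N) :
    M.unitSpan J ≤ N := by
  refine Submodule.topologicalClosure_minimal _ (Submodule.span_le.2 ?_) hN
  rintro _ ⟨n, m, a, ha, rfl⟩
  exact h n m a ha

theorem star_mem_unitSpan {x : A} (hx : x ∈ M.unitSpan J) : star x ∈ M.unitSpan J := by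
  refine map_mem_closure continuous_star hx fun y hy => ?_
  induction hy using Submodule.span_induction with
  | mem y hy =>
    obtain ⟨n, m, a, ha, rfl⟩ := hy
    rw [M.star_matrixUnit]
    exact Submodule.subset_span ⟨m, n, _, J.adj_mem ha, rfl⟩
  | zero => rw [star_zero]; exact zero_mem _
  | add y z _ _ hy hz => rw [star_add]; exact add_mem hy hz
  | smul c y _ hy => rw [star_smul]; exact Submodule.smul_mem _ _ hy

/-- In `(a ⊗ 1^k) b` only `a` is tensored, so that no invariance of `J` under `⊗ 1` is needed. -/
theorem toeplitz_mul_mem_unitSpan {n m : ℕ} (a : T.Hom m n) {x : A}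
    (hx : x ∈ M.unitSpan J) : M.toeplitz n m a * x ∈ M.unitSpan J := by
  refine mul_mem_closure_span ?_ hx
  rintro _ ⟨p, q, b, hb, rfl⟩
  change M.toeplitz n m a * M.matrixUnit p q b ∈ M.unitSpan J
  rcases lt_or_ge p m with h | h
  · rw [M.toeplitz_mul_matrixUnit_of_lt _ _ h]
    exact zero_mem _
  · obtain ⟨k, rfl⟩ := Nat.exists_eq_add_of_le h
    rw [M.toeplitz_mul_matrixUnit]
    exact M.matrixUnit_mem_unitSpan (J.comp_mem _ hb)

variable (M J)

/-- The idealizer of `M.unitSpan J`. -/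
noncomputable abbrev unitIdealizer : NonUnitalStarSubalgebra ℂ (A) :=
  idealizer (M.unitSpan J) fun _ => M.star_mem_unitSpan

instance : IsClosed (M.unitIdealizer J : Set (A)) :=
  isClosed_idealizer _ (M.isClosed_unitSpan J)

/-- `M.unitSpan J` as an ideal of its idealizer. -/
noncomputable def unitIdeal : ClosedStarIdeal (M.unitIdealizer J) :=
  idealOfIdealizer (M.unitSpan J) (fun _ => M.star_mem_unitSpan) (M.isClosed_unitSpan J)

theorem toeplitz_mem_unitIdealizer {n m : ℕ} (a : T.Hom m n) :
    M.toeplitz n m a ∈ M.unitIdealizer J := by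
  intro x hx
  refine ⟨M.toeplitz_mul_mem_unitSpan a hx, ?_⟩
  have h := M.star_mem_unitSpan (M.toeplitz_mul_mem_unitSpan (T.adj a) (M.star_mem_unitSpan hx))
  rwa [← M.star_toeplitz, star_mul, star_star, star_star] at h

/-- The class of the operator `∑_k a ⊗ 1^k` modulo the matrix units with entries in `J`. -/
noncomputable def toeplitzClass (n m : ℕ) : T.Hom m n →ₗ[ℂ] (M.unitIdeal J).Quot :=
  (M.unitIdeal J).mkₗ ∘ₗ (M.toeplitz n m).codRestrict (M.unitIdealizer J).toSubmodule
    (M.toeplitz_mem_unitIdealizer J)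

theorem toeplitzClass_eq_zero {n m : ℕ} {a : T.Hom m n} :
    M.toeplitzClass J n m a = 0 ↔ M.toeplitz n m a ∈ M.unitSpan J :=
  (M.unitIdeal J).mkₗ_eq_zero

/-- The representation of `K` by the classes of the operators `∑_k a ⊗ 1^k`. -/
noncomputable def toeplitzRep (K : T.Ideal) : Representation K (M.unitIdeal J).Quot where
  map n m := M.toeplitzClass J n m ∘ₗ (K.space m n).subtype
  map_adj n m a := congrArg (M.unitIdeal J).mkₗ (Subtype.ext (M.star_toeplitz n m a.1))
  map_tensor k l m n a b := congrArg (M.unitIdeal J).mkₗ (Subtype.ext (M.toeplitz_mul k l m n a.1 b.1))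

theorem toeplitzRep_isCoisometricOn (K : T.Ideal) : (M.toeplitzRep J K).IsCoisometricOn J := by
  intro n m a h h' ha
  refine (M.unitIdeal J).proj_eq_proj.2 ?_
  change M.toeplitz n m a - M.toeplitz (n + 1) (m + 1) (T.tensor a) ∈ M.unitSpan J
  rw [M.toeplitz_eq_add, add_sub_cancel_right]
  exact M.matrixUnit_mem_unitSpan ha

/-- The entry of an operator at the place `(p,q)`, as an operator. -/
noncomputable def entryMap (p q : ℕ) :
    A →ₗ[ℂ] A :=
  compress (M.entryProj p) (M.entryProj q)

theorem entryMap_apply (p q : ℕ) (x : A) :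
    M.entryMap p q x = M.entryProj p * (x * M.entryProj q) := compress_apply _ _ _

theorem norm_entryMap_le (p q : ℕ) (x : A) : ‖M.entryMap p q x‖ ≤ ‖x‖ :=
  norm_compress_le (M.norm_entryProj_le p) (M.norm_entryProj_le q) x

theorem continuous_entryMap (p q : ℕ) : Continuous (M.entryMap p q) :=
  continuous_compress _ _

theorem isometry_matrixUnit (n m : ℕ) : Isometry (M.matrixUnit n m) :=
  AddMonoidHomClass.isometry_of_norm _ (M.norm_matrixUnit n m)

theorem isClosed_map_matrixUnit (n m : ℕ) :
    IsClosed ((J.space m n).map (M.matrixUnit n m) : Set (A)) :=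
  (M.isometry_matrixUnit n m).isClosedEmbedding.isClosedMap _ (J.isClosed_space m n)

theorem entryMap_matrixUnit_of_ne {p q n m : ℕ} (a : T.Hom m n) (h : p ≠ n ∨ q ≠ m) :
    M.entryMap p q (M.matrixUnit n m a) = 0 := by
  rw [M.entryMap_apply]
  rcases h with h | h
  · rw [← mul_assoc, M.entryProj_mul_matrixUnit_of_ne a h, zero_mul]
  · rw [M.matrixUnit_mul_entryProj_of_ne a h, mul_zero]

theorem entryMap_matrixUnit (n m : ℕ) (a : T.Hom m n) :
    M.entryMap n m (M.matrixUnit n m a) = M.matrixUnit n m a := by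
  rw [M.entryMap_apply, M.matrixUnit_mul_entryProj, M.entryProj_mul_matrixUnit]

variable {M J}

/-- The condition is clear for matrix units and passes to limits: the matrix unit map is isometric,
so it sends the closed space `J(q,p)` to a closed space. -/
theorem entryMap_mem {x : A} (hx : x ∈ M.unitSpan J) (p q : ℕ) :
    M.entryMap p q x ∈ (J.space q p).map (M.matrixUnit p q) := by
  refine M.unitSpan_le (N := ((J.space q p).map (M.matrixUnit p q)).comap (M.entryMap p q))
    ((M.isClosed_map_matrixUnit J p q).preimage (M.continuous_entryMap p q)) ?_ hx
  intro n m b hb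
  change M.entryMap p q (M.matrixUnit n m b) ∈ (J.space q p).map (M.matrixUnit p q)
  by_cases h : p = n ∧ q = m
  · obtain ⟨rfl, rfl⟩ := h
    rw [M.entryMap_matrixUnit]
    exact Submodule.mem_map_of_mem hb
  · rw [M.entryMap_matrixUnit_of_ne _ (not_and_or.1 h)]
    exact zero_mem _

theorem mem_of_matrixUnit_mem_map {p q : ℕ} {a : T.Hom q p}
    (h : M.matrixUnit p q a ∈ (J.space q p).map (M.matrixUnit p q)) : a ∈ J.space q p := by
  obtain ⟨b, hb, hab⟩ := h
  rwa [← (M.isometry_matrixUnit p q).injective hab]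

/-- An element of the closed span is a norm limit of matrices with finitely many nonzero entries, so
its far entries are uniformly small. -/
theorem exists_entryMap_le {x : A} (hx : x ∈ M.unitSpan J) {ε : ℝ} (hε : 0 < ε) :
    ∃ N, ∀ p, N ≤ p → ∀ q, ‖M.entryMap p q x‖ ≤ ε := by
  obtain ⟨y, hy, hxy⟩ := Metric.mem_closure_iff.1 hx ε hε
  have h : ∃ N, ∀ p, N ≤ p → ∀ q, M.entryMap p q y = 0 := by
    clear hxy
    induction hy using Submodule.span_induction with
    | mem y hy =>
      obtain ⟨n, m, a, -, rfl⟩ := hy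
      exact ⟨n + 1, fun p hp q => M.entryMap_matrixUnit_of_ne a (.inl (by omega))⟩
    | zero => exact ⟨0, fun p _ q => map_zero _⟩
    | add y z _ _ hy hz =>
      obtain ⟨N, hN⟩ := hy
      obtain ⟨M, hM⟩ := hz
      exact ⟨max N M, fun p hp q => by
        rw [map_add, hN p (le_of_max_le_left hp), hM p (le_of_max_le_right hp), add_zero]⟩
    | smul c y _ hy =>
      obtain ⟨N, hN⟩ := hy
      exact ⟨N, fun p hp q => by rw [map_smul, hN p hp, smul_zero]⟩
  obtain ⟨N, hN⟩ := h
  refine ⟨N, fun p hp q => ?_⟩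
  have h1 : M.entryMap p q x = M.entryMap p q (x - y) := by rw [map_sub, hN p hp, sub_zero]
  rw [h1]
  refine (M.norm_entryMap_le p q _).trans ?_
  rw [← dist_eq_norm]
  exact hxy.le

/-- A Toeplitz operator in the closed span has entries `a ⊗ 1^k` that lie in `J` and become small,
which is the criterion of `mem_reductionIdeal`. -/
theorem toeplitzRep_eq_zero {K : T.Ideal} {n m : ℕ} {a : K.space m n}
    (h : (M.toeplitzRep J K).map n m a = 0) : a.1 ∈ reductionIdeal J m n := by
  have hx : M.toeplitz n m a.1 ∈ M.unitSpan J := (M.toeplitzClass_eq_zero J).1 h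
  refine mem_reductionIdeal J (fun k => ?_) fun ε hε => ?_
  · have h1 := M.entryMap_mem hx (n + k) (m + k)
    rw [M.entryMap_apply, M.toeplitz_entry] at h1
    exact M.mem_of_matrixUnit_mem_map h1
  · obtain ⟨N, hN⟩ := M.exists_entryMap_le hx hε
    have h1 := hN (n + N) (by omega) (m + N)
    rw [M.entryMap_apply, M.toeplitz_entry, M.norm_matrixUnit] at h1
    exact ⟨N, h1⟩

/-- The entry at `(n,n)` decides: it is `a` for the Toeplitz operator of `a`, it vanishes for
Toeplitz operators starting at `n + j` with `j ≥ 1`, and it lies in `J` for every element divided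
out. -/
theorem toeplitzRep_mem {K : T.Ideal} {n k : ℕ} {a : K.space n n}
    (h : (M.toeplitzRep J K).map n n a ∈
      ⨆ j ∈ Finset.Icc 1 k, LinearMap.range ((M.toeplitzRep J K).map (n + j) (n + j))) :
    a.1 ∈ J.space n n := by
  set N : Submodule ℂ (M.unitIdealizer J) := ((J.space n n).map (M.matrixUnit n n)).comap
    (M.entryMap n n ∘ₗ (M.unitIdealizer J).toSubmodule.subtype)
  have hle : ⨆ j ∈ Finset.Icc 1 k, LinearMap.range ((M.toeplitzRep J K).map (n + j) (n + j)) ≤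
      N.map (M.unitIdeal J).mkₗ := by
    refine iSup₂_le fun j hj => ?_
    rintro _ ⟨b, rfl⟩
    refine ⟨⟨M.toeplitz (n + j) (n + j) b.1, M.toeplitz_mem_unitIdealizer J _⟩, ?_, rfl⟩
    change M.entryMap n n (M.toeplitz (n + j) (n + j) b.1) ∈ (J.space n n).map (M.matrixUnit n n)
    rw [Finset.mem_Icc] at hj
    rw [M.entryMap_apply, ← mul_assoc, M.entryProj_mul_toeplitz_of_lt _ (by omega), zero_mul]
    exact zero_mem _
  obtain ⟨x, hx, hxa⟩ := hle h
  have h1 : M.toeplitz n n a.1 - x.1 ∈ M.unitSpan J := (M.unitIdeal J).proj_eq_proj.1 hxa.symm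
  have h2 := add_mem (M.entryMap_mem h1 n n) hx
  change M.entryMap n n (M.toeplitz n n a.1 - x.1) + M.entryMap n n x.1 ∈
    (J.space n n).map (M.matrixUnit n n) at h2
  rw [← map_add, sub_add_cancel, M.entryMap_apply] at h2
  have h3 : M.entryProj n * (M.toeplitz n n a.1 * M.entryProj n) = M.matrixUnit n n a.1 :=
    M.toeplitz_entry n n 0 a.1
  rw [h3] at h2
  exact M.mem_of_matrixUnit_mem_map h2

end MatrixModel

end RightTensorPrecategory

/-! ### The kernel of the extension and the diagonal condition. -/

namespace CStarPrecategory

variable {Ob : Type v} {C : CStarPrecategory.{u, v} Ob}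

/-- An ideal contains `a` as soon as it contains `a* a`. -/
theorem Ideal.mem_of_adj_comp_self_mem (K : C.Ideal) {σ ρ : Ob} {a : C.Hom σ ρ}
    (hK : C.comp (C.adj a) a ∈ K.space σ σ) : a ∈ K.space σ ρ := by
  set h : C.EndAlg σ := C.comp (C.adj a) a with hh
  have hsa : IsSelfAdjoint h := by
    change C.adj (C.comp (C.adj a) a) = C.comp (C.adj a) a
    rw [C.adj_comp, C.adj_adj]
  rw [← SetLike.mem_coe, ← (K.isClosed_space σ ρ).closure_eq, Metric.mem_closure_iff]
  intro ε hε
  obtain ⟨f, hf1, hf2⟩ := approx_aux h hsa ((ε / 2) ^ 2) (by positivity)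
  set e : C.Hom σ σ := C.comp h f with he
  have heK : e ∈ K.space σ σ := K.mem_comp _ hK
  have hes : C.adj e = e := hf1
  refine ⟨C.comp a e, K.comp_mem _ heK, ?_⟩
  rw [dist_eq_norm]
  have key : C.comp (C.adj (a - C.comp a e)) (a - C.comp a e)
      = (h - h * (h * f) - (h * f) * h + (h * f) * h * (h * f) : C.EndAlg σ) := by
    change _ = C.comp (C.adj a) a - C.comp (C.comp (C.adj a) a) e
      - C.comp e (C.comp (C.adj a) a) + C.comp (C.comp e (C.comp (C.adj a) a)) e
    rw [C.adj_sub, C.adj_comp, hes, C.comp_sub, C.sub_comp, C.sub_comp]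
    simp only [C.comp_assoc]
    abel
  have h2 := C.norm_adj_comp_self (a - C.comp a e)
  rw [key] at h2
  have h3 : ‖a - C.comp a e‖ ^ 2 ≤ (ε / 2) ^ 2 := h2 ▸ hf2
  have h4 := abs_le_of_sq_le_sq h3 (by positivity)
  rw [abs_of_nonneg (norm_nonneg _)] at h4
  linarith

end CStarPrecategory

namespace RightTensorPrecategory

variable {T : RightTensorPrecategory.{u}} {K J : T.Ideal}

theorem diagSum_single_of_lt {n m : ℕ} (a : K.space m n) :
    ∀ {p : ℕ} (q : ℕ), p < n → diagSum K p q (single K n m a) = 0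
  | 0, q, h => by
    rw [diagSum, LinearMap.comp_apply, Representation.entry_single_ne _ _ _ _ h.ne', map_zero]
  | p + 1, 0, h => by
    rw [diagSum, LinearMap.comp_apply, Representation.entry_single_ne _ _ _ _ h.ne', map_zero]
  | p + 1, q + 1, h => by
    rw [diagSum, LinearMap.add_apply, LinearMap.comp_apply, LinearMap.comp_apply,
      Representation.entry_single_ne _ _ _ _ h.ne', map_zero,
      diagSum_single_of_lt a q (by omega), map_zero, add_zero]

theorem entry_single (n m : ℕ) (a : K.space m n) : entry K n m (single K n m a) = a :=
  DirectSum.of_eq_same _ _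

theorem diagSum_single_self : ∀ {n m : ℕ} (a : K.space m n),
    diagSum K n m (single K n m a) = a.1
  | 0, m, a => by rw [diagSum, LinearMap.comp_apply, entry_single]; rfl
  | n + 1, 0, a => by rw [diagSum, LinearMap.comp_apply, entry_single]; rfl
  | n + 1, m + 1, a => by
    rw [diagSum, LinearMap.add_apply, LinearMap.comp_apply, LinearMap.comp_apply, entry_single,
      diagSum_single_of_lt a m (by omega), map_zero, zero_add]
    rfl

/-- Since `J` is closed, a vanishing quotient norm means membership in `J`. -/
theorem mem_nullSpace {m n : ℕ} {a : diagMatrices K m n} :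
    a ∈ nullSpace K J m n ↔ diagSum K n m a.1 = 0 ∧ ∀ i ∈ Finset.Icc 1 (min m n),
      diagSum K (n - i) (m - i) a.1 ∈ J.space (m - i) (n - i) := by
  have hq : ∀ i, ‖(J.space (m - i) (n - i)).mkQ (diagSum K (n - i) (m - i) a.1)‖ = 0 ↔
      diagSum K (n - i) (m - i) a.1 ∈ J.space (m - i) (n - i) := by
    intro i
    have h := QuotientAddGroup.norm_mk_eq_zero_iff_mem_closure
      (S := (J.space (m - i) (n - i)).toAddSubgroup) (m := diagSum K (n - i) (m - i) a.1)
    refine h.trans ?_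
    change _ ∈ closure (J.space (m - i) (n - i) : Set (T.Hom (m - i) (n - i))) ↔ _
    rw [(J.isClosed_space (m - i) (n - i)).closure_eq, SetLike.mem_coe]
  constructor
  · intro ha
    have ha' : seminormJ K J m n a = 0 := ha
    refine ⟨?_, fun i hi => (hq i).1 (le_antisymm ?_ (norm_nonneg _))⟩
    · have hle : ‖diagSum K n m a.1‖ ≤ 0 := by
        rw [← ha']
        exact (le_sup_right (α := Seminorm ℂ (diagMatrices K m n)) :
          (normSeminorm ℂ (T.Hom m n)).comp (diagSum K n m ∘ₗ (diagMatrices K m n).subtype) ≤ _) a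
      exact norm_le_zero_iff.1 hle
    · rw [← ha']
      refine le_trans ?_ (le_sup_left (α := Seminorm ℂ (diagMatrices K m n)) a)
      exact Seminorm.le_finset_sup_apply (p := fun i =>
        (normSeminorm ℂ (T.Hom (m - i) (n - i) ⧸ J.space (m - i) (n - i))).comp
        ((J.space (m - i) (n - i)).mkQ ∘ₗ diagSum K (n - i) (m - i) ∘ₗ
        (diagMatrices K m n).subtype)) hi
  · rintro ⟨h0, h1⟩
    change seminormJ K J m n a = 0
    refine le_antisymm ?_ (apply_nonneg _ _)
    rw [seminormJ, Seminorm.sup_apply]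
    refine max_le (Seminorm.finset_sup_apply_le le_rfl fun i hi => ((hq i).2 (h1 i hi)).le) ?_
    change ‖diagSum K n m a.1‖ ≤ 0
    rw [h0, norm_zero]

namespace Representation

variable {B : Type w} [NonUnitalCStarAlgebra B] (π : Representation K B)

theorem continuous_map (n m : ℕ) : Continuous (π.map n m) :=
  AddMonoidHomClass.continuous_of_bound (π.map n m) 1 fun a => by
    rw [one_mul]; exact π.norm_map_le a

/-- Coisometry replaces `a` by `a ⊗ 1` as long as the element stays in `J`; after `k` replacements
it has become `0`. -/
theorem map_eq_zero_of_mem_saturationStep (hJ : ∀ m n, J.space m n ≤ idealJ K m n)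
    (hπ : π.IsCoisometricOn J) : ∀ (k : ℕ) {m n : ℕ} (a : T.Hom m n) (h : a ∈ K.space m n),
      a ∈ saturationStep J (fun _ _ => ⊥) k m n → π.map n m ⟨a, h⟩ = 0
  | 0, m, n, a, h, ha => by
    have h0 : a = 0 := ha
    have h1 : (⟨a, h⟩ : K.space m n) = 0 := Subtype.ext h0
    rw [h1, map_zero]
  | k + 1, m, n, a, h, ha => by
    rw [hπ n m a h (hJ m n ha.1).2 ha.1]
    exact map_eq_zero_of_mem_saturationStep hJ hπ k _ _ ha.2

/-- A representation which is coisometric on `J` vanishes on the reduction ideal. -/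
theorem map_eq_zero_of_mem_reductionIdeal (hJ : ∀ m n, J.space m n ≤ idealJ K m n)
    (hπ : π.IsCoisometricOn J) {m n : ℕ} (a : K.space m n) (ha : a.1 ∈ reductionIdeal J m n) :
    π.map n m a = 0 := by
  have hcl : IsClosed ((LinearMap.ker (π.map n m)).map (K.space m n).subtype : Set (T.Hom m n)) :=
    (K.isClosed_space m n).isClosedEmbedding_subtypeVal.isClosedMap _
      (isClosed_singleton.preimage (π.continuous_map n m))
  have hle : reductionIdeal J m n ≤ (LinearMap.ker (π.map n m)).map (K.space m n).subtype := by
    refine Submodule.topologicalClosure_minimal _ (iSup_le fun k b hb => ?_) hcl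
    have hbK : b ∈ K.space m n := by
      cases k with
      | zero =>
        have h0 : b = 0 := hb
        rw [h0]
        exact zero_mem _
      | succ k => exact (hJ m n hb.1).1
    exact ⟨⟨b, hbK⟩, π.map_eq_zero_of_mem_saturationStep hJ hπ k b hbK hb, rfl⟩
  obtain ⟨b, hb, hba⟩ := hle ha
  rw [← Subtype.ext hba]
  exact hb

theorem map_mem_iSup_of_mem (hJ : ∀ m n, J.space m n ≤ idealJ K m n)
    (hπ : π.IsCoisometricOn J) {n k : ℕ} (hk : 1 ≤ k) (a : K.space n n)
    (ha : a.1 ∈ J.space n n) :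
    π.map n n a ∈ ⨆ j ∈ Finset.Icc 1 k, LinearMap.range (π.map (n + j) (n + j)) := by
  refine Submodule.mem_iSup_of_mem 1 (Submodule.mem_iSup_of_mem (by simpa using hk) ?_)
  exact ⟨⟨T.tensor a.1, (hJ n n ha).2⟩, (hπ n n a.1 a.2 (hJ n n ha).2 ha).symm⟩

/-- The non-diagonal form of `DiagonalCondition`. -/
theorem mem_of_map_mem_iSup {π : Representation K B} (hD : π.DiagonalCondition J) {m n k : ℕ}
    (hk : 1 ≤ k)
    (a : K.space m n)
    (ha : π.map n m a ∈ ⨆ j ∈ Finset.Icc 1 k, LinearMap.range (π.map (n + j) (m + j))) :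
    a.1 ∈ J.space m n := by
  -- Multiplication by `π(a)*` moves the relation to the diagonal: the images of `K(m+j,n+j)` go to
  -- images of `K(m+j,m+j)`. The diagonal condition then gives `a* a ∈ J`, which suffices.
  refine J.mem_of_adj_comp_self_mem ?_
  set a' : K.space n m := ⟨T.adj a.1, K.adj_mem a.2⟩
  have hle : ⨆ j ∈ Finset.Icc 1 k, LinearMap.range (π.map (n + j) (m + j)) ≤
      (⨆ j ∈ Finset.Icc 1 k, LinearMap.range (π.map (m + j) (m + j))).comap
        (LinearMap.mulLeft ℂ (π.map m n a')) := by
    refine iSup₂_le fun j hj => ?_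
    rintro _ ⟨b, rfl⟩
    rw [Submodule.mem_comap, LinearMap.mulLeft_apply, π.map_tensor]
    exact Submodule.mem_iSup_of_mem j (Submodule.mem_iSup_of_mem hj ⟨_, rfl⟩)
  have h := hle ha
  rw [Submodule.mem_comap, LinearMap.mulLeft_apply, π.map_mul] at h
  have h1 : (⟨T.comp a'.1 a.1, K.comp_mem _ a.2⟩ : K.space m m) ∈
      (J.space m m).comap (K.space m m).subtype := by
    rw [hD m k hk]
    exact h
  exact h1

theorem extension_inclusion (hJ : ∀ m n, J.space m n ≤ idealJ K m n)
    (hπ : π.IsCoisometricOn J) {m n : ℕ} (a : K.space m n) :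
    π.extension hJ hπ n m (inclusion K J m n a) = π.map n m a :=
  π.matrixMap_single n m a

/-- If the sum of the images of the entries of a diagonal matrix vanishes, the partial sums lie
in `J`. -/
theorem diagSum_mem_of_matrixMap_eq_zero {π : Representation K B}
    (hJ : ∀ m n, J.space m n ≤ idealJ K m n)
    (hπ : π.IsCoisometricOn J) (hD : π.DiagonalCondition J) {m n : ℕ} {a : Matrices K}
    (ha : a ∈ diagMatrices K m n) (h0 : π.matrixMap a = 0) :
    ∀ (d i : ℕ), i + d = min m n → 1 ≤ i →
      diagSum K (n - i) (m - i) a ∈ J.space (m - i) (n - i) := by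
  intro d
  -- The induction runs from the end of the diagonal with the smallest indices, where `d = 0`. Once
  -- the previous partial sums lie in `J`, coisometry makes the image of the partial sum at `(n-i,
  -- m-i)` equal to the sum of the images of the entries up to that place. By the vanishing of the
  -- total, this is minus the sum of the images of the `i` entries further along, and the diagonal
  -- condition applies with `k = i`.
  induction d using Nat.strong_induction_on with
  | _ d ih =>
    intro i hid hi
    obtain ⟨h, hs⟩ := π.sum_eq_map_diagSum hJ hπ a (n - i) (m - i) (by
      intro t ht
      rw [Finset.mem_Icc] at ht
      rw [Nat.sub_sub, Nat.sub_sub]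
      exact ih (d - t) (by omega) (i + t) (by omega) (by omega))
    refine mem_of_map_mem_iSup hD hi ⟨_, h⟩ ?_
    let F : ℕ → ℕ → B := fun p q => π.map p q (entry K p q a)
    have hF : ∀ p q, F p q ∈ LinearMap.range (π.map p q) := fun p q => ⟨_, rfl⟩
    have hsum : ∑ t ∈ Finset.range i, F (n - t) (m - t) +
        ∑ t ∈ Finset.range (min (n - i) (m - i) + 1), F (n - i - t) (m - i - t) = 0 := by
      have hsplit := Finset.sum_range_add (fun t => F (n - t) (m - t)) i
        (min (n - i) (m - i) + 1)
      rw [show i + (min (n - i) (m - i) + 1) = min n m + 1 by omega] at hsplit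
      rw [← h0, π.matrixMap_eq ha]
      refine Eq.trans ?_ hsplit.symm
      simp only [Nat.sub_sub]
    have hs' : ∑ t ∈ Finset.range (min (n - i) (m - i) + 1), F (n - i - t) (m - i - t) =
      π.map (n - i) (m - i) ⟨_, h⟩ := hs
    rw [← hs', ← neg_eq_of_add_eq_zero_right hsum]
    refine neg_mem (Submodule.sum_mem _ fun t ht => ?_)
    rw [Finset.mem_range] at ht
    refine Submodule.mem_iSup_of_mem (i - t) (Submodule.mem_iSup_of_mem
      (by rw [Finset.mem_Icc]; omega) ?_)
    rw [show n - t = n - i + (i - t) by omega, show m - t = m - i + (i - t) by omega]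
    exact hF _ _

/-- From 3 to 4, a relation between `π_{nn}(a)` and later diagonal images is a matrix killed by
`π̃`, and its partial sum at `(n,n)` recovers `a` up to `J`. From 4 to 3, a matrix killed by `π̃` is
equivalent to its own total sum, placed at the last position. -/
theorem kerExtensionEq_iff (hJ : ∀ m n, J.space m n ≤ idealJ K m n)
    (hπ : π.IsCoisometricOn J) :
    π.KerExtensionEq hJ hπ ↔ π.KerEq J ∧ π.DiagonalCondition J := by
  constructor
  · intro H
    have hker : ∀ (n m : ℕ) (a : diagMatrices K m n), π.matrixMap a.1 = 0 →
        ∃ r : K.space m n, r.1 ∈ reductionIdeal J m n ∧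
          (⟨single K n m r, single_mem K m n r⟩ - a : diagMatrices K m n) ∈ nullSpace K J m n := by
      intro n m a ha
      have h : (Submodule.Quotient.mk a : quotientSpace K J m n) ∈
          LinearMap.ker (π.extension hJ hπ n m) := ha
      rw [H n m] at h
      obtain ⟨r, hr, hra⟩ := h
      exact ⟨r, hr, (Submodule.Quotient.eq _).1 hra⟩
    refine ⟨fun n m => le_antisymm (fun a ha => ?_)
      (fun a ha => π.map_eq_zero_of_mem_reductionIdeal hJ hπ a ha), fun n k hk =>
      le_antisymm (fun a ha => π.map_mem_iSup_of_mem hJ hπ hk a ha) (fun a ha => ?_)⟩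
    · obtain ⟨r, hr, hra⟩ := hker n m ⟨single K n m a, single_mem K m n a⟩
        ((π.matrixMap_single n m a).trans ha)
      have h := (mem_nullSpace.1 hra).1
      change diagSum K n m (single K n m r - single K n m a) = 0 at h
      rw [map_sub, diagSum_single_self, diagSum_single_self, sub_eq_zero] at h
      change a.1 ∈ reductionIdeal J m n
      rwa [← h]
    -- The right-hand side of the relation is lifted to a matrix supported strictly beyond `(n,n)`,
    -- so it does not contribute to the partial sum there.
    · have hle : ⨆ j ∈ Finset.Icc 1 k, LinearMap.range (π.map (n + j) (n + j)) ≤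
          (diagMatrices K (n + k) (n + k) ⊓ LinearMap.ker (diagSum K n n)).map π.matrixMap := by
        refine iSup₂_le fun j hj => ?_
        rw [Finset.mem_Icc] at hj
        rintro _ ⟨b, rfl⟩
        refine ⟨single K (n + j) (n + j) b, ⟨fun p q hpq => ?_, ?_⟩, π.matrixMap_single _ _ _⟩
        · have := single_mem K (n + j) (n + j) b p q hpq
          omega
        · exact diagSum_single_of_lt b n (by omega)
      obtain ⟨x, ⟨hx1, hx2⟩, hx3⟩ := hle ha
      have hx2' : diagSum K n n x = 0 := hx2
      have ha' : single K n n a ∈ diagMatrices K (n + k) (n + k) := fun p q hpq => by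
        have := single_mem K n n a p q hpq
        omega
      obtain ⟨r, hr, hra⟩ := hker (n + k) (n + k) ⟨single K n n a - x, sub_mem ha' hx1⟩ (by
        change π.matrixMap (single K n n a - x) = 0
        rw [map_sub, matrixMap_single, hx3, sub_self])
      -- Seen from the last place `(n+k, n+k)`, the index `k` is the place `(n,n)`. There the
      -- partial sum of the null matrix is `-a`.
      have h := (mem_nullSpace.1 hra).2 k (by rw [Finset.mem_Icc]; omega)
      have hsub : n + k - k = n := Nat.add_sub_cancel n k
      rw [hsub] at h
      change diagSum K n n (single K (n + k) (n + k) r - (single K n n a - x)) ∈ J.space n n at h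
      rw [map_sub, map_sub, diagSum_single_of_lt r n (by omega), hx2', diagSum_single_self,
        sub_zero, zero_sub] at h
      exact neg_mem_iff.1 h
  · rintro ⟨hK, hD⟩ n m
    refine le_antisymm (fun x hx => ?_) ?_
    · obtain ⟨a, rfl⟩ := Submodule.Quotient.mk_surjective _ x
      have h0 : π.matrixMap a.1 = 0 := hx
      have hmem : ∀ i ∈ Finset.Icc 1 (min m n),
          diagSum K (n - i) (m - i) a.1 ∈ J.space (m - i) (n - i) := fun i hi => by
        rw [Finset.mem_Icc] at hi
        exact diagSum_mem_of_matrixMap_eq_zero hJ hπ hD a.2 h0 (min m n - i) i (by omega) hi.1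
      obtain ⟨h, hs⟩ := π.sum_eq_map_diagSum hJ hπ a.1 n m hmem
      rw [← π.matrixMap_eq a.2, h0] at hs
      have hr : (⟨_, h⟩ : K.space m n) ∈ (reductionIdeal J m n).comap (K.space m n).subtype := by
        rw [← hK n m]
        exact hs.symm
      -- The difference between the total sum, put at `(n,m)`, and the matrix has last sum `0`. Its
      -- earlier partial sums are the negatives of those of the matrix, already known to lie in `J`.
      refine ⟨⟨_, h⟩, hr, (Submodule.Quotient.eq _).2 (mem_nullSpace.2 ⟨?_, fun i hi => ?_⟩)⟩
      · change diagSum K n m (single K n m ⟨_, h⟩ - a.1) = 0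
        rw [map_sub, diagSum_single_self, sub_self]
      · change diagSum K (n - i) (m - i) (single K n m ⟨_, h⟩ - a.1) ∈ _
        have hi' := Finset.mem_Icc.1 hi
        rw [map_sub, diagSum_single_of_lt _ _ (by omega), zero_sub]
        exact neg_mem (hmem i hi)
    · rintro _ ⟨r, hr, rfl⟩
      exact (π.extension_inclusion hJ hπ r).trans
        (π.map_eq_zero_of_mem_reductionIdeal hJ hπ r hr)

end Representation

end RightTensorPrecategory

/-! ### The `C*`-algebras formed by finite sums of diagonal images. -/

namespace RightTensorPrecategory

variable {T : RightTensorPrecategory.{u}} {K J : T.Ideal}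

namespace Representation

section Segments

variable {B : Type w} [NonUnitalCStarAlgebra B] (π : Representation K B)

/-- The elements `π_{nm}(a)`. -/
def generators : Set B := {b : B | ∃ (n m : ℕ) (a : K.space m n), π.map n m a = b}

theorem star_mem_generators {x : B} (hx : x ∈ π.generators) : star x ∈ π.generators := by
  obtain ⟨n, m, a, rfl⟩ := hx
  exact ⟨m, n, _, (π.map_adj n m a).symm⟩

/-- The tensor relation covers the case in which the inner index grows; the other case is its
adjoint. Therefore the linear span of the generators is already a `*`-algebra. -/
theorem mul_mem_generators {x y : B} (hx : x ∈ π.generators) (hy : y ∈ π.generators) :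
    x * y ∈ π.generators := by
  have key : ∀ {n m p q : ℕ} (a : K.space m n) (b : K.space q p), m ≤ p →
      π.map n m a * π.map p q b ∈ π.generators := by
    intro n m p q a b h
    obtain ⟨k, rfl⟩ := Nat.exists_eq_add_of_le h
    exact ⟨_, _, _, (π.map_tensor k q m n a b).symm⟩
  obtain ⟨n, m, a, rfl⟩ := hx
  obtain ⟨p, q, b, rfl⟩ := hy
  rcases le_total m p with h | h
  · exact key a b h
  · have h1 := π.star_mem_generators (key ⟨T.adj b.1, K.adj_mem b.2⟩ ⟨T.adj a.1, K.adj_mem a.2⟩ h)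
    rwa [← π.map_adj, ← π.map_adj, star_mul, star_star, star_star] at h1

/-- The linear span of the generators as a `*`-algebra. -/
def spanAlgebra : NonUnitalStarSubalgebra ℂ B where
  __ := Submodule.span ℂ π.generators
  mul_mem' {x y} hx hy := by
    have h1 : ∀ z ∈ π.generators, Submodule.span ℂ π.generators ≤
        (Submodule.span ℂ π.generators).comap (LinearMap.mulLeft ℂ z) := fun z hz =>
      Submodule.span_le.2 fun t ht => Submodule.subset_span (π.mul_mem_generators hz ht)
    have h2 : Submodule.span ℂ π.generators ≤
        (Submodule.span ℂ π.generators).comap (LinearMap.mulRight ℂ y) :=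
      Submodule.span_le.2 fun t ht => h1 t ht hy
    exact h2 hx
  star_mem' {x} hx := by
    change star x ∈ Submodule.span ℂ π.generators
    induction hx using Submodule.span_induction with
    | mem y hy => exact Submodule.subset_span (π.star_mem_generators hy)
    | zero => rw [star_zero]; exact zero_mem _
    | add y z _ _ hy hz => rw [star_add]; exact add_mem hy hz
    | smul c y _ hy => rw [star_smul]; exact Submodule.smul_mem _ _ hy

theorem generatedAlgebra_subset_closure :
    (π.generatedAlgebra : Set B) ⊆ closure (Submodule.span ℂ π.generators) := by
  have h : NonUnitalStarAlgebra.adjoin ℂ π.generators ≤ π.spanAlgebra :=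
    NonUnitalStarAlgebra.adjoin_le Submodule.subset_span
  exact closure_mono h

/-- The sum of the spaces `π_{jj}(K(j,j))` for `p ≤ j ≤ p + d`. -/
def segment (p : ℕ) : ℕ → Submodule ℂ B
  | 0 => LinearMap.range (π.map p p)
  | d + 1 => LinearMap.range (π.map p p) ⊔ segment (p + 1) d

theorem range_le_segment (p : ℕ) : ∀ d, LinearMap.range (π.map p p) ≤ π.segment p d
  | 0 => le_rfl
  | _ + 1 => le_sup_left

theorem range_le_segment_add : ∀ (d p i : ℕ), i ≤ d →
    LinearMap.range (π.map (p + i) (p + i)) ≤ π.segment p d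
  | d, p, 0, _ => π.range_le_segment p d
  | 0, _, i + 1, h => by omega
  | d + 1, p, i + 1, h => by
    refine le_trans ?_ le_sup_right
    have := range_le_segment_add d (p + 1) i (by omega)
    rwa [Nat.add_assoc, Nat.add_comm 1 i] at this

theorem segment_le_succ (p d : ℕ) : π.segment p d ≤ π.segment p (d + 1) := by
  induction d generalizing p with
  | zero => exact le_sup_left
  | succ d ih => exact sup_le_sup_left (ih (p + 1)) _

theorem segment_mono (p : ℕ) : Monotone (π.segment p) :=
  monotone_nat_of_le_succ (π.segment_le_succ p)

theorem segment_le_iSup {n k : ℕ} : ∀ (d q : ℕ), n + 1 ≤ q → q + d ≤ n + k →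
    π.segment q d ≤ ⨆ j ∈ Finset.Icc 1 k, LinearMap.range (π.map (n + j) (n + j)) := by
  have hr : ∀ q, n + 1 ≤ q → q ≤ n + k → LinearMap.range (π.map q q) ≤
      ⨆ j ∈ Finset.Icc 1 k, LinearMap.range (π.map (n + j) (n + j)) := by
    intro q h1 h2
    obtain ⟨j, rfl⟩ := Nat.exists_eq_add_of_le ((Nat.le_succ n).trans h1)
    exact le_iSup₂_of_le j (by rw [Finset.mem_Icc]; omega) le_rfl
  intro d
  induction d with
  | zero => exact fun q h1 h2 => hr q h1 h2
  | succ d ih => exact fun q h1 h2 => sup_le (hr q h1 (by omega)) (ih (q + 1) (by omega) (by omega))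

theorem star_mem_range (p : ℕ) {x : B} (hx : x ∈ LinearMap.range (π.map p p)) :
    star x ∈ LinearMap.range (π.map p p) := by
  obtain ⟨a, rfl⟩ := hx
  exact ⟨_, (π.map_adj p p a).symm⟩

theorem star_mem_segment : ∀ (d p : ℕ) {x : B}, x ∈ π.segment p d → star x ∈ π.segment p d
  | 0, p, _, hx => π.star_mem_range p hx
  | d + 1, p, x, hx => by
    obtain ⟨y, hy, z, hz, rfl⟩ := Submodule.mem_sup.1 hx
    rw [star_add]
    exact Submodule.add_mem_sup (π.star_mem_range p hy) (star_mem_segment d (p + 1) hz)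

/-- By the tensor relation, `π_{qq}` multiplies the image at a place `p ≥ q` into itself. Thus
`segment (p + 1) d` is an ideal in `segment p (d + 1)`. -/
theorem map_mul_mem_segment {q : ℕ} (a : K.space q q) : ∀ (d p : ℕ), q ≤ p → ∀ {x : B},
    x ∈ π.segment p d → π.map q q a * x ∈ π.segment p d
  | 0, p, h, _, hx => by
    obtain ⟨k, rfl⟩ := Nat.exists_eq_add_of_le h
    obtain ⟨b, rfl⟩ := hx
    exact ⟨_, (π.map_tensor k (q + k) q q a b).symm⟩
  | d + 1, p, h, _, hx => by
    obtain ⟨y, hy, z, hz, rfl⟩ := Submodule.mem_sup.1 hx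
    rw [mul_add]
    exact Submodule.add_mem_sup (map_mul_mem_segment a 0 p h hy)
      (map_mul_mem_segment a d (p + 1) (by omega) hz)

theorem mul_map_mem_segment {q : ℕ} (a : K.space q q) (d p : ℕ) (h : q ≤ p) {x : B}
    (hx : x ∈ π.segment p d) : x * π.map q q a ∈ π.segment p d := by
  have h1 := π.star_mem_segment d p
    (π.map_mul_mem_segment ⟨T.adj a.1, K.adj_mem a.2⟩ d p h (π.star_mem_segment d p hx))
  rwa [← π.map_adj, star_mul, star_star, star_star] at h1

theorem mul_mem_segment : ∀ (d p : ℕ) {x y : B}, x ∈ π.segment p d → y ∈ π.segment p d →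
    x * y ∈ π.segment p d
  | 0, p, _, _, hx, hy => by
    obtain ⟨a, rfl⟩ := hx
    exact π.map_mul_mem_segment a 0 p le_rfl hy
  | d + 1, p, _, _, hx, hy => by
    obtain ⟨_, ⟨a, rfl⟩, x, hx', rfl⟩ := Submodule.mem_sup.1 hx
    rw [add_mul]
    refine add_mem (π.map_mul_mem_segment a (d + 1) p le_rfl hy) ?_
    obtain ⟨_, ⟨b, rfl⟩, y, hy', rfl⟩ := Submodule.mem_sup.1 hy
    rw [mul_add]
    exact Submodule.mem_sup_right (add_mem (π.mul_map_mem_segment b d (p + 1) (by omega) hx')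
      (mul_mem_segment d (p + 1) hx' hy'))

/-- `segment p d` as a `*`-algebra. -/
def segmentAlgebra (p d : ℕ) : NonUnitalStarSubalgebra ℂ B where
  __ := π.segment p d
  mul_mem' hx hy := π.mul_mem_segment d p hx hy
  star_mem' hx := π.star_mem_segment d p hx

theorem isClosed_range_map (p : ℕ) : IsClosed (LinearMap.range (π.map p p) : Set B) :=
  (π.diagHom p).isClosed_range_of_cstar

/-- Each step adds the closed algebra at `p` to a closed ideal normalized by it. Closedness makes
the segments `C*`-algebras, on which injective `*`-homomorphisms are isometric. -/
theorem isClosed_segment : ∀ d p : ℕ, IsClosed (π.segment p d : Set B)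
  | 0, p => π.isClosed_range_map p
  | d + 1, p => by
    refine isClosed_sup_of_le_idealizer (π.segment (p + 1) d)
      (fun x hx => π.star_mem_segment d (p + 1) hx) (isClosed_segment d (p + 1))
      (fun x hx y hy => π.mul_mem_segment d (p + 1) hx hy) (π.segmentAlgebra p 0)
      (π.isClosed_range_map p) ?_
    rintro _ ⟨a, rfl⟩ x hx
    exact ⟨π.map_mul_mem_segment a d (p + 1) (by omega) hx,
      π.mul_map_mem_segment a d (p + 1) (by omega) hx⟩

end Segments

/-! ### Injectivity and isometry on segments. -/

section Intertwining

variable {O : Type v} [NonUnitalCStarAlgebra O] {B : Type w} [NonUnitalCStarAlgebra B]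
  {ι : Representation K O} {π : Representation K B} {Ψ : O →⋆ₙₐ[ℂ] B}

theorem apply_mem_segment (hΨ : ∀ n m a, Ψ (ι.map n m a) = π.map n m a) :
    ∀ (d p : ℕ) {x : O}, x ∈ ι.segment p d → Ψ x ∈ π.segment p d
  | 0, p, x, hx => by
    obtain ⟨a, rfl⟩ := hx
    exact ⟨a, (hΨ p p a).symm⟩
  | d + 1, p, x, hx => by
    obtain ⟨_, ⟨a, rfl⟩, y, hy, rfl⟩ := Submodule.mem_sup.1 hx
    rw [map_add]
    exact Submodule.add_mem_sup ⟨a, (hΨ p p a).symm⟩ (apply_mem_segment hΨ d (p + 1) hy)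

/-- In a sum killed by `Ψ`, the image under `π` of the first entry equals minus the image of the
later terms, so the diagonal condition puts this entry into `J`. Coisometry moves it to the next
place and shortens the segment. In the last segment the entry lies in the kernel of `π`, which is
`R_J` and is killed by every coisometric representation. -/
theorem eq_zero_of_mem_segment (hΨ : ∀ n m a, Ψ (ι.map n m a) = π.map n m a)
    (hJ : ∀ m n, J.space m n ≤ idealJ K m n) (hι : ι.IsCoisometricOn J)
    (hK : π.KerEq J) (hD : π.DiagonalCondition J) :
    ∀ (d p : ℕ) {x : O}, x ∈ ι.segment p d → Ψ x = 0 → x = 0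
  | 0, p, x, hx, h => by
    obtain ⟨a, rfl⟩ := hx
    rw [hΨ] at h
    have ha : a ∈ LinearMap.ker (π.map p p) := h
    rw [hK] at ha
    exact ι.map_eq_zero_of_mem_reductionIdeal hJ hι a ha
  | d + 1, p, x, hx, h => by
    obtain ⟨_, ⟨a, rfl⟩, y, hy, rfl⟩ := Submodule.mem_sup.1 hx
    have h1 := h
    rw [map_add, hΨ, add_eq_zero_iff_eq_neg] at h1
    have h2 : π.map p p a ∈ ⨆ j ∈ Finset.Icc 1 (d + 1),
        LinearMap.range (π.map (p + j) (p + j)) := by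
      rw [h1]
      exact neg_mem (π.segment_le_iSup d (p + 1) le_rfl (by omega)
        (apply_mem_segment hΨ d (p + 1) hy))
    have h3 : a.1 ∈ J.space p p := mem_of_map_mem_iSup hD (by omega) a h2
    refine eq_zero_of_mem_segment hΨ hJ hι hK hD d (p + 1) (add_mem ?_ hy) h
    refine ι.range_le_segment (p + 1) d ⟨⟨T.tensor a.1, (hJ p p h3).2⟩, ?_⟩
    exact (hι p p a.1 a.2 (hJ p p h3).2 h3).symm

/-- Injectivity alone would not pass to the closure of the union of the segments; equality of norms
does. -/
theorem norm_apply_of_mem_segment (hΨ : ∀ n m a, Ψ (ι.map n m a) = π.map n m a)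
    (hJ : ∀ m n, J.space m n ≤ idealJ K m n) (hι : ι.IsCoisometricOn J)
    (hK : π.KerEq J) (hD : π.DiagonalCondition J) {d p : ℕ} {x : O} (hx : x ∈ ι.segment p d) :
    ‖Ψ x‖ = ‖x‖ := by
  have hcl : IsClosed (ι.segmentAlgebra p d : Set O) := ι.isClosed_segment d p
  let f : ι.segmentAlgebra p d →⋆ₙₐ[ℂ] B :=
    Ψ.comp (NonUnitalStarSubalgebraClass.subtype (ι.segmentAlgebra p d))
  have hf : Function.Injective f := by
    refine (injective_iff_map_eq_zero f).2 fun y hy => Subtype.ext ?_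
    exact eq_zero_of_mem_segment hΨ hJ hι hK hD d p y.2 hy
  exact NonUnitalStarAlgHom.norm_map f hf ⟨x, hx⟩

end Intertwining

end Representation

end RightTensorPrecategory

/-! ### Circle actions and their spectral subspaces. -/

namespace RightTensorPrecategory

variable {T : RightTensorPrecategory.{u}} {K J : T.Ideal}

/-- A representation whose image generates the `C*`-algebra `O`, with a circle action `γ` such that
`γ_z(π_{nm}(a)) = z^{m-n} π_{nm}(a)`. -/
structure GaugedRepresentation (K : T.Ideal) (O : Type v) [NonUnitalCStarAlgebra O] where
  rep : Representation K O
  gauge : Circle → O →⋆ₙₐ[ℂ] O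
  gauge_map : ∀ (z : Circle) (n m : ℕ) (a : K.space m n),
    gauge z (rep.map n m a) = ((z ^ ((m : ℤ) - n) : Circle) : ℂ) • rep.map n m a
  dense : ∀ x : O, x ∈ closure (Submodule.span ℂ rep.generators : Set O)

namespace GaugedRepresentation

variable {O : Type v} [NonUnitalCStarAlgebra O] (G : GaugedRepresentation K O)

/-- The `k`-th spectral subspace of the circle action. -/
def spectral (k : ℤ) : Set O := {b | ∀ z : Circle, G.gauge z b = ((z ^ k : Circle) : ℂ) • b}

/-- The `k`-th spectral subspace as a subspace. -/
def spectralSubmodule (k : ℤ) : Submodule ℂ O where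
  carrier := G.spectral k
  add_mem' hb hc z := by rw [map_add, hb z, hc z, smul_add]
  zero_mem' z := by rw [map_zero, smul_zero]
  smul_mem' c b hb z := by rw [map_smul, hb z, smul_comm]

theorem sub_mem_spectral {k : ℤ} {b c : O} (hb : b ∈ G.spectral k) (hc : c ∈ G.spectral k) :
    b - c ∈ G.spectral k := (G.spectralSubmodule k).sub_mem hb hc

theorem map_mem_spectral (n m : ℕ) (a : K.space m n) :
    G.rep.map n m a ∈ G.spectral ((m : ℤ) - n) := fun z => G.gauge_map z n m a

theorem star_mul_self_mem_spectral {k : ℤ} {b : O} (hb : b ∈ G.spectral k) :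
    star b * b ∈ G.spectral 0 := fun z => by
  rw [map_mul, map_star, hb z, star_smul, smul_mul_smul_comm, zpow_zero, Circle.coe_one, one_smul,
    ← starRingEnd_apply, ← Circle.coe_inv_eq_conj, ← Circle.coe_mul, inv_mul_cancel,
    Circle.coe_one, one_smul]

/-- `*`-homomorphisms which agree on the image of the representation are equal. -/
theorem hom_ext {C : Type w} [NonUnitalCStarAlgebra C] {f g : O →⋆ₙₐ[ℂ] C}
    (h : ∀ n m (a : K.space m n), f (G.rep.map n m a) = g (G.rep.map n m a)) (x : O) :
    f x = g x := by
  have hcl : IsClosed {x | f x = g x} :=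
    isClosed_eq f.continuous_of_cstar g.continuous_of_cstar
  refine hcl.closure_subset_iff.2 (fun y hy => ?_) (G.dense x)
  change f y = g y
  induction hy using Submodule.span_induction with
  | mem y hy =>
    obtain ⟨n, m, a, rfl⟩ := hy
    exact h n m a
  | zero => rw [map_zero, map_zero]
  | add y z _ _ hy hz => rw [map_add, map_add, hy, hz]
  | smul c y _ hy => rw [map_smul, map_smul, hy]

/-- The group law is not part of the structure; it is inherited from the scalars on the generators.
-/
theorem gauge_gauge (z w : Circle) (x : O) : G.gauge z (G.gauge w x) = G.gauge (z * w) x := by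
  refine G.hom_ext (f := (G.gauge z).comp (G.gauge w)) (g := G.gauge (z * w)) (fun n m a => ?_) x
  change G.gauge z (G.gauge w _) = _
  rw [G.gauge_map, map_smul, G.gauge_map, G.gauge_map, smul_smul, ← Circle.coe_mul, mul_zpow,
    mul_comm]

theorem gauge_one (x : O) : G.gauge 1 x = x := by
  refine G.hom_ext (f := G.gauge 1) (g := NonUnitalStarAlgHom.id ℂ O) (fun n m a => ?_) x
  rw [G.gauge_map, one_zpow, Circle.coe_one, one_smul]
  rfl

/-- Orbits of elements in the span of the generators are trigonometric polynomials; contractivity of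
the action makes every orbit a uniform limit of these. -/
theorem continuous_gauge (x : O) : Continuous fun z => G.gauge z x := by
  refine continuous_of_uniform_approx_of_continuous fun U hU => ?_
  obtain ⟨ε, hε, hU⟩ := Metric.mem_uniformity_dist.1 hU
  obtain ⟨y, hy, hxy⟩ := Metric.mem_closure_iff.1 (G.dense x) ε hε
  refine ⟨fun z => G.gauge z y, ?_, fun z => hU ?_⟩
  · clear hxy
    induction hy using Submodule.span_induction with
    | mem y hy =>
      obtain ⟨n, m, a, rfl⟩ := hy
      have h : (fun z => G.gauge z (G.rep.map n m a)) =
          fun z => ((z ^ ((m : ℤ) - n) : Circle) : ℂ) • G.rep.map n m a :=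
        funext fun z => G.gauge_map z n m a
      rw [h]
      have hc : Continuous fun z : Circle => (z : ℂ) := by fun_prop
      exact (hc.comp (continuous_zpow _)).smul continuous_const
    | zero => simp only [map_zero]; exact continuous_const
    | add y z _ _ hy hz => simp only [map_add]; exact hy.add hz
    | smul c y _ hy => simp only [map_smul]; exact hy.const_smul c
  · rw [dist_eq_norm, ← map_sub]
    refine (NonUnitalStarAlgHom.norm_apply_le (G.gauge z) _).trans_lt ?_
    rwa [← dist_eq_norm]

/-! ### Fourier coefficients of the circle action -/

/-- The orbit of an element as a function on the additive circle. -/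
noncomputable def orbit (x : O) (t : UnitAddCircle) : O := G.gauge t.toCircle x

theorem continuous_orbit (x : O) : Continuous (G.orbit x) :=
  (G.continuous_gauge x).comp AddCircle.continuous_toCircle

theorem integrable_orbit (x : O) :
    MeasureTheory.Integrable (G.orbit x) AddCircle.haarAddCircle :=
  (G.continuous_orbit x).integrable_of_hasCompactSupport (HasCompactSupport.of_compactSpace _)

/-- The `k`-th Fourier coefficient of an element with respect to the circle action. -/
noncomputable def coeff (k : ℤ) (x : O) : O := fourierCoeff (G.orbit x) k

theorem coeff_add (k : ℤ) (x y : O) : G.coeff k (x + y) = G.coeff k x + G.coeff k y := by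
  have h : G.orbit (x + y) = G.orbit x + G.orbit y := funext fun t => map_add _ _ _
  rw [coeff, h, fourierCoeff.add (G.integrable_orbit x) (G.integrable_orbit y)]
  rfl

theorem coeff_smul (k : ℤ) (c : ℂ) (x : O) : G.coeff k (c • x) = c • G.coeff k x := by
  have h : G.orbit (c • x) = c • G.orbit x := funext fun t => map_smul (G.gauge _) _ _
  rw [coeff, h, fourierCoeff.const_smul]
  rfl

theorem norm_coeff_le (k : ℤ) (x : O) : ‖G.coeff k x‖ ≤ ‖x‖ := by
  have h := MeasureTheory.norm_integral_le_of_norm_le_const (μ := AddCircle.haarAddCircle)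
    (f := fun t : UnitAddCircle => fourier (-k) t • G.orbit x t) (C := ‖x‖)
    (Filter.Eventually.of_forall fun t => by
      rw [norm_smul, fourier_apply, Circle.norm_coe, one_mul]
      exact NonUnitalStarAlgHom.norm_apply_le _ x)
  rw [MeasureTheory.probReal_univ, mul_one] at h
  exact h

theorem coeff_of_mem_spectral {d : ℤ} {x : O} (hx : x ∈ G.spectral d) (k : ℤ) :
    G.coeff k x = if k = d then x else 0 := by
  have h : ∀ t : UnitAddCircle, fourier (-k) t • G.orbit x t =
      (fourier (-k) t • fourier d t : ℂ) • x := fun t => by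
    rw [orbit, hx, ← AddCircle.toCircle_zsmul, ← fourier_apply, smul_smul, smul_eq_mul]
  have h1 : G.coeff k x = fourierCoeff (T := 1) (fourier d) k • x := by
    rw [coeff, fourierCoeff, fourierCoeff, ← integral_smul_const]
    simp only [h]
  rw [h1, fourierCoeff_fourier, Pi.single_apply]
  split_ifs
  · rw [one_smul]
  · rw [zero_smul]

theorem map_coeff {F : Type w} [NormedAddCommGroup F] [NormedSpace ℂ F] [CompleteSpace F]
    (L : O →L[ℂ] F) (k : ℤ) (x : O) :
    L (G.coeff k x) = fourierCoeff (fun t => L (G.orbit x t)) k := by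
  rw [coeff, fourierCoeff, fourierCoeff, ← L.integral_comp_comm
    ((G.integrable_orbit x).fourier_smul (-k))]
  simp only [map_smul]

/-- Acting by `γ_s` translates the orbit, and invariance of the Haar measure turns the translation
into the character value at `s`. -/
theorem coeff_mem_spectral (k : ℤ) (x : O) : G.coeff k x ∈ G.spectral k := by
  intro z
  obtain ⟨s, rfl⟩ := (AddCircle.homeomorphCircle (T := 1) one_ne_zero).surjective z
  rw [AddCircle.homeomorphCircle_apply]
  let L : O →L[ℂ] O := ⟨(G.gauge s.toCircle : O →ₗ[ℂ] O), (G.gauge s.toCircle).continuous_of_cstar⟩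
  have h := G.map_coeff L k x
  change G.gauge s.toCircle (G.coeff k x) = _ at h
  rw [h, fourierCoeff]
  have h2 : ∀ t : UnitAddCircle, fourier (-k) t • L (G.orbit x t) =
      ((s.toCircle ^ k : Circle) : ℂ) • (fourier (-k) (s + t) • G.orbit x (s + t)) := fun t => by
    change fourier (-k) t • G.gauge s.toCircle (G.gauge t.toCircle x) =
      _ • (_ • G.gauge (s + t).toCircle x)
    rw [G.gauge_gauge, ← AddCircle.toCircle_add, smul_smul, ← AddCircle.toCircle_zsmul,
      ← fourier_apply]
    congr 1
    rw [fourier_apply, fourier_apply, fourier_apply, ← Circle.coe_mul, ← AddCircle.toCircle_add]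
    congr 3
    rw [smul_add, neg_smul, neg_smul]
    abel
  simp only [h2]
  rw [MeasureTheory.integral_smul, MeasureTheory.integral_add_left_eq_self
    (fun t : UnitAddCircle => fourier (-k) t • G.orbit x t) s]
  rfl

/-- An element whose Fourier coefficients vanish is zero. -/
theorem eq_zero_of_coeff {x : O} (h : ∀ k, G.coeff k x = 0) : x = 0 := by
  -- After applying a bounded functional, the orbit is a continuous scalar function with zero
  -- Fourier coefficients. Its series is trivially summable, so it converges to the function, which
  -- is therefore zero at `t = 0`.
  refine SeparatingDual.eq_zero_of_forall_dual_eq_zero (R := ℂ) fun L => ?_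
  let f : C(UnitAddCircle, ℂ) := ⟨fun t => L (G.orbit x t), L.continuous.comp (G.continuous_orbit x)⟩
  have hf : fourierCoeff f = 0 := funext fun k => by
    have := G.map_coeff L k x
    rw [h k, map_zero] at this
    exact this.symm
  have hs : Summable (fourierCoeff f) := by rw [hf]; exact summable_zero
  have h1 := has_pointwise_sum_fourier_series_of_summable hs 0
  simp only [hf, Pi.zero_apply, zero_smul] at h1
  have h2 : f 0 = L x := by
    change L (G.gauge (AddCircle.toCircle 0) x) = L x
    rw [AddCircle.toCircle_zero, G.gauge_one]
  rw [← h2]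
  exact h1.unique hasSum_zero

/-- The zeroth coefficient keeps generators with `n = m` and annihilates the others; the remaining
finitely many diagonal terms lie in one segment. -/
theorem exists_coeff_mem_segment {x : O} (hx : x ∈ Submodule.span ℂ G.rep.generators) :
    ∃ d, G.coeff 0 x ∈ G.rep.segment 0 d := by
  induction hx using Submodule.span_induction with
  | mem y hy =>
    obtain ⟨n, m, a, rfl⟩ := hy
    rw [G.coeff_of_mem_spectral (G.map_mem_spectral n m a)]
    split_ifs with h
    · obtain rfl : m = n := by omega
      have h1 := G.rep.range_le_segment_add m 0 m le_rfl
      rw [Nat.zero_add] at h1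
      exact ⟨m, h1 ⟨a, rfl⟩⟩
    · exact ⟨0, zero_mem _⟩
  | zero =>
    have h : G.coeff 0 (0 : O) = 0 := by simpa using G.coeff_smul 0 0 0
    exact ⟨0, by rw [h]; exact zero_mem _⟩
  | add y z _ _ hy hz =>
    obtain ⟨d, hd⟩ := hy
    obtain ⟨e, he⟩ := hz
    rw [coeff_add]
    exact ⟨max d e, add_mem (G.rep.segment_mono 0 (le_max_left d e) hd)
      (G.rep.segment_mono 0 (le_max_right d e) he)⟩
  | smul c y _ hy =>
    obtain ⟨d, hd⟩ := hy
    rw [coeff_smul]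
    exact ⟨d, Submodule.smul_mem _ _ hd⟩

/-- The zeroth Fourier coefficient is a contractive projection onto the degree zero part. It fixes
`b` and maps approximants from the span into segments. -/
theorem exists_segment_near {b : O} (hb : b ∈ G.spectral 0) {ε : ℝ} (hε : 0 < ε) :
    ∃ d, ∃ x ∈ G.rep.segment 0 d, ‖b - x‖ < ε := by
  obtain ⟨y, hy, hby⟩ := Metric.mem_closure_iff.1 (G.dense b) ε hε
  obtain ⟨d, hd⟩ := G.exists_coeff_mem_segment hy
  refine ⟨d, _, hd, ?_⟩
  have h1 : G.coeff 0 b = b := by rw [G.coeff_of_mem_spectral hb, if_pos rfl]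
  have h2 : G.coeff 0 (b - y) = b - G.coeff 0 y := by
    rw [sub_eq_add_neg, ← neg_one_smul ℂ y, coeff_add, coeff_smul, h1, neg_one_smul,
      ← sub_eq_add_neg]
  rw [← h2]
  refine (G.norm_coeff_le 0 _).trans_lt ?_
  rwa [← dist_eq_norm]

/-! ### Faithfulness on the spectral subspaces -/

variable {G} {B : Type w} [NonUnitalCStarAlgebra B] {π : Representation K B} {Ψ : O →⋆ₙₐ[ℂ] B}

theorem injOn_spectral_iff {k : ℤ} :
    Set.InjOn Ψ (G.spectral k) ↔ ∀ b ∈ G.spectral k, Ψ b = 0 → b = 0 := by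
  constructor
  · intro h b hb hb0
    refine h hb (fun z => ?_) (hb0.trans (map_zero Ψ).symm)
    rw [map_zero, smul_zero]
  · intro h b hb c hc hbc
    refine sub_eq_zero.1 (h _ (G.sub_mem_spectral hb hc) ?_)
    rw [map_sub, hbc, sub_self]

/-- If `Ψ b = 0`, then `b* b` is a degree zero element of the kernel. -/
theorem injOn_spectral_of_zero (h : Set.InjOn Ψ (G.spectral 0)) (k : ℤ) :
    Set.InjOn Ψ (G.spectral k) := by
  rw [injOn_spectral_iff] at h ⊢
  intro b hb hb0
  refine (CStarRing.star_mul_self_eq_zero_iff b).1 (h _ (G.star_mul_self_mem_spectral hb) ?_)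
  rw [map_mul, hb0, mul_zero]

/-- For `b` in the kernel and `x` in a segment near `b`, isometry gives `‖x‖ = ‖Ψ x‖ ≤ ‖b - x‖`,
hence `‖b‖ ≤ 2 ‖b - x‖`. -/
theorem injOn_spectral_zero (hΨ : ∀ n m a, Ψ (G.rep.map n m a) = π.map n m a)
    (hJ : ∀ m n, J.space m n ≤ idealJ K m n) (hG : G.rep.IsCoisometricOn J)
    (hK : π.KerEq J) (hD : π.DiagonalCondition J) : Set.InjOn Ψ (G.spectral 0) := by
  rw [injOn_spectral_iff]
  intro b hb hb0
  rw [← norm_le_zero_iff]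
  refine le_of_forall_pos_le_add fun ε hε => ?_
  obtain ⟨d, x, hx, hbx⟩ := G.exists_segment_near hb (half_pos hε)
  have h1 := Representation.norm_apply_of_mem_segment hΨ hJ hG hK hD hx
  have h2 : ‖Ψ x‖ ≤ ‖b - x‖ := by
    have := NonUnitalStarAlgHom.norm_apply_le Ψ (b - x)
    rwa [map_sub, hb0, zero_sub, norm_neg] at this
  have h3 : ‖b‖ ≤ ‖b - x‖ + ‖x‖ := by simpa using norm_add_le (b - x) x
  linarith

/-- The test representation `ρ` factors through `O`, so relations in `O` hold in `ρ`. Faithfulness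
lifts relations of `π` to `O`, and `hρ`, `hρ'` state what they imply in `ρ`. -/
theorem kerEq_and_diagonalCondition (hΨ : ∀ n m a, Ψ (G.rep.map n m a) = π.map n m a)
    (hJ : ∀ m n, J.space m n ≤ idealJ K m n) (hπ : π.IsCoisometricOn J)
    {C : Type*} [NonUnitalCStarAlgebra C] {ρ : Representation K C} {Θ : O →⋆ₙₐ[ℂ] C}
    (hΘ : ∀ n m a, Θ (G.rep.map n m a) = ρ.map n m a)
    (hρ : ∀ (n m : ℕ) (a : K.space m n), ρ.map n m a = 0 → a.1 ∈ reductionIdeal J m n)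
    (hρ' : ∀ (n k : ℕ) (a : K.space n n), ρ.map n n a ∈
      ⨆ j ∈ Finset.Icc 1 k, LinearMap.range (ρ.map (n + j) (n + j)) → a.1 ∈ J.space n n)
    (h : Set.InjOn Ψ (G.spectral 0)) : π.KerEq J ∧ π.DiagonalCondition J := by
  constructor
  · refine fun n m => le_antisymm (fun a ha => hρ n m a ?_)
      (fun a ha => π.map_eq_zero_of_mem_reductionIdeal hJ hπ a ha)
    have h1 := injOn_spectral_iff.1 (injOn_spectral_of_zero h _) _ (G.map_mem_spectral n m a)
      ((hΨ n m a).trans ha)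
    rw [← hΘ, h1, map_zero]
  · refine fun n k hk => le_antisymm (fun a ha => π.map_mem_iSup_of_mem hJ hπ hk a ha)
      (fun a ha => hρ' n k a ?_)
    have hle : ⨆ j ∈ Finset.Icc 1 k, LinearMap.range (π.map (n + j) (n + j)) ≤
        (⨆ j ∈ Finset.Icc 1 k, LinearMap.range (G.rep.map (n + j) (n + j))).map
          (Ψ : O →ₗ[ℂ] B) := by
      refine iSup₂_le fun j hj => ?_
      rintro _ ⟨b, rfl⟩
      exact ⟨G.rep.map (n + j) (n + j) b,
        Submodule.mem_iSup_of_mem j (Submodule.mem_iSup_of_mem hj ⟨b, rfl⟩), hΨ _ _ b⟩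
    have hle' : ⨆ j ∈ Finset.Icc 1 k, LinearMap.range (G.rep.map (n + j) (n + j)) ≤
        (⨆ j ∈ Finset.Icc 1 k, LinearMap.range (ρ.map (n + j) (n + j))).comap
          (Θ : O →ₗ[ℂ] C) := by
      refine iSup₂_le fun j hj => ?_
      rintro _ ⟨b, rfl⟩
      refine Submodule.mem_iSup_of_mem j (Submodule.mem_iSup_of_mem hj ⟨b, ?_⟩)
      exact (hΘ _ _ b).symm
    have hspec : ⨆ j ∈ Finset.Icc 1 k, LinearMap.range (G.rep.map (n + j) (n + j)) ≤
        G.spectralSubmodule 0 := by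
      refine iSup₂_le fun j _ => ?_
      rintro _ ⟨b, rfl⟩
      have := G.map_mem_spectral (n + j) (n + j) b
      rwa [sub_self] at this
    obtain ⟨x, hx, hxa⟩ := hle ha
    have h1 : G.rep.map n n a = x := by
      refine h ?_ (hspec hx) ((hΨ n n a).trans hxa.symm)
      have := G.map_mem_spectral n n a
      rwa [sub_self] at this
    rw [← hΘ, h1]
    exact hle' hx

/-- If the kernel of `Ψ` is invariant under the circle action and `Ψ` is faithful on the spectral
subspaces, then `Ψ` is faithful. -/
theorem injective_of_injOn_spectral (h : ∀ k, Set.InjOn Ψ (G.spectral k))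
    (hinv : ∀ z b, Ψ b = 0 → Ψ (G.gauge z b) = 0) : Function.Injective Ψ := by
  refine (injective_iff_map_eq_zero Ψ).2 fun b hb => G.eq_zero_of_coeff fun k => ?_
  refine injOn_spectral_iff.1 (h k) _ (G.coeff_mem_spectral k b) ?_
  let L : O →L[ℂ] B := ⟨(Ψ : O →ₗ[ℂ] B), Ψ.continuous_of_cstar⟩
  have h1 := G.map_coeff L k b
  change Ψ (G.coeff k b) = _ at h1
  have h2 : (fun t => L (G.orbit b t)) = fun _ => 0 := funext fun t => hinv _ b hb
  rw [h1, h2, fourierCoeff]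
  simp

variable (G) in
theorem apply_mem_generatedAlgebra (hΨ : ∀ n m a, Ψ (G.rep.map n m a) = π.map n m a) (x : O) :
    Ψ x ∈ π.generatedAlgebra := by
  have hcl : IsClosed {x | Ψ x ∈ (π.generatedAlgebra : Set B)} :=
    (inferInstance : IsClosed (π.generatedAlgebra : Set B)).preimage Ψ.continuous_of_cstar
  refine hcl.closure_subset_iff.2 (fun y hy => ?_) (G.dense x)
  change Ψ y ∈ π.generatedAlgebra
  induction hy using Submodule.span_induction with
  | mem y hy =>
    obtain ⟨n, m, a, rfl⟩ := hy
    rw [hΨ]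
    exact π.map_mem_generatedAlgebra a
  | zero => rw [map_zero]; exact zero_mem _
  | add y z _ _ hy hz => rw [map_add]; exact add_mem hy hz
  | smul c y _ hy => rw [map_smul]; exact SMulMemClass.smul_mem c hy

theorem apply_gauge_eq_zero (hΨ : ∀ n m a, Ψ (G.rep.map n m a) = π.map n m a)
    (hg : π.AdmitsGaugeAction) (z : Circle) {b : O} (hb : Ψ b = 0) : Ψ (G.gauge z b) = 0 := by
  -- The conventions are opposite: `β_z` scales by `z^{n-m}` and `γ_z` by `z^{m-n}`, so `γ_z` is
  -- intertwined with `β_{z⁻¹}`.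
  obtain ⟨β, hβ⟩ := hg z⁻¹
  let Φ : O →⋆ₙₐ[ℂ] π.generatedAlgebra :=
    NonUnitalStarAlgHom.codRestrict Ψ _ (G.apply_mem_generatedAlgebra hΨ)
  have hΦ : ∀ n m a, Φ (G.rep.map n m a) = ⟨π.map n m a, π.map_mem_generatedAlgebra a⟩ :=
    fun n m a => Subtype.ext (hΨ n m a)
  have h := G.hom_ext (f := Φ.comp (G.gauge z)) (g := β.comp Φ) (fun n m a => by
    change Φ (G.gauge z _) = β (Φ _)
    rw [G.gauge_map, map_smul, hΦ, hβ, inv_zpow, ← zpow_neg, neg_sub]) b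
  change Φ (G.gauge z b) = β (Φ b) at h
  have hb' : Φ b = 0 := Subtype.ext hb
  rw [hb', map_zero] at h
  exact congrArg Subtype.val h

/-- Since the range of `Ψ` is closed, an injective `Ψ` identifies `O` with `C*(π)`, and `γ_{z⁻¹}`
can be transported. -/
theorem admitsGaugeAction_of_injective (hΨ : ∀ n m a, Ψ (G.rep.map n m a) = π.map n m a)
    (hinj : Function.Injective Ψ) : π.AdmitsGaugeAction := by
  intro z
  let Φ : O →⋆ₙₐ[ℂ] π.generatedAlgebra :=
    NonUnitalStarAlgHom.codRestrict Ψ _ (G.apply_mem_generatedAlgebra hΨ)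
  have hΦ : ∀ n m a, Φ (G.rep.map n m a) = ⟨π.map n m a, π.map_mem_generatedAlgebra a⟩ :=
    fun n m a => Subtype.ext (hΨ n m a)
  have hbij : Function.Bijective Φ := by
    refine ⟨fun x y h => hinj (congrArg Subtype.val h), fun y => ?_⟩
    have hle : π.generatedAlgebra ≤ NonUnitalStarAlgHom.range Ψ := by
      refine NonUnitalStarSubalgebra.topologicalClosure_minimal _
        (NonUnitalStarAlgebra.adjoin_le ?_) Ψ.isClosed_range_of_cstar
      rintro _ ⟨n, m, a, rfl⟩
      exact ⟨_, hΨ n m a⟩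
    obtain ⟨x, hx⟩ := hle y.2
    exact ⟨x, Subtype.ext hx⟩
  let e := StarAlgEquiv.ofBijective Φ hbij
  refine ⟨Φ.comp ((G.gauge z⁻¹).comp (e.symm : π.generatedAlgebra →⋆ₙₐ[ℂ] O)), fun n m a => ?_⟩
  change Φ (G.gauge z⁻¹ (e.symm _)) = _
  have he : e.symm ⟨π.map n m a, π.map_mem_generatedAlgebra a⟩ = G.rep.map n m a := by
    rw [← hΦ]
    exact e.symm_apply_apply _
  rw [he, G.gauge_map, map_smul, hΦ, inv_zpow, ← zpow_neg, neg_sub]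

end GaugedRepresentation

end RightTensorPrecategory

/-! ### The universal algebra and the equivalence of the four conditions. -/

namespace RightTensorPrecategory

variable {T : RightTensorPrecategory.{u}}

/-- This moves density of the span from the ambient algebra to `UnivAlg K J`, whose generators are
elements of a subtype. -/
theorem coe_mem_span_generators_ambientRep (K J : T.Ideal) {y : AmbientAlg K J}
    (hy : y ∈ Submodule.span ℂ (ambientRep K J).generators) :
    ∃ h : y ∈ (ambientRep K J).generatedAlgebra,
      (⟨y, h⟩ : (ambientRep K J).generatedAlgebra) ∈
        (Submodule.span ℂ (univRep K J).generators : Submodule ℂ (UnivAlg K J)) := by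
  induction hy using Submodule.span_induction with
  | mem y hy =>
    obtain ⟨n, m, a, rfl⟩ := hy
    exact ⟨(ambientRep K J).map_mem_generatedAlgebra a, Submodule.subset_span ⟨n, m, a, rfl⟩⟩
  | zero => exact ⟨zero_mem _, Submodule.zero_mem _⟩
  | add y z _ _ hy hz =>
    obtain ⟨h, hy⟩ := hy
    obtain ⟨h', hz⟩ := hz
    exact ⟨add_mem h h', Submodule.add_mem _ hy hz⟩
  | smul c y _ hy =>
    obtain ⟨h, hy⟩ := hy
    exact ⟨SMulMemClass.smul_mem c h, Submodule.smul_mem _ c hy⟩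

theorem mem_closure_span_generators_univRep (K J : T.Ideal) (x : UnivAlg K J) :
    x ∈ closure (Submodule.span ℂ (univRep K J).generators : Set (UnivAlg K J)) := by
  refine Metric.mem_closure_iff.2 fun ε hε => ?_
  obtain ⟨y, hy, hxy⟩ := Metric.mem_closure_iff.1
    ((ambientRep K J).generatedAlgebra_subset_closure x.2) ε hε
  obtain ⟨h, hy⟩ := coe_mem_span_generators_ambientRep K J hy
  exact ⟨⟨y, h⟩, hy, hxy⟩

/-- The universal representation with its gauge action. -/
noncomputable def univGauged (K J : T.Ideal) : GaugedRepresentation K (UnivAlg K J) where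
  rep := univRep K J
  gauge := gauge K J
  gauge_map := gauge_univRep K J
  dense := mem_closure_span_generators_univRep K J

namespace Representation

variable {K J : T.Ideal} {B : Type u} [NonUnitalCStarAlgebra B] {π : Representation K B}

theorem tfae_faithfulOnSpectral (hJ : ∀ m n, J.space m n ≤ idealJ K m n)
    (hπ : π.IsCoisometricOn J) :
    List.TFAE [
      π.FaithfulOnSpectral hπ 0,
      ∀ k : ℤ, π.FaithfulOnSpectral hπ k,
      π.KerExtensionEq hJ hπ,
      π.KerEq J ∧ π.DiagonalCondition J] := by
  tfae_have 1 → 2 := fun h k =>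
    GaugedRepresentation.injOn_spectral_of_zero (G := univGauged K J) h k
  tfae_have 2 → 1 := fun h => h 0
  -- The Toeplitz quotient lies in the universe `u` over which the direct sum defining `O_T(K,J)`
  -- runs, so it is one of its components and serves as the test representation.
  tfae_have 1 → 4 := fun h =>
    GaugedRepresentation.kerEq_and_diagonalCondition (G := univGauged K J)
      (integrated_univRep π hπ) hJ hπ
      (integrated_univRep ((columnModel T).toeplitzRep J K)
        ((columnModel T).toeplitzRep_isCoisometricOn J K))
      (fun _ _ _ => (columnModel T).toeplitzRep_eq_zero)
      (fun _ _ _ => (columnModel T).toeplitzRep_mem) h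
  tfae_have 4 → 1 := fun h =>
    GaugedRepresentation.injOn_spectral_zero (G := univGauged K J)
      (integrated_univRep π hπ) hJ (univRep_isCoisometricOn K J) h.1 h.2
  tfae_have 3 ↔ 4 := π.kerExtensionEq_iff hJ hπ
  tfae_finish

theorem injective_integrated (hπ : π.IsCoisometricOn J) (hg : π.AdmitsGaugeAction)
    (h : π.FaithfulOnSpectral hπ 0) : Function.Injective (integrated π hπ) :=
  GaugedRepresentation.injective_of_injOn_spectral (G := univGauged K J)
    (GaugedRepresentation.injOn_spectral_of_zero h)
    fun z _ => GaugedRepresentation.apply_gauge_eq_zero (G := univGauged K J)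
      (integrated_univRep π hπ) hg z

end Representation

end RightTensorPrecategory

theorem mainTheorem4 (T : RightTensorPrecategory.{u}) (K J : T.Ideal)
    (hJ : ∀ m n : ℕ, J.space m n ≤ RightTensorPrecategory.idealJ K m n)
    {B : Type u} [NonUnitalCStarAlgebra B]
    (π : RightTensorPrecategory.Representation K B) (hπ : π.IsCoisometricOn J) :
    List.TFAE [
      π.FaithfulOnSpectral hπ 0,
      ∀ k : ℤ, π.FaithfulOnSpectral hπ k,
      π.KerExtensionEq hJ hπ,
      π.KerEq J ∧ π.DiagonalCondition J] ∧
    (Function.Injective (RightTensorPrecategory.integrated π hπ) ↔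
      π.AdmitsGaugeAction ∧
        (π.FaithfulOnSpectral hπ 0 ∨
          (∀ k : ℤ, π.FaithfulOnSpectral hπ k) ∨
          π.KerExtensionEq hJ hπ ∨
          (π.KerEq J ∧ π.DiagonalCondition J))) := by
  have h := π.tfae_faithfulOnSpectral hJ hπ
  refine ⟨h, fun hinj => ⟨?_, Or.inl hinj.injOn⟩, fun ⟨hg, h'⟩ => ?_⟩
  · exact RightTensorPrecategory.GaugedRepresentation.admitsGaugeAction_of_injective
      (G := RightTensorPrecategory.univGauged K J)
      (RightTensorPrecategory.integrated_univRep π hπ) hinj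
  · refine π.injective_integrated hπ hg ?_
    rcases h' with h' | h' | h' | h'
    · exact h'
    · exact h' 0
    · exact (h.out 0 2).2 h'
    · exact (h.out 0 3).2 h'
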